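/- **Proposition 3.2.** Let $(\chi,\varphi)$ be a dyadic partition of unity of $\mathbb R^3$: $\chi\in\mathcal D(\mathbb R^3)$ and $\varphi\in\mathcal D(\mathbb R^3\setminus\{0\})$ are nonnegative and radial, $\chi(\xi)+\sum_{q\in\mathbb N}\varphi(2^{-q}\xi)=1$ and $\frac13\le\chi^2(\xi)+\sum_{q\in\mathbb N}\varphi^2(2^{-q}\xi)\le1$ for all $\xi$, $\operatorname{supp}\varphi(2^{-p}\cdot)\cap\operatorname{supp}\varphi(2^{-q}\cdot)=\emptyset$ if $|p-q|\ge2$, and $\operatorname{supp}\chi\cap\operatorname{supp}\varphi(2^{-q}\cdot)=\emptyset$ if $q\ge1$. Put $\Delta_{-1}=\chi(D)$ and $\Delta_q=\varphi(2^{-q}D)$ for $q\in\mathbb N$ (Fourier multipliers on tempered distributions). For $x=(x_1,x_2,z)\in\mathbb R^3$ write $x_h=(x_1,x_2)$ and $r=(x_1^2+x_2^2)^{1/2}$, and let $e_r=(x_1/r,x_2/r,0)$, $e_\theta=(-x_2/r,x_1/r,0)$, $e_z=(0,0,1)$. Let $L^{3,1}$ be the Lorentz space on $\mathbb R^3$ with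 the real interpolation norm of $(L^1,L^\infty)_{2/3,1}$. There is a constant $C>0$, depending only on $(\chi,\varphi)$, such that the following holds. Let $v:\mathbb R^3\to\mathbb R^3$ be a $C^1$ vector field in $L^2$ which is divergence free and axisymmetric without swirl, that is, $v(x)=v^r(r,z)e_r+v^z(r,z)e_z$ off the axis $r=0$, and let $\omega_\theta=(\operatorname{curl}v)\cdot e_\theta$. Let $\rho:\mathbb R^3\to\mathbb R$ be a $C^1$ function in $L^2$. Then the function $v\cdot\nabla\rho$ defines a tempered distribution, and for every $q\in\mathbb N\cup\{-1\}$ the commutator $[\Delta_q,v\cdot\nabla]\rho=\Delta_q(v\cdot\nabla\rho)-v\cdot\nabla(\Delta_q\rho)$ is a function and satisfies $$\|[\Delta_q,v\cdot\nabla]\rho\|_{L^2}\le C\,\|\omega_\theta/r\|_{L^{3,1}}\bigl(\|\rho\,x_h\|_{L^6}+\|\rho\|_{L^2}\bigr)$$ (where the right-hand side may be $+\infty$, and $0\cdot\infty=0$). -/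

import Mathlib

open MeasureTheory
open scoped ENNReal SchwartzMap ContDiff

noncomputable section

namespace AxiBoussinesq

/-- The Euclidean space `ℝ³`; the coordinates `x₁, x₂, z` are `x 0, x 1, x 2`. -/
abbrev E3 : Type := EuclideanSpace ℝ (Fin 3)

/-! ### Cylindrical coordinates and vector calculus -/

/-- The distance to the vertical axis, `r = (x₁² + x₂²)^{1/2}`. -/
def rad (x : E3) : ℝ := Real.sqrt (x 0 ^ 2 + x 1 ^ 2)

/-- The horizontal part `x_h = (x₁, x₂)`. -/
def horiz (x : E3) : EuclideanSpace ℝ (Fin 2) := !₂[x 0, x 1]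

/-- The radial unit vector `e_r` (off the axis). -/
def eR (x : E3) : E3 := !₂[x 0 / rad x, x 1 / rad x, 0]

/-- The angular unit vector `e_θ` (off the axis). -/
def eTheta (x : E3) : E3 := !₂[-(x 1) / rad x, x 0 / rad x, 0]

/-- The vertical unit vector `e_z`. -/
def eZ : E3 := !₂[0, 0, 1]

/-- `v = v^r(r, z) e_r + v^z(r, z) e_z`. The formula is required off the axis only, where `e_r` is
defined; for continuous `v` it determines `v` on the axis as well. -/
def IsAxisymmetricNoSwirl (v : E3 → E3) : Prop :=
  ∃ vr vz : ℝ → ℝ → ℝ, ∀ x : E3, rad x ≠ 0 →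
    v x = vr (rad x) (x 2) • eR x + vz (rad x) (x 2) • eZ

/-- The partial derivative `∂_i v^j` at `x`. -/
def pderiv (i j : Fin 3) (v : E3 → E3) (x : E3) : ℝ :=
  fderiv ℝ v x (EuclideanSpace.single i 1) j

/-- The divergence of a vector field. -/
def divergence (v : E3 → E3) (x : E3) : ℝ := ∑ i, pderiv i i v x

/-- The vorticity `ω = curl v`. -/
def curl (v : E3 → E3) (x : E3) : E3 :=
  !₂[pderiv 1 2 v x - pderiv 2 1 v x,
     pderiv 2 0 v x - pderiv 0 2 v x,
     pderiv 0 1 v x - pderiv 1 0 v x]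

/-- The angular component `ω_θ = ω · e_θ` of the vorticity. -/
def omegaTheta (v : E3 → E3) (x : E3) : ℝ := inner ℝ (curl v x) (eTheta x)

/-- The function `(v · ∇) f`. -/
def advect (v : E3 → E3) (f : E3 → ℂ) (x : E3) : ℂ := fderiv ℝ f x (v x)

/-! ### Lorentz spaces by real interpolation -/

/-- Peetre's `K`-functional of the couple `(L¹, L^∞)`:
`K(t, f) = inf { ‖g‖_{L¹} + t ‖f - g‖_{L^∞} }`. -/
def kFunctional (t : ℝ) (f : E3 → ℝ) : ℝ≥0∞ :=
  ⨅ (g : E3 → ℝ) (_ : AEStronglyMeasurable g volume),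
    eLpNorm g 1 volume + ENNReal.ofReal t * eLpNorm (f - g) ∞ volume

/-- The norm of the Lorentz space `L^{p,q} = (L¹, L^∞)_{θ,q}`, `1/p = 1 - θ`, for `1 < p < ∞` and
`1 ≤ q < ∞`: `( ∫₀^∞ (t^{-θ} K(t, f))^q dt/t )^{1/q}`. -/
def lorentzNorm (p q : ℝ) (f : E3 → ℝ) : ℝ≥0∞ :=
  (∫⁻ t in Set.Ioi (0 : ℝ),
    (ENNReal.ofReal (t ^ (-(1 - 1 / p))) * kFunctional t f) ^ q * ENNReal.ofReal t⁻¹) ^ (1 / q)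

/-! ### Littlewood-Paley blocks -/

/-- A dyadic partition of unity `(χ, φ)` of `ℝ³`. -/
structure IsDyadicPartition (χ φ : E3 → ℝ) : Prop where
  chi_smooth : ContDiff ℝ ∞ χ
  phi_smooth : ContDiff ℝ ∞ φ
  chi_compact : HasCompactSupport χ
  phi_compact : HasCompactSupport φ
  phi_zero : (0 : E3) ∉ tsupport φ
  chi_nonneg : ∀ ξ, 0 ≤ χ ξ
  phi_nonneg : ∀ ξ, 0 ≤ φ ξ
  chi_radial : ∀ ξ η, ‖ξ‖ = ‖η‖ → χ ξ = χ η
  phi_radial : ∀ ξ η, ‖ξ‖ = ‖η‖ → φ ξ = φ η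
  sum_eq_one : ∀ ξ, HasSum (fun q : ℕ => φ ((2 : ℝ) ^ (-(q : ℤ)) • ξ)) (1 - χ ξ)
  sum_sq_ge : ∀ ξ, 1 / 3 ≤ χ ξ ^ 2 + ∑' q : ℕ, φ ((2 : ℝ) ^ (-(q : ℤ)) • ξ) ^ 2
  sum_sq_le : ∀ ξ, χ ξ ^ 2 + ∑' q : ℕ, φ ((2 : ℝ) ^ (-(q : ℤ)) • ξ) ^ 2 ≤ 1
  phi_disjoint : ∀ p q : ℤ, 2 ≤ |p - q| →
    Disjoint (tsupport fun ξ => φ ((2 : ℝ) ^ (-p) • ξ)) (tsupport fun ξ => φ ((2 : ℝ) ^ (-q) • ξ))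
  chi_phi_disjoint : ∀ q : ℤ, 1 ≤ q →
    Disjoint (tsupport χ) (tsupport fun ξ => φ ((2 : ℝ) ^ (-q) • ξ))

/-- The symbol of `Δ_q` (`q ≥ -1`), as a function of the frequency `ξ` dual to `x` through
`e^{i x · ξ}`: it is `χ` for `q = -1` and `φ(2^{-q} ·)` for `q ≥ 0`. -/
def blockSymbol (χ φ : E3 → ℝ) (q : ℤ) (ξ : E3) : ℝ :=
  if q = -1 then χ ξ else φ ((2 : ℝ) ^ (-q) • ξ)

/-- The Littlewood-Paley block `Δ_q u = χ(D) u` (`q = -1`), `Δ_q u = φ(2^{-q} D) u` (`q ≥ 0`) of a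
tempered distribution `u`. Mathlib's Fourier transform uses the character `e^{2πi x · ξ}`, whence
the factor `2π`. -/
def block (χ φ : E3 → ℝ) (q : ℤ) (u : 𝓢'(E3, ℂ)) : 𝓢'(E3, ℂ) :=
  TemperedDistribution.fourierMultiplierCLM ℂ
    (fun ξ : E3 => (blockSymbol χ φ q ((2 * Real.pi) • ξ) : ℂ)) u

/-- The tempered distribution `u` is the locally integrable function `f`, that is, both define the
same distribution. This determines `u` from `f` (test functions with compact support are dense in
the Schwartz space), and `f` from `u` almost everywhere. -/
def IsRepresentedBy (u : 𝓢'(E3, ℂ)) (f : E3 → ℂ) : Prop :=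
  LocallyIntegrable f volume ∧
    ∀ ψ : 𝓢(E3, ℂ), HasCompactSupport ψ → u ψ = ∫ x, ψ x * f x

/-- `F` is the commutator `[Δ_q, v · ∇] ρ = Δ_q (v · ∇ρ) - v · ∇ (Δ_q ρ)`. Here `ρ` and the function
`v · ∇ρ` are tempered distributions `R` and `U`, `f` is the (continuously differentiable) function
`Δ_q ρ`, and `g` is the function `Δ_q (v · ∇ρ)`. Since `R, U, f` are determined by `v, ρ, q`, and `g`
almost everywhere, so is `F` almost everywhere. -/
def IsBlockCommutator (χ φ : E3 → ℝ) (q : ℤ) (v : E3 → E3) (ρ : E3 → ℝ) (F : E3 → ℂ) : Prop :=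
  ∃ (R U : 𝓢'(E3, ℂ)) (f g : E3 → ℂ),
    IsRepresentedBy R (fun x => (ρ x : ℂ)) ∧
    IsRepresentedBy U (advect v fun x => (ρ x : ℂ)) ∧
    ContDiff ℝ 1 f ∧ IsRepresentedBy (block χ φ q R) f ∧
    IsRepresentedBy (block χ φ q U) g ∧
    F = fun x => g x - advect v f x

end AxiBoussinesq

end

open MeasureTheory
open scoped ENNReal SchwartzMap ContDiff

noncomputable section

namespace AxiBoussinesq

open FourierTransform Filter Topology ComplexConjugate

/-! Put ζ = ω_θ/r and let h_q be the convolution kernel of Δ_q. Since div v = 0, v·∇ρ = div(ρv), and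
the commutator at x is ∫ ρ(y) ∇h_q(x-y)·(v(y)-v(x)) dy (`isBlockCommutator_integral`). Substituting
x = y+z and applying Minkowski in z reduces the theorem to two facts. The first is that ∫ |z|
|∇h_q(z)| dz is bounded in q, by scale invariance (`exists_moment_le`). The second is ‖ρ
(v(·+z)-v)‖_{L²} ≤ C |z| ‖ζ‖_{L^{3,1}} (‖ρ x_h‖_{L⁶} + ‖ρ‖_{L²}).

For the second fact, absence of swirl gives curl v = ζ (-x₂, x₁, 0), so the Biot-Savart law writes v
as a sum of convolutions K_i * (x_l ζ) with K(x) = x/(4π|x|³) and l a horizontal index. In an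
increment between x and y, write w_l = (w_l-y_l) + y_l inside the integral
(`enorm_kern_coord_sub_le`). The factor w_l-y_l compensates the singularity of the differentiated
kernel, |K(p)-K(q)| |q| ≤ C |p-q| (|p|⁻²+|q|⁻²) (`abs_kern_sub_mul_le`). As |x|⁻² is paired with
L^{3,1} in a bounded way (`lintegral_enorm_mul_inv_sq_le`), this part is at most C |x-y|
‖ζ‖_{L^{3,1}} pointwise, to be multiplied by ρ in L². The other part is y_l times an increment of K
* ζ. Since ∇(K * ζ) is controlled in L³, that increment has L³ norm at most C |z| ‖ζ‖_{L^{3,1}}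
(`lintegral_kern_sub_rpow_le`), and Hölder with ρ y_h in L⁶ closes the estimate, 1/6 + 1/3 = 1/2.

The L³ bound is a Calderón-Zygmund estimate: ∇K is a product of two Riesz transforms. Directional
Hilbert transforms are bounded on L² and L⁴ by Cotlar's argument, Riesz transforms by averaging over
directions. Cauchy-Schwarz between L² and L⁴ yields L³ for functions bounded by 1 on sets of finite
measure. A general f is the integral of its sign layers over levels l, and Minkowski costs ∫
|{|f|>l}|^{1/3} dl, which the interpolation norm of L^{3,1} dominates (`lintegral_distrib_rpow_le`).

To avoid singular integrals, K is replaced by x_i ∫_a^b ½ s⁻¹ G_s(x) ds with Gaussians G_s of mass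
one. Its Fourier transform is explicit, its divergence is G_b - G_a, and all quantitative bounds are
uniform in 0 < a ≤ b. The regularised Biot-Savart law represents (G_b - G_a) * v, which tends to v
pointwise as a → 0, b → ∞; Fatou's lemma transfers the bounds to v. -/

/-- A weighted form of Minkowski's integral inequality. -/
theorem lintegral_rpow_lintegral_le {α β : Type*} [MeasurableSpace α] [MeasurableSpace β]
    {μ : Measure α} {ν : Measure β} [SFinite μ] [SFinite ν] {F : α → β → ℝ≥0∞}
    (hF : Measurable (Function.uncurry F)) {c : β → ℝ≥0∞} (hc : Measurable c) {p : ℝ}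
    (hp : 1 < p) (h : ∀ b, ∫⁻ x, F x b ^ p ∂μ ≤ c b ^ p) :
    ∫⁻ x, (∫⁻ b, F x b ∂ν) ^ p ∂μ ≤ (∫⁻ b, c b ∂ν) ^ p := by
  have hp0 : 0 < p := by linarith
  set S := ∫⁻ b, c b ∂ν with hS
  rcases eq_or_ne S ⊤ with hSt | hSt
  · rw [hSt, ENNReal.top_rpow_of_pos hp0]; exact le_top
  have hct : ∀ᵐ b ∂ν, c b < ⊤ := ae_lt_top hc hSt
  have hpq : p.HolderConjugate (p / (p - 1)) := Real.HolderConjugate.conjExponent hp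
  set q := p / (p - 1) with hq
  have hq0 : 0 < q := hpq.symm.pos
  set r : ℝ := 1 / q with hr
  have hr0 : 0 < r := by positivity
  have hrp : 1 / p + r = 1 := by rw [hr]; simpa using hpq.inv_add_inv_eq_one
  -- almost everywhere vanishing where the weight vanishes
  have hzero : ∀ b, c b = 0 → ∀ᵐ x ∂μ, F x b = 0 := by
    intro b hb
    have h1 := h b
    have hFb : Measurable fun x => F x b := hF.comp (measurable_id.prodMk measurable_const)
    rw [hb, ENNReal.zero_rpow_of_pos hp0, nonpos_iff_eq_zero,
      lintegral_eq_zero_iff (hFb.pow_const p)] at h1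
    filter_upwards [h1] with x hx
    simpa [hp0, hp0.not_gt] using hx
  have hset : MeasurableSet {z : α × β | ¬ (c z.2 = 0 → F z.1 z.2 = 0)} := by
    have h1 : MeasurableSet {z : α × β | c z.2 = 0} :=
      (hc.comp measurable_snd) (measurableSet_singleton 0)
    have h2 : MeasurableSet {z : α × β | F z.1 z.2 = 0} := hF (measurableSet_singleton 0)
    have : {z : α × β | ¬ (c z.2 = 0 → F z.1 z.2 = 0)}
        = {z : α × β | c z.2 = 0} \ {z : α × β | F z.1 z.2 = 0} := by
      ext z; simp
    rw [this]; exact h1.diff h2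
  have hae : ∀ᵐ x ∂μ, ∀ᵐ b ∂ν, c b = 0 → F x b = 0 := by
    have h1 : ∀ᵐ z ∂(ν.prod μ), c z.1 = 0 → F z.2 z.1 = 0 := by
      rw [Measure.ae_prod_iff_ae_ae]
      · refine Filter.Eventually.of_forall fun b => ?_
        by_cases hb : c b = 0
        · filter_upwards [hzero b hb] with x hx using fun _ => hx
        · exact Filter.Eventually.of_forall fun x hx => absurd hx hb
      · have := (measurable_swap (α := β) (β := α)) hset.compl
        convert this using 1
        ext z; simp
    have h2 : ∀ᵐ z ∂(μ.prod ν), c z.2 = 0 → F z.1 z.2 = 0 := by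
      have h3 := (Measure.measurePreserving_swap (μ := μ) (ν := ν)).quasiMeasurePreserving.ae h1
      exact h3
    exact Measure.ae_ae_of_ae_prod h2
  -- Hölder for F = (F c^{-r}) c^r with r = 1/q, legitimate because F vanishes a.e. where c does.
  -- The weight is chosen so that p - rp = 1: after Tonelli, c^p c^{-rp} gives back exactly c.
  have hpt : ∀ᵐ x ∂μ, (∫⁻ b, F x b ∂ν) ^ p ≤
      (∫⁻ b, F x b ^ p * c b ^ (-(r * p)) ∂ν) * S ^ (p - 1) := by
    filter_upwards [hae] with x hx
    have hFx : Measurable (F x) := hF.comp (measurable_const.prodMk measurable_id)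
    have e1 : ∫⁻ b, F x b ∂ν = ∫⁻ b, ((fun b => F x b * c b ^ (-r)) * fun b => c b ^ r) b ∂ν := by
      refine lintegral_congr_ae ?_
      filter_upwards [hx, hct] with b hb hb'
      by_cases h0 : c b = 0
      · simp [hb h0]
      · simp only [Pi.mul_apply]
        rw [mul_assoc, ← ENNReal.rpow_add _ _ h0 hb'.ne]; simp
    have e2 := ENNReal.lintegral_mul_le_Lp_mul_Lq ν hpq
      (hFx.mul (hc.pow_const (-r))).aemeasurable (hc.pow_const r).aemeasurable
    replace e2 := e1.trans_le e2
    calc (∫⁻ b, F x b ∂ν) ^ p ≤ _ := ENNReal.rpow_le_rpow e2 hp0.le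
      _ = _ := by
        rw [ENNReal.mul_rpow_of_nonneg _ _ hp0.le, ← ENNReal.rpow_mul, ← ENNReal.rpow_mul]
        congr 1
        · rw [one_div_mul_cancel hp0.ne', ENNReal.rpow_one]
          refine lintegral_congr fun b => ?_
          rw [Pi.mul_apply, ENNReal.mul_rpow_of_nonneg _ _ hp0.le, ← ENNReal.rpow_mul]
          congr 2; ring
        · congr 1
          · refine lintegral_congr fun b => ?_
            rw [← ENNReal.rpow_mul, hr, one_div_mul_cancel hq0.ne', ENNReal.rpow_one]
          · rw [hq]; field_simp
  calc ∫⁻ x, (∫⁻ b, F x b ∂ν) ^ p ∂μ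
      ≤ ∫⁻ x, (∫⁻ b, F x b ^ p * c b ^ (-(r * p)) ∂ν) * S ^ (p - 1) ∂μ := lintegral_mono_ae hpt
    _ = (∫⁻ x, (∫⁻ b, F x b ^ p * c b ^ (-(r * p)) ∂ν) ∂μ) * S ^ (p - 1) := by
        rw [lintegral_mul_const']
        exact (ENNReal.rpow_lt_top_of_nonneg (by linarith) hSt).ne
    _ = (∫⁻ b, (∫⁻ x, F x b ^ p * c b ^ (-(r * p)) ∂μ) ∂ν) * S ^ (p - 1) := by
        rw [lintegral_lintegral_swap]
        exact ((hF.pow_const p).mul ((hc.comp measurable_snd).pow_const _)).aemeasurable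
    _ ≤ (∫⁻ b, c b ∂ν) * S ^ (p - 1) := by
        gcongr ?_ * _
        refine lintegral_mono_ae ?_
        filter_upwards [hct] with b hb
        by_cases h0 : c b = 0
        · have : ∫⁻ x, F x b ^ p * c b ^ (-(r * p)) ∂μ = 0 := by
            rw [← lintegral_zero (μ := μ)]
            refine lintegral_congr_ae ?_
            filter_upwards [hzero b h0] with x hx
            simp [hx, hp0]
          rw [this]; exact bot_le
        · rw [lintegral_mul_const]
          · calc _ ≤ c b ^ p * c b ^ (-(r * p)) := by gcongr; exact h b
              _ = c b := by
                rw [← ENNReal.rpow_add _ _ h0 hb.ne]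
                have : p + -(r * p) = 1 := by
                  have : r = 1 - 1 / p := by linarith
                  rw [this]; field_simp; ring
                rw [this, ENNReal.rpow_one]
          · exact (hF.comp (measurable_id.prodMk measurable_const)).pow_const p
    _ = S ^ p := by
        rcases eq_or_ne S 0 with h0 | h0
        · rw [← hS, h0]; simp [hp0]
        · rw [← hS]
          have := ENNReal.rpow_add 1 (p - 1) h0 hSt
          rw [ENNReal.rpow_one] at this
          rw [← this]; congr 1; ring

/-! ### The interpolation norm of L^{3,1} and level sets. -/

/-- The distribution function of `f`. -/
def distrib (f : E3 → ℝ) (t : ℝ) : ℝ≥0∞ := volume {x | t < |f x|}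

theorem distrib_antitone (f : E3 → ℝ) : Antitone (distrib f) := fun _ _ hst =>
  measure_mono fun _ hx => lt_of_le_of_lt hst hx

/-- Given a competitor g with ‖f-g‖_∞ = M, the levels below M contribute at most tM, and above M the
inclusion {|f| > l+M} ⊆ {|g| > l} (up to a null set) and the layer cake formula bound the rest by
‖g‖_{L¹}. Only this half of the formula for the K-functional is needed. -/
theorem lintegral_min_distrib_le_kFunctional (f : E3 → ℝ) {t : ℝ} (ht : 0 < t) :
    ∫⁻ l in Set.Ioi (0 : ℝ), min (ENNReal.ofReal t) (distrib f l) ≤ kFunctional t f := by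
  refine le_iInf₂ fun g hg => ?_
  rcases eq_or_ne (eLpNorm (f - g) ∞ volume) ∞ with hM | hM
  · rw [hM, ENNReal.mul_top (by simpa using ht)]; simp
  set M := (eLpNorm (f - g) ∞ volume).toReal with hMdef
  have hM0 : 0 ≤ M := ENNReal.toReal_nonneg
  have hfg : ∀ᵐ x, |f x - g x| ≤ M := by
    have := enorm_ae_le_eLpNormEssSup (f - g) (volume : Measure E3)
    filter_upwards [this] with x hx
    rw [← eLpNorm_exponent_top] at hx
    rw [hMdef, ← Real.norm_eq_abs, ← toReal_enorm]
    exact ENNReal.toReal_mono hM hx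
  have hle : ∀ l, distrib f (l + M) ≤ volume {x | l < ‖g x‖} := by
    intro l
    refine measure_mono_ae ?_
    filter_upwards [hfg] with x hx
    intro (h : l + M < |f x|)
    change l < ‖g x‖
    rw [Real.norm_eq_abs]
    have := abs_sub_abs_le_abs_sub (f x) (g x)
    linarith
  have hL1 : eLpNorm g 1 volume = ∫⁻ l in Set.Ioi (0 : ℝ), volume {x | l < ‖g x‖} := by
    rw [eLpNorm_one_eq_lintegral_enorm, ← lintegral_eq_lintegral_meas_lt]
    · simp only [ofReal_norm]
    · exact Filter.Eventually.of_forall fun x => norm_nonneg _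
    · exact hg.norm.aemeasurable
  have hsplit : Set.Ioi (0 : ℝ) = Set.Ioc 0 M ∪ Set.Ioi M :=
    (Set.Ioc_union_Ioi_eq_Ioi hM0).symm
  calc ∫⁻ l in Set.Ioi (0 : ℝ), min (ENNReal.ofReal t) (distrib f l)
      ≤ (∫⁻ l in Set.Ioc 0 M, min (ENNReal.ofReal t) (distrib f l))
        + ∫⁻ l in Set.Ioi M, min (ENNReal.ofReal t) (distrib f l) := by
        rw [hsplit]; exact lintegral_union_le _ _ _
    _ ≤ (∫⁻ l in Set.Ioc 0 M, ENNReal.ofReal t) + ∫⁻ l in Set.Ioi M, distrib f l := by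
        gcongr
        · exact min_le_left _ _
        · exact min_le_right _ _
    _ = ENNReal.ofReal t * eLpNorm (f - g) ∞ volume
        + ∫⁻ l in Set.Ioi (0 : ℝ), distrib f (l + M) := by
        congr 1
        · rw [setLIntegral_const, Real.volume_Ioc, sub_zero, hMdef, ENNReal.ofReal_toReal hM]
        · have h1 := (measurePreserving_add_right (volume : Measure ℝ) M).setLIntegral_comp_preimage
            (s := Set.Ioi M) measurableSet_Ioi (distrib_antitone f).measurable
          rw [← h1]; simp
    _ ≤ _ := by
        rw [add_comm, hL1]
        gcongr with l
        exact hle l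

/-- On t ≤ m the integrand is t^{-2/3} ≥ m^{-2/3}, and this interval has length m. The exponent -5/3
is -(1-1/3) - 1: the interpolation weight for p = 3 together with dt/t. -/
theorem lintegral_rpow_Ioo_ge (m : ℝ≥0∞) :
    m ^ (1 / 3 : ℝ) ≤ ∫⁻ t in Set.Ioi (0 : ℝ),
      ENNReal.ofReal (t ^ (-(5 / 3) : ℝ)) * min (ENNReal.ofReal t) m := by
  have key : ∀ a : ℝ, 0 < a → ENNReal.ofReal a ≤ m →
      ENNReal.ofReal a ^ (1 / 3 : ℝ) ≤ ∫⁻ t in Set.Ioi (0 : ℝ),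
      ENNReal.ofReal (t ^ (-(5 / 3) : ℝ)) * min (ENNReal.ofReal t) m := by
    intro a ha ham
    calc ENNReal.ofReal a ^ (1 / 3 : ℝ) = ENNReal.ofReal (a ^ (-(2 / 3) : ℝ)) * ENNReal.ofReal a := by
          rw [ENNReal.ofReal_rpow_of_pos ha, ← ENNReal.ofReal_mul (by positivity)]
          congr 1
          nth_rewrite 3 [← Real.rpow_one a]
          rw [← Real.rpow_add ha]; norm_num
      _ = ∫⁻ t in Set.Ioc (0 : ℝ) a, ENNReal.ofReal (a ^ (-(2 / 3) : ℝ)) := by simp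
      _ ≤ ∫⁻ t in Set.Ioc (0 : ℝ) a,
          ENNReal.ofReal (t ^ (-(5 / 3) : ℝ)) * min (ENNReal.ofReal t) m := by
          refine setLIntegral_mono' measurableSet_Ioc fun t ht => ?_
          have h1 : ENNReal.ofReal t ≤ m := (ENNReal.ofReal_le_ofReal ht.2).trans ham
          have ht0 : 0 < t := ht.1
          rw [min_eq_left h1, ← ENNReal.ofReal_mul (by positivity)]
          refine ENNReal.ofReal_le_ofReal ?_
          have : t ^ (-(5 / 3) : ℝ) * t = t ^ (-(2 / 3) : ℝ) := by
            nth_rewrite 2 [← Real.rpow_one t]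
            rw [← Real.rpow_add ht0]; norm_num
          rw [this]
          exact Real.rpow_le_rpow_of_nonpos ht0 ht.2 (by norm_num)
      _ ≤ _ := lintegral_mono_set Set.Ioc_subset_Ioi_self
  rcases eq_or_ne m 0 with h0 | h0
  · simp [h0]
  rcases eq_or_ne m ⊤ with ht | ht
  · refine le_of_eq_of_le (b := ⊤) (by simp [ht]) ?_
    refine top_le_iff.2 (ENNReal.eq_top_of_forall_nnreal_le fun r => ?_)
    -- For m = ∞ every finite a is admissible; a = (r+1)³ pushes the integral beyond r.
    have := key ((r + 1 : ℝ) ^ (3 : ℝ)) (by positivity) (by simp [ht])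
    refine le_trans ?_ this
    rw [ENNReal.ofReal_rpow_of_pos (by positivity), ← Real.rpow_mul (by positivity)]
    norm_num
    rw [← ENNReal.ofReal_coe_nnreal]
    exact ENNReal.ofReal_le_ofReal (by linarith)
  · have := key m.toReal (ENNReal.toReal_pos h0 ht) (by rw [ENNReal.ofReal_toReal ht])
    rwa [ENNReal.ofReal_toReal ht] at this

/-- The Lorentz norm of `L^{3,1}` controls the layer cake integral `∫ |{|f| > l}|^{1/3} dl`. -/
theorem lintegral_distrib_rpow_le (f : E3 → ℝ) :
    ∫⁻ l in Set.Ioi (0 : ℝ), distrib f l ^ (1 / 3 : ℝ) ≤ lorentzNorm 3 1 f := by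
  have hm : Measurable (distrib f) := (distrib_antitone f).measurable
  calc ∫⁻ l in Set.Ioi (0 : ℝ), distrib f l ^ (1 / 3 : ℝ)
      ≤ ∫⁻ l in Set.Ioi (0 : ℝ), ∫⁻ t in Set.Ioi (0 : ℝ),
        ENNReal.ofReal (t ^ (-(5 / 3) : ℝ)) * min (ENNReal.ofReal t) (distrib f l) :=
        lintegral_mono fun l => lintegral_rpow_Ioo_ge _
    _ = ∫⁻ t in Set.Ioi (0 : ℝ), ∫⁻ l in Set.Ioi (0 : ℝ),
        ENNReal.ofReal (t ^ (-(5 / 3) : ℝ)) * min (ENNReal.ofReal t) (distrib f l) := by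
        rw [lintegral_lintegral_swap]
        have h1 : Measurable fun z : ℝ × ℝ => distrib f z.1 := hm.comp measurable_fst
        have h2 : Measurable fun z : ℝ × ℝ => ENNReal.ofReal (z.2 ^ (-(5 / 3) : ℝ)) := by fun_prop
        have h3 : Measurable fun z : ℝ × ℝ => ENNReal.ofReal z.2 := by fun_prop
        exact (h2.mul (h3.min h1)).aemeasurable
    _ ≤ ∫⁻ t in Set.Ioi (0 : ℝ),
        (ENNReal.ofReal (t ^ (-(1 - 1 / 3) : ℝ)) * kFunctional t f) ^ (1 : ℝ)
          * ENNReal.ofReal t⁻¹ := by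
        refine setLIntegral_mono' measurableSet_Ioi fun t (ht : 0 < t) => ?_
        rw [lintegral_const_mul _ (measurable_const.min hm), ENNReal.rpow_one, mul_right_comm,
          ← ENNReal.ofReal_mul (by positivity)]
        have : t ^ (-(1 - 1 / 3) : ℝ) * t⁻¹ = t ^ (-(5 / 3) : ℝ) := by
          rw [← Real.rpow_neg_one t, ← Real.rpow_add ht]; norm_num
        rw [this]
        gcongr
        exact lintegral_min_distrib_le_kFunctional f ht
    _ = lorentzNorm 3 1 f := by simp [lorentzNorm]

/-! ### Pairing of |x|⁻² with L^{3,1}. -/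

theorem lintegral_closedBall_inv_sq {R : ℝ} (hR : 0 < R) :
    ∫⁻ w in Metric.closedBall (0 : E3) R, ENNReal.ofReal (‖w‖ ^ 2)⁻¹ =
      3 * volume (Metric.ball (0 : E3) 1) * ENNReal.ofReal R := by
  set φ : ℝ → ℝ := Set.indicator (Set.Iic R) fun y => (y ^ 2)⁻¹ with hφ
  have hdim : Module.finrank ℝ E3 = 3 := by simp
  have h1 : Set.EqOn (fun y : ℝ => y ^ (Module.finrank ℝ E3 - 1) • φ y)
      (Set.indicator (Set.Ioc 0 R) fun _ => (1 : ℝ)) (Set.Ioi 0) := by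
    intro y (hy : 0 < y)
    simp only [hdim, hφ, smul_eq_mul, Set.indicator_apply, Set.mem_Iic, Set.mem_Ioc, hy, true_and]
    split_ifs
    · norm_num; field_simp
    · simp
  have hint : Integrable (fun w : E3 => φ ‖w‖) := by
    rw [integrable_fun_norm_addHaar, integrableOn_congr_fun h1 measurableSet_Ioi,
      integrableOn_indicator_iff measurableSet_Ioc]
    exact (integrableOn_const (by simp)).mono_set Set.inter_subset_left
  have hval := integral_fun_norm_addHaar (volume : Measure E3) φ
  rw [setIntegral_congr_fun measurableSet_Ioi h1, setIntegral_indicator measurableSet_Ioc] at hval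
  have hnn : ∀ w : E3, 0 ≤ φ ‖w‖ := fun w => Set.indicator_nonneg (fun _ _ => by positivity) _
  have h2 := ofReal_integral_eq_lintegral_ofReal hint (Filter.Eventually.of_forall hnn)
  have h3 : ∫⁻ w in Metric.closedBall (0 : E3) R, ENNReal.ofReal (‖w‖ ^ 2)⁻¹
      = ∫⁻ w : E3, ENNReal.ofReal (φ ‖w‖) := by
    rw [← lintegral_indicator Metric.isClosed_closedBall.measurableSet]
    refine lintegral_congr fun w => ?_
    by_cases h : ‖w‖ ≤ R
    · rw [Set.indicator_of_mem (by simpa using h), hφ, Set.indicator_of_mem (by simpa using h)]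
    · rw [Set.indicator_of_notMem (by simpa using h), hφ,
        Set.indicator_of_notMem (by simpa using h), ENNReal.ofReal_zero]
  rw [h3, ← h2, hval, Set.inter_eq_right.2 Set.Ioc_subset_Ioi_self]
  simp only [hdim, integral_const, measureReal_restrict_apply_univ, Real.volume_real_Ioc_of_le hR.le,
    smul_eq_mul, nsmul_eq_mul, mul_one, sub_zero]
  rw [ENNReal.ofReal_mul (by positivity), ENNReal.ofReal_mul (by positivity), Measure.real,
    ENNReal.ofReal_toReal measure_ball_lt_top.ne, mul_assoc]
  norm_num

/-- The constant in the bound for the potential `∫ |f w| |x - w|⁻² dw`. -/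
def potConst : ℝ≥0∞ := 3 * volume (Metric.ball (0 : E3) 1) + 1

theorem potConst_ne_top : potConst ≠ ⊤ := by
  unfold potConst
  exact ENNReal.add_ne_top.2 ⟨ENNReal.mul_ne_top (by simp) measure_ball_lt_top.ne, by simp⟩

/-- Split at the ball of radius R = |A|^{1/3} about x. Inside, polar coordinates give a multiple of
R; outside, the integrand is at most R⁻² on a set of measure at most R³. -/
theorem setLIntegral_inv_sq_le {A : Set E3} (hA : MeasurableSet A) (x : E3) :
    ∫⁻ w in A, ENNReal.ofReal (‖x - w‖ ^ 2)⁻¹ ≤ potConst * volume A ^ (1 / 3 : ℝ) := by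
  rcases eq_or_ne (volume A) ⊤ with ht | ht
  · rw [ht]; simp [potConst]
  rcases eq_or_ne (volume A) 0 with h0 | h0
  · rw [setLIntegral_measure_zero _ _ h0]; exact bot_le
  set m := (volume A).toReal with hm
  have hm0 : 0 < m := ENNReal.toReal_pos h0 ht
  have hAm : volume A = ENNReal.ofReal m := (ENNReal.ofReal_toReal ht).symm
  set R : ℝ := m ^ (1 / 3 : ℝ) with hR
  have hR0 : 0 < R := by positivity
  have hR3 : m = R ^ 3 := by
    rw [hR, ← Real.rpow_natCast, ← Real.rpow_mul hm0.le]; norm_num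
  have hball : ∫⁻ w in Metric.closedBall x R, ENNReal.ofReal (‖x - w‖ ^ 2)⁻¹ =
      3 * volume (Metric.ball (0 : E3) 1) * ENNReal.ofReal R := by
    rw [← lintegral_closedBall_inv_sq hR0]
    have := (Measure.measurePreserving_sub_left (volume : Measure E3) x).setLIntegral_comp_preimage
      (s := Metric.closedBall (0 : E3) R) Metric.isClosed_closedBall.measurableSet
      (f := fun w => ENNReal.ofReal (‖w‖ ^ 2)⁻¹) (by fun_prop)
    rw [← this]
    congr 2
    ext w
    simp [dist_eq_norm, norm_sub_rev]
  have hfar : ∫⁻ w in A \ Metric.closedBall x R, ENNReal.ofReal (‖x - w‖ ^ 2)⁻¹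
      ≤ ENNReal.ofReal R := by
    calc _ ≤ ∫⁻ w in A \ Metric.closedBall x R, ENNReal.ofReal (R ^ 2)⁻¹ := by
          refine setLIntegral_mono' (hA.diff Metric.isClosed_closedBall.measurableSet) fun w hw => ?_
          refine ENNReal.ofReal_le_ofReal ?_
          have : R < ‖x - w‖ := by
            have := hw.2
            rw [Metric.mem_closedBall, not_le, dist_eq_norm, norm_sub_rev] at this
            exact this
          gcongr
      _ ≤ ENNReal.ofReal (R ^ 2)⁻¹ * volume A := by
          rw [setLIntegral_const]; gcongr; exact Set.sdiff_subset
      _ = ENNReal.ofReal R := by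
          rw [hAm, ← ENNReal.ofReal_mul (by positivity), hR3]
          congr 1; field_simp
  calc _ ≤ ∫⁻ w in Metric.closedBall x R ∪ (A \ Metric.closedBall x R),
        ENNReal.ofReal (‖x - w‖ ^ 2)⁻¹ := by
        apply lintegral_mono_set; rw [Set.union_sdiff_self]; exact Set.subset_union_right
    _ ≤ _ := lintegral_union_le _ _ _
    _ ≤ 3 * volume (Metric.ball (0 : E3) 1) * ENNReal.ofReal R + ENNReal.ofReal R := by
        rw [hball]; gcongr
    _ = potConst * volume A ^ (1 / 3 : ℝ) := by
        rw [hAm, ENNReal.ofReal_rpow_of_pos hm0, potConst, add_mul, one_mul]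

theorem enorm_eq_lintegral_layer (a : ℝ) :
    ‖a‖ₑ = ∫⁻ l in Set.Ioi (0 : ℝ), Set.indicator {l : ℝ | l < |a|} (fun _ => (1 : ℝ≥0∞)) l := by
  have hm : MeasurableSet {l : ℝ | l < |a|} := measurableSet_lt measurable_id measurable_const
  rw [lintegral_indicator hm, setLIntegral_const, Measure.restrict_apply hm]
  have : {l : ℝ | l < |a|} ∩ Set.Ioi 0 = Set.Ioo 0 |a| := by ext; simp [and_comm]
  rw [this]; simp [Real.enorm_eq_ofReal_abs]

/-- Duality of L^{3,1} and weak L^{3/2}, done by hand: slice |f| into level sets, use the bound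
|A|^{1/3} on each, and integrate over the levels. -/
theorem lintegral_enorm_mul_inv_sq_le {f : E3 → ℝ} (hf : Measurable f) (x : E3) :
    ∫⁻ w, ‖f w‖ₑ * ENNReal.ofReal (‖x - w‖ ^ 2)⁻¹ ≤ potConst * lorentzNorm 3 1 f := by
  have hk : Measurable fun w : E3 => ENNReal.ofReal (‖x - w‖ ^ 2)⁻¹ := by fun_prop
  have hset : MeasurableSet {z : E3 × ℝ | z.2 < |f z.1|} :=
    measurableSet_lt measurable_snd (by fun_prop)
  have hI : Measurable fun z : E3 × ℝ =>
      Set.indicator {l : ℝ | l < |f z.1|} (fun _ => (1 : ℝ≥0∞)) z.2 :=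
    (measurable_const (a := (1 : ℝ≥0∞))).indicator hset
  calc ∫⁻ w, ‖f w‖ₑ * ENNReal.ofReal (‖x - w‖ ^ 2)⁻¹
      = ∫⁻ w, ∫⁻ l in Set.Ioi (0 : ℝ), Set.indicator {l : ℝ | l < |f w|} (fun _ => (1 : ℝ≥0∞)) l
          * ENNReal.ofReal (‖x - w‖ ^ 2)⁻¹ := by
        refine lintegral_congr fun w => ?_
        rw [lintegral_mul_const, ← enorm_eq_lintegral_layer]
        exact measurable_const.indicator (measurableSet_lt measurable_id measurable_const)
    _ = ∫⁻ l in Set.Ioi (0 : ℝ), ∫⁻ w, Set.indicator {l : ℝ | l < |f w|} (fun _ => (1 : ℝ≥0∞)) l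
          * ENNReal.ofReal (‖x - w‖ ^ 2)⁻¹ := by
        rw [lintegral_lintegral_swap]
        exact (hI.mul (hk.comp measurable_fst)).aemeasurable
    _ ≤ ∫⁻ l in Set.Ioi (0 : ℝ), potConst * distrib f l ^ (1 / 3 : ℝ) := by
        refine lintegral_mono fun l => ?_
        have hA : MeasurableSet {w | l < |f w|} := measurableSet_lt measurable_const (by fun_prop)
        refine le_trans (le_of_eq ?_) (setLIntegral_inv_sq_le hA x)
        rw [← lintegral_indicator hA]
        refine lintegral_congr fun w => ?_
        simp only [Set.indicator_apply, Set.mem_ofPred_eq]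
        split_ifs <;> simp
    _ ≤ _ := by
        rw [lintegral_const_mul _ ((distrib_antitone f).measurable.pow_const _)]
        gcongr
        exact lintegral_distrib_rpow_le f

/-! ### Gaussians and their Fourier transforms. -/

/-- The Gaussian `s^{3/2} e^{-π s |x|²}` of mass one. -/
def heat (s : ℝ) (x : E3) : ℝ := s ^ (3 / 2 : ℝ) * Real.exp (-Real.pi * s * ‖x‖ ^ 2)

/-- The Fourier transform `e^{-π |ξ|²/s}` of `heat s`. -/
def gauss (s : ℝ) (ξ : E3) : ℝ := Real.exp (-Real.pi * ‖ξ‖ ^ 2 / s)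

theorem heat_nonneg {s : ℝ} (hs : 0 < s) (x : E3) : 0 ≤ heat s x := by unfold heat; positivity

theorem gauss_pos (s : ℝ) (x : E3) : 0 < gauss s x := by unfold gauss; positivity

theorem gauss_le_one {s : ℝ} (hs : 0 < s) (x : E3) : gauss s x ≤ 1 := by
  unfold gauss
  rw [Real.exp_le_one_iff, neg_mul, neg_div]
  have := Real.pi_pos
  simp only [Left.neg_nonpos_iff]; positivity

@[fun_prop]
theorem continuous_heat (s : ℝ) : Continuous (heat s) := by unfold heat; fun_prop

@[fun_prop]
theorem continuous_gauss (s : ℝ) : Continuous (gauss s) := by unfold gauss; fun_prop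

theorem gauss_eq_heat {s : ℝ} (hs : 0 < s) (x : E3) :
    gauss s x = s ^ (3 / 2 : ℝ) * heat s⁻¹ x := by
  unfold gauss heat
  rw [← mul_assoc, ← Real.mul_rpow hs.le (by positivity), mul_inv_cancel₀ hs.ne']
  simp; ring_nf

theorem integrable_heat {s : ℝ} (hs : 0 < s) : Integrable (heat s) := by
  have h := GaussianFourier.integrable_cexp_neg_mul_sq_norm_add (V := E3) (b := (Real.pi * s : ℝ))
    (by simp; positivity) 0 0
  have h2 := h.re.const_mul (s ^ (3 / 2 : ℝ))
  refine h2.congr (Eventually.of_forall fun x => ?_)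
  simp only [heat]
  congr 1
  rw [inner_zero_left]
  simp only [Complex.ofReal_zero, mul_zero, add_zero]
  rw [show -((Real.pi * s : ℝ) : ℂ) * (‖x‖ : ℂ) ^ 2 = ((-Real.pi * s * ‖x‖ ^ 2 : ℝ) : ℂ) by
    push_cast; ring]
  rw [← Complex.ofReal_exp]
  exact (Complex.ofReal_re _).symm

theorem integrable_gauss {s : ℝ} (hs : 0 < s) : Integrable (gauss s) :=
  ((integrable_heat (inv_pos.2 hs)).const_mul (s ^ (3 / 2 : ℝ))).congr
    (Eventually.of_forall fun x => (gauss_eq_heat hs x).symm)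

theorem integral_heat {s : ℝ} (hs : 0 < s) : ∫ x, heat s x = 1 := by
  have h := GaussianFourier.integral_rexp_neg_mul_sq_norm (V := E3) (b := Real.pi * s)
    (by positivity)
  simp only [heat]
  rw [integral_const_mul]
  have e : ∀ x : E3, Real.exp (-Real.pi * s * ‖x‖ ^ 2) = Real.exp (-(Real.pi * s) * ‖x‖ ^ 2) :=
    fun x => by ring_nf
  simp_rw [e]
  rw [h]
  have : Real.pi / (Real.pi * s) = s⁻¹ := by have := Real.pi_pos; field_simp
  rw [this, finrank_euclideanSpace_fin, Nat.cast_ofNat, ← Real.mul_rpow hs.le (by positivity),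
    mul_inv_cancel₀ hs.ne', Real.one_rpow]

theorem ofReal_heat_eq {s : ℝ} (hs : 0 < s) (x : E3) :
    ((heat s x : ℝ) : ℂ) = (s : ℂ) ^ ((Module.finrank ℝ E3 : ℂ) / 2)
      * Complex.exp (-Real.pi * s * ‖x‖ ^ 2) := by
  unfold heat
  push_cast
  rw [finrank_euclideanSpace_fin, Complex.ofReal_cpow hs.le]
  push_cast
  ring_nf

theorem fourier_gauss_modulated {s : ℝ} (hs : 0 < s) (y x : E3) :
    𝓕 (fun ξ : E3 => (gauss s ξ : ℂ) * Complex.exp (2 * Real.pi * Complex.I * inner ℝ y ξ)) x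
      = (heat s (y - x) : ℂ) := by
  have h := fourier_gaussian_innerProductSpace' (V := E3) (b := (Real.pi / s : ℝ))
    (by rw [Complex.ofReal_re]; positivity) y x
  have hpi : (Real.pi : ℂ) ≠ 0 := by exact_mod_cast Real.pi_ne_zero
  have hsc : (s : ℂ) ≠ 0 := by exact_mod_cast hs.ne'
  rw [ofReal_heat_eq hs]
  convert h using 2
  · ext ξ
    unfold gauss
    rw [Complex.ofReal_exp, ← Complex.exp_add]
    congr 1
    push_cast
    ring
  · congr 1
    push_cast; field_simp
  · congr 1
    push_cast; field_simp

/-- The general Gaussian approximate identity has its parameter normalised differently, whence the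
substitution s ↦ s/π. Continuity of f is asked only at the one point; f may be discontinuous
elsewhere, as a frequency cut-off is. -/
theorem tendsto_heat_conv {f : E3 → ℂ} (hf : Integrable f) {v : E3} (hv : ContinuousAt f v) :
    Tendsto (fun s : ℝ => ∫ w, (heat s (v - w) : ℂ) * f w) atTop (𝓝 (f v)) := by
  have h := Real.tendsto_integral_gaussian_smul' hf hv
  have h2 := h.comp (tendsto_id.atTop_mul_const (inv_pos.2 Real.pi_pos) :
    Tendsto (fun s : ℝ => s * Real.pi⁻¹) atTop atTop)
  refine h2.congr' ?_
  filter_upwards [eventually_gt_atTop 0] with s hs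
  refine integral_congr_ae (Eventually.of_forall fun w => ?_)
  simp only [smul_eq_mul]
  rw [ofReal_heat_eq hs]
  have hpi : (Real.pi : ℂ) ≠ 0 := by exact_mod_cast Real.pi_ne_zero
  congr 3
  · push_cast; field_simp
  · push_cast; field_simp

theorem norm_fourier_le {g : E3 → ℂ} (x : E3) : ‖𝓕 g x‖ ≤ ∫ ξ, ‖g ξ‖ := by
  rw [Real.fourier_eq]
  refine (norm_integral_le_integral_norm _).trans (le_of_eq ?_)
  simp

theorem continuous_fourier {g : E3 → ℂ} (hg : Integrable g) : Continuous (𝓕 g) := by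
  exact VectorFourier.fourierIntegral_continuous Real.continuous_fourierChar
    (L := innerₗ E3) continuous_inner hg

theorem integral_fourier_mul_flip {f g : E3 → ℂ} (hf : Integrable f) (hg : Integrable g) :
    ∫ x, 𝓕 f x * g x = ∫ x, f x * 𝓕 g x := by
  simpa using! VectorFourier.integral_fourierIntegral_smul_eq_flip (L := innerₗ E3)
      Real.continuous_fourierChar continuous_inner hf hg

/-- Parseval's formula with a Gaussian convergence factor. It holds for merely integrable g and h;
letting s → ∞ removes the factor and formally gives ∫ 𝓕g 𝓕h = ∫ g(ξ) h(-ξ) dξ. -/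
theorem integral_fourier_mul_fourier_gauss {g h : E3 → ℂ} (hg : Integrable g) (hh : Integrable h)
    {s : ℝ} (hs : 0 < s) :
    ∫ x, 𝓕 g x * (𝓕 h x * (gauss s x : ℂ)) = ∫ ξ, g ξ * ∫ η, (heat s (-ξ - η) : ℂ) * h η := by
  have hG : Integrable fun x => (gauss s x : ℂ) := (integrable_gauss hs).ofReal
  have hi : Integrable fun x => 𝓕 h x * (gauss s x : ℂ) :=
    hG.bdd_mul (c := ∫ ξ, ‖h ξ‖) (continuous_fourier hh).aestronglyMeasurable
      (Eventually.of_forall norm_fourier_le)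
  rw [integral_fourier_mul_flip hg hi]
  refine integral_congr_ae (Eventually.of_forall fun ξ => ?_)
  simp only
  congr 1
  have hm : Integrable fun η : E3 =>
      (gauss s η : ℂ) * Complex.exp (2 * Real.pi * Complex.I * inner ℝ (-ξ) η) := by
    refine hG.mul_bdd (c := 1) (Continuous.aestronglyMeasurable (by fun_prop))
      (Eventually.of_forall fun η => ?_)
    rw [show 2 * (Real.pi : ℂ) * Complex.I * (inner ℝ (-ξ) η : ℝ)
      = ((2 * Real.pi * inner ℝ (-ξ) η : ℝ) : ℂ) * Complex.I by push_cast; ring,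
      Complex.norm_exp_ofReal_mul_I]
  have := integral_fourier_mul_flip hm hh
  simp_rw [fourier_gauss_modulated hs] at this
  rw [this, Real.fourier_eq']
  refine integral_congr_ae (Eventually.of_forall fun η => ?_)
  simp only [smul_eq_mul, inner_neg_left]
  rw [real_inner_comm ξ η]
  have : Complex.exp (↑(-2 * Real.pi * inner ℝ η ξ) * Complex.I)
    = Complex.exp (2 * Real.pi * Complex.I * ((-inner ℝ η ξ : ℝ) : ℂ)) := by
    congr 1; push_cast; ring
  rw [real_inner_comm, this]
  ring_nf

/-! ### Square and fourth-power integrals of Fourier transforms. -/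

/-- Integrable and bounded functions. -/
structure IntegrableBdd (g : E3 → ℂ) : Prop where
  integrable : Integrable g
  bdd : ∃ M : ℝ, ∀ ξ, ‖g ξ‖ ≤ M

theorem norm_heat_conv_le {h : E3 → ℂ} {M : ℝ} (hM : ∀ ξ, ‖h ξ‖ ≤ M) {s : ℝ} (hs : 0 < s)
    (v : E3) : ‖∫ η, (heat s (v - η) : ℂ) * h η‖ ≤ M := by
  calc ‖∫ η, (heat s (v - η) : ℂ) * h η‖ ≤ ∫ η, heat s (v - η) * M := by
        refine norm_integral_le_of_norm_le
          (((integrable_heat hs).comp_sub_left v).mul_const M)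
          (Eventually.of_forall fun η => ?_)
        rw [norm_mul, Complex.norm_real, Real.norm_of_nonneg (heat_nonneg hs _)]
        gcongr
        · exact heat_nonneg hs _
        · exact hM η
    _ = M := by
        rw [integral_mul_const, integral_sub_left_eq_self (heat s) volume v, integral_heat hs, one_mul]

theorem conj_fourier (g : E3 → ℂ) (x : E3) : conj (𝓕 g x) = 𝓕 (fun ξ => conj (g (-ξ))) x := by
  rw [Real.fourier_eq', Real.fourier_eq', ← integral_conj, ← integral_neg_eq_self]
  refine integral_congr_ae (Eventually.of_forall fun ξ => ?_)
  simp only [smul_eq_mul, map_mul, inner_neg_left]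
  rw [← Complex.exp_conj]
  simp [Complex.conj_ofNat]

theorem tendsto_gauss (x : E3) : Tendsto (fun n : ℕ => gauss n x) atTop (𝓝 1) := by
  have : Tendsto (fun n : ℕ => -Real.pi * ‖x‖ ^ 2 / (n : ℝ)) atTop (𝓝 0) :=
    tendsto_const_div_atTop_nhds_zero_nat _
  have h2 := (Real.continuous_exp.tendsto 0).comp this
  rw [Real.exp_zero] at h2
  exact h2

/-- Regularised Parseval against the conjugate reflection of g bounds ∫ |𝓕g|² e^{-π|x|²/n} by
‖g‖_{L¹} sup|g| for every n, and Fatou removes the Gaussian. The class of integrable bounded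
functions is convenient because bounded measurable multipliers preserve it. -/
theorem IntegrableBdd.memLp_fourier {g : E3 → ℂ} (hg : IntegrableBdd g) :
    Integrable fun x => ‖𝓕 g x‖ ^ 2 := by
  obtain ⟨M, hM⟩ := hg.bdd
  have hg' : Integrable fun ξ => conj (g (-ξ)) := by
    have := hg.integrable.comp_neg
    exact (Complex.conjLIE.toContinuousLinearEquiv.toContinuousLinearMap).integrable_comp this
  have hc : Continuous fun x => ‖𝓕 g x‖ ^ 2 := (continuous_fourier hg.integrable).norm.pow 2
  refine ⟨hc.aestronglyMeasurable, ?_⟩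
  have key : ∀ n : ℕ, 0 < n →
      ∫⁻ x, ENNReal.ofReal (‖𝓕 g x‖ ^ 2 * gauss n x) ≤ ENNReal.ofReal (∫ ξ, ‖g ξ‖ * M) := by
    intro n hn
    have hn' : (0 : ℝ) < n := by exact_mod_cast hn
    have hI : Integrable fun x => ‖𝓕 g x‖ ^ 2 * gauss n x := by
      refine (integrable_gauss hn').bdd_mul (c := (∫ ξ, ‖g ξ‖) ^ 2) hc.aestronglyMeasurable
        (Eventually.of_forall fun x => ?_)
      rw [norm_pow, norm_norm]
      gcongr
      exact norm_fourier_le x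
    rw [← ofReal_integral_eq_lintegral_ofReal hI
      (Eventually.of_forall fun x => mul_nonneg (by positivity) (gauss_pos _ _).le)]
    refine ENNReal.ofReal_le_ofReal ?_
    have e := integral_fourier_mul_fourier_gauss hg.integrable hg' hn'
    have e1 : (∫ x, 𝓕 g x * (𝓕 (fun ξ => conj (g (-ξ))) x * (gauss n x : ℂ)))
        = ((∫ x, ‖𝓕 g x‖ ^ 2 * gauss n x : ℝ) : ℂ) := by
      rw [← integral_complex_ofReal]
      refine integral_congr_ae (Eventually.of_forall fun x => ?_)
      simp only
      rw [← conj_fourier, ← mul_assoc, Complex.mul_conj, Complex.normSq_eq_norm_sq]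
      push_cast; rfl
    have e2 : ‖∫ ξ, g ξ * ∫ η, (heat n (-ξ - η) : ℂ) * conj (g (-η))‖ ≤ ∫ ξ, ‖g ξ‖ * M := by
      refine norm_integral_le_of_norm_le (hg.integrable.norm.mul_const M)
        (Eventually.of_forall fun ξ => ?_)
      rw [norm_mul]
      gcongr
      refine norm_heat_conv_le (fun η => ?_) hn' _
      rw [RCLike.norm_conj]; exact hM _
    rw [← e, e1, Complex.norm_real] at e2
    exact (le_abs_self _).trans e2
  have hlim : ∀ x, Tendsto (fun n : ℕ => ENNReal.ofReal (‖𝓕 g x‖ ^ 2 * gauss n x)) atTop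
      (𝓝 (ENNReal.ofReal (‖𝓕 g x‖ ^ 2))) := fun x => by
    have := (tendsto_gauss x).const_mul (‖𝓕 g x‖ ^ 2)
    rw [mul_one] at this
    exact ENNReal.tendsto_ofReal this
  have hF := lintegral_liminf_le (μ := volume) (u := atTop)
    (f := fun (n : ℕ) x => ENNReal.ofReal (‖𝓕 g x‖ ^ 2 * gauss n x)) (fun n => ENNReal.measurable_ofReal.comp (hc.mul (continuous_gauss n)).measurable)
  simp_rw [fun x => (hlim x).liminf_eq] at hF
  refine lt_of_le_of_lt (b := ENNReal.ofReal (∫ ξ, ‖g ξ‖ * M)) ?_ ENNReal.ofReal_lt_top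
  refine le_trans (le_of_eq ?_) (hF.trans ?_)
  · refine lintegral_congr fun x => ?_
    rw [Real.enorm_of_nonneg (by positivity)]
  · refine liminf_le_of_le (by isBoundedDefault) fun b hb => ?_
    obtain ⟨n, hn1, hn2⟩ := (hb.and (eventually_gt_atTop 0)).exists
    exact hn1.trans (key n hn2)

theorem IntegrableBdd.integrable_fourier_pow {g : E3 → ℂ} (hg : IntegrableBdd g) {k : ℕ}
    (hk : 2 ≤ k) : Integrable fun x => ‖𝓕 g x‖ ^ k := by
  obtain ⟨j, rfl⟩ := Nat.exists_eq_add_of_le hk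
  simp_rw [pow_add]
  refine hg.memLp_fourier.mul_bdd (c := (∫ ξ, ‖g ξ‖) ^ j)
    ((continuous_fourier hg.integrable).norm.pow j).aestronglyMeasurable
    (Eventually.of_forall fun x => ?_)
  rw [norm_pow, norm_norm]
  gcongr
  exact norm_fourier_le x

/-- If `g` is supported in an open half-space, then `∫ (𝓕 g)² = 0`. -/
theorem IntegrableBdd.integral_fourier_sq_eq_zero {g : E3 → ℂ} (hg : IntegrableBdd g) {θ : E3}
    (hθ : ∀ ξ, inner ℝ ξ θ ≤ 0 → g ξ = 0) : ∫ x, 𝓕 g x ^ 2 = 0 := by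
  obtain ⟨M, hM⟩ := hg.bdd
  have hc := continuous_fourier hg.integrable
  have l1 : Tendsto (fun n : ℕ => ∫ x, 𝓕 g x * (𝓕 g x * (gauss n x : ℂ))) atTop
      (𝓝 (∫ x, 𝓕 g x ^ 2)) := by
    refine tendsto_integral_filter_of_dominated_convergence (fun x => ‖𝓕 g x‖ ^ 2) ?_ ?_
      hg.memLp_fourier ?_
    · exact Eventually.of_forall fun n => Continuous.aestronglyMeasurable (by fun_prop)
    · filter_upwards [eventually_gt_atTop 0] with n hn
      refine Eventually.of_forall fun x => ?_
      have hn' : (0 : ℝ) < n := by exact_mod_cast hn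
      rw [norm_mul, norm_mul, ← mul_assoc, ← sq, Complex.norm_real,
        Real.norm_of_nonneg (gauss_pos _ _).le]
      exact mul_le_of_le_one_right (by positivity) (gauss_le_one hn' x)
    · refine Eventually.of_forall fun x => ?_
      have h1 : Tendsto (fun n : ℕ => ((gauss n x : ℝ) : ℂ)) atTop (𝓝 ((1 : ℝ) : ℂ)) :=
        (Complex.continuous_ofReal.tendsto 1).comp (tendsto_gauss x)
      have := (h1.const_mul (𝓕 g x)).const_mul (𝓕 g x)
      simpa [sq] using this
  have l2 : Tendsto (fun n : ℕ => ∫ ξ, g ξ * ∫ η, (heat n (-ξ - η) : ℂ) * g η) atTop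
      (𝓝 (∫ ξ : E3, (0 : ℂ))) := by
    refine tendsto_integral_filter_of_dominated_convergence (fun x => ‖g x‖ * M) ?_ ?_
      (hg.integrable.norm.mul_const M) ?_
    · filter_upwards [eventually_gt_atTop 0] with n hn
      have hn' : (0 : ℝ) < n := by exact_mod_cast hn
      refine hg.integrable.aestronglyMeasurable.mul ?_
      have : AEStronglyMeasurable (fun z : E3 × E3 => (heat n (-z.1 - z.2) : ℂ) * g z.2)
          (volume.prod volume) :=
        (Continuous.aestronglyMeasurable (by fun_prop)).mul
          hg.integrable.aestronglyMeasurable.comp_snd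
      exact this.integral_prod_right'
    · filter_upwards [eventually_gt_atTop 0] with n hn
      have hn' : (0 : ℝ) < n := by exact_mod_cast hn
      refine Eventually.of_forall fun ξ => ?_
      rw [norm_mul]
      gcongr
      exact norm_heat_conv_le hM hn' _
    · refine Eventually.of_forall fun ξ => ?_
      by_cases hξ : inner ℝ ξ θ ≤ 0
      · simp [hθ ξ hξ]
      push Not at hξ
      -- The limit integrand is g(ξ) g(-ξ). Where g(ξ) ≠ 0 the reflected point lies in the open
      -- complementary half-space, so g vanishes near it and is continuous there, which is what the
      -- approximate identity requires.
      have hev : g =ᶠ[𝓝 (-ξ)] fun _ => 0 := by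
        have : ∀ᶠ η in 𝓝 (-ξ), inner ℝ η θ < 0 := by
          refine (isOpen_lt (by fun_prop) continuous_const).mem_nhds ?_
          change inner ℝ (-ξ) θ < 0
          rw [inner_neg_left]; linarith
        filter_upwards [this] with η hη using hθ η hη.le
      have hcont : ContinuousAt g (-ξ) := continuousAt_const.congr hev.symm
      have h0 : g (-ξ) = 0 := hev.eq_of_nhds
      have := ((tendsto_heat_conv hg.integrable hcont).comp tendsto_natCast_atTop_atTop).const_mul
        (g ξ)
      rw [h0, mul_zero] at this
      exact this
  rw [integral_zero] at l2
  refine tendsto_nhds_unique l1 (l2.congr' ?_)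
  filter_upwards [eventually_gt_atTop 0] with n hn
  exact (integral_fourier_mul_fourier_gauss hg.integrable hg.integrable (by exact_mod_cast hn)).symm

-- The support condition is stable under convolution: (𝓕g)⁴ = (𝓕(g * g))², and g * g vanishes on the
-- same closed half-space because that half-space contains one of t and ξ-t whenever it contains ξ.
-- So the quadratic case applies to g * g.
open scoped Convolution in
theorem IntegrableBdd.integral_fourier_pow_four_eq_zero {g : E3 → ℂ} (hg : IntegrableBdd g)
    {θ : E3} (hθ : ∀ ξ, inner ℝ ξ θ ≤ 0 → g ξ = 0) : ∫ x, 𝓕 g x ^ 4 = 0 := by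
  obtain ⟨M, hM⟩ := hg.bdd
  set G : E3 → ℂ := g ⋆[ContinuousLinearMap.mul ℂ ℂ] g with hGdef
  have hGi : Integrable G := hg.integrable.integrable_convolution _ hg.integrable
  have hG : IntegrableBdd G := by
    refine ⟨hGi, ∫ ξ, ‖g ξ‖ * M, fun ξ => ?_⟩
    refine norm_integral_le_of_norm_le (hg.integrable.norm.mul_const M)
        (Eventually.of_forall fun t => ?_)
    simp only [ContinuousLinearMap.mul_apply', norm_mul]
    gcongr
    exact hM _
  have hGθ : ∀ ξ, inner ℝ ξ θ ≤ 0 → G ξ = 0 := by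
    intro ξ hξ
    rw [hGdef, convolution_def]
    rw [← integral_zero E3 ℂ (μ := volume)]
    refine integral_congr_ae (Eventually.of_forall fun t => ?_)
    simp only [ContinuousLinearMap.mul_apply']
    by_cases ht : inner ℝ t θ ≤ 0
    · rw [hθ t ht, zero_mul]
    · rw [hθ (ξ - t), mul_zero]
      rw [inner_sub_left]; push Not at ht; linarith
  have := hG.integral_fourier_sq_eq_zero hGθ
  rw [← this]
  refine integral_congr_ae (Eventually.of_forall fun x => ?_)
  simp only
  rw [hGdef, Real.fourier_mul_convolution_eq hg.integrable hg.integrable]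
  ring

/-! ### Directional Hilbert transforms and Cotlar's argument. -/

theorem measurable_real_sign : Measurable Real.sign := by
  unfold Real.sign
  exact Measurable.ite measurableSet_Iio measurable_const
    (Measurable.ite measurableSet_Ioi measurable_const measurable_const)

theorem abs_real_sign_le (r : ℝ) : |Real.sign r| ≤ 1 := by
  rcases Real.sign_apply_eq r with h | h | h <;> simp [h]

/-- The Fourier symbol of the (real) Hilbert transform in direction `θ`. -/
def signSymbol (θ ξ : E3) : ℂ := Complex.I * (Real.sign (inner ℝ ξ θ) : ℂ)

theorem measurable_signSymbol : Measurable fun z : E3 × E3 => signSymbol z.1 z.2 := by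
  unfold signSymbol
  have h1 : Measurable fun z : E3 × E3 => (inner ℝ z.2 z.1 : ℝ) := by fun_prop
  exact measurable_const.mul (Complex.measurable_ofReal.comp (measurable_real_sign.comp h1))

theorem measurable_signSymbol_right (θ : E3) : Measurable (signSymbol θ) := by
  unfold signSymbol
  have h1 : Measurable fun ξ : E3 => (inner ℝ ξ θ : ℝ) := by fun_prop
  exact measurable_const.mul (Complex.measurable_ofReal.comp (measurable_real_sign.comp h1))

theorem norm_signSymbol_le (θ ξ : E3) : ‖signSymbol θ ξ‖ ≤ 1 := by
  rw [signSymbol, norm_mul, Complex.norm_I, one_mul, Complex.norm_real]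
  exact abs_real_sign_le _

theorem IntegrableBdd.mul {g m : E3 → ℂ} (hg : IntegrableBdd g) (hm : Measurable m) {M : ℝ}
    (hM : ∀ ξ, ‖m ξ‖ ≤ M) : IntegrableBdd fun ξ => m ξ * g ξ := by
  obtain ⟨N, hN⟩ := hg.bdd
  refine ⟨hg.integrable.bdd_mul hm.aestronglyMeasurable (Eventually.of_forall hM),
    M * N, fun ξ => ?_⟩
  rw [norm_mul]
  exact mul_le_mul (hM ξ) (hN ξ) (norm_nonneg _) ((norm_nonneg _).trans (hM ξ))

theorem lintegral_enorm_fourier_pow {g : E3 → ℂ} (hg : IntegrableBdd g) {k : ℕ} (hk : 2 ≤ k) :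
    ∫⁻ x, ‖𝓕 g x‖ₑ ^ k = ENNReal.ofReal (∫ x, ‖𝓕 g x‖ ^ k) := by
  rw [ofReal_integral_eq_lintegral_ofReal (hg.integrable_fourier_pow hk)
    (Eventually.of_forall fun x => by positivity)]
  refine lintegral_congr fun x => ?_
  rw [ENNReal.ofReal_pow (norm_nonneg _), ofReal_norm]

theorem volume_inner_eq_zero {θ : E3} (hθ : θ ≠ 0) :
    volume {ξ : E3 | inner ℝ ξ θ = 0} = 0 := by
  have h := Measure.addHaar_submodule (volume : Measure E3) (LinearMap.ker (innerₛₗ ℝ θ)) (by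
    intro h
    have : θ ∈ LinearMap.ker (innerₛₗ ℝ θ) := by rw [h]; trivial
    rw [LinearMap.mem_ker] at this
    exact hθ (inner_self_eq_zero.1 (this : inner ℝ θ θ = 0)))
  refine measure_mono_null (fun ξ hξ => ?_) h
  change ξ ∈ LinearMap.ker (innerₛₗ ℝ θ)
  rw [LinearMap.mem_ker]
  change inner ℝ θ ξ = 0
  rw [real_inner_comm]; exact hξ

/-- Cotlar's identity: substituting conj F = f - F in |F|⁴ = F² (conj F)² gives F²f² - 2F³f + F⁴.
Once F⁴ integrates to zero, ‖F‖_{L⁴} is controlled by ‖f‖_{L⁴}, because |F|⁴ reappears with a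
coefficient below 1. -/
theorem norm_pow_four_le (F f : ℂ) (h : f = F + conj F) :
    ‖F‖ ^ 4 ≤ 3 / 4 * ‖F‖ ^ 4 + 17 * ‖f‖ ^ 4 + (F ^ 4).re := by
  have e : ((‖F‖ ^ 4 : ℝ) : ℂ) = F ^ 2 * f ^ 2 - 2 * F ^ 3 * f + F ^ 4 := by
    have h1 : conj F = f - F := by rw [h]; ring
    have h2 := Complex.mul_conj' F
    have : ((‖F‖ ^ 4 : ℝ) : ℂ) = (F * conj F) ^ 2 := by rw [h2]; push_cast; ring
    rw [this, h1]; ring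
  have e2 : ‖F‖ ^ 4 = (F ^ 2 * f ^ 2).re - (2 * F ^ 3 * f).re + (F ^ 4).re := by
    rw [← Complex.sub_re, ← Complex.add_re, ← e, Complex.ofReal_re]
  have b1 := Complex.re_le_norm (F ^ 2 * f ^ 2)
  have b2 := Complex.abs_re_le_norm (2 * F ^ 3 * f)
  have b3 := neg_le_of_abs_le b2
  simp only [norm_mul, norm_pow, Complex.norm_ofNat] at b1 b3
  have := norm_nonneg F
  have := norm_nonneg f
  generalize ‖F‖ = a at *
  generalize ‖f‖ = b at *
  -- The claim is a²b² + 2a³b ≤ ¾a⁴ + 17b⁴. Use 2a³b ≤ a⁴/4 + 4a²b², then a²b² ≤ a⁴/4 + b⁴ and 4a²b²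
  -- ≤ a⁴/4 + 16b⁴.
  nlinarith [sq_nonneg (a ^ 2 - 2 * b ^ 2), mul_nonneg (sq_nonneg a) (sq_nonneg (a - 4 * b)),
    sq_nonneg (a ^ 2 - 8 * b ^ 2)]

theorem norm_sq_le (F f : ℂ) (h : f = F + conj F) :
    ‖F‖ ^ 2 ≤ 1 / 2 * ‖F‖ ^ 2 + 1 / 2 * ‖f‖ ^ 2 - (F ^ 2).re := by
  have e : ((‖F‖ ^ 2 : ℝ) : ℂ) = F * f - F ^ 2 := by
    have h1 : conj F = f - F := by rw [h]; ring
    have h2 := Complex.mul_conj' F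
    push_cast
    rw [← h2, h1]; ring
  have e2 : ‖F‖ ^ 2 = (F * f).re - (F ^ 2).re := by
    rw [← Complex.sub_re, ← e, Complex.ofReal_re]
  have b1 := Complex.re_le_norm (F * f)
  rw [norm_mul] at b1
  nlinarith [sq_nonneg (‖F‖ - ‖f‖)]

/-- The Hilbert transform in direction `θ` is bounded on `L²` and `L⁴`, by Cotlar's argument. -/
theorem lintegral_fourier_signSymbol_le {g : E3 → ℂ} (hg : IntegrableBdd g)
    (hh : ∀ ξ, g (-ξ) = conj (g ξ)) (θ : E3) {k : ℕ} (hk : k = 2 ∨ k = 4) :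
    ∫⁻ x, ‖𝓕 (fun ξ => signSymbol θ ξ * g ξ) x‖ₑ ^ k ≤ 1088 * ∫⁻ x, ‖𝓕 g x‖ₑ ^ k := by
  have hk2 : 2 ≤ k := by omega
  rcases eq_or_ne θ 0 with rfl | hθ
  · have : (fun ξ => signSymbol 0 ξ * g ξ) = fun _ => 0 := by
      ext ξ; simp [signSymbol]
    rw [this]
    have : ∀ x : E3, 𝓕 (fun _ : E3 => (0 : ℂ)) x = 0 := fun x => by simp [Real.fourier_eq]
    simp [this, show k ≠ 0 by omega]
  set m : E3 → ℂ := fun ξ => if 0 < inner ℝ ξ θ then 1 else 0 with hm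
  have hmm : Measurable m :=
    Measurable.ite (measurableSet_lt measurable_const (by fun_prop)) measurable_const
      measurable_const
  have hG : IntegrableBdd fun ξ => m ξ * g ξ := by
    refine hg.mul hmm (M := 1) fun ξ => ?_
    simp only [hm]; split_ifs <;> simp
  have hGs : ∀ ξ, inner ℝ ξ θ ≤ 0 → m ξ * g ξ = 0 := fun ξ h => by simp [hm, h.not_gt]
  set F := 𝓕 fun ξ => m ξ * g ξ with hF
  have hS : IntegrableBdd fun ξ => signSymbol θ ξ * g ξ :=
    hg.mul (measurable_signSymbol_right θ) (norm_signSymbol_le θ)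
  have hne : ∀ᵐ ξ : E3, inner ℝ ξ θ ≠ 0 := by
    rw [ae_iff]; simpa using volume_inner_eq_zero hθ
  have hGi' : Integrable fun ξ => conj (m (-ξ) * g (-ξ)) :=
    Complex.conjLIE.toContinuousLinearEquiv.toContinuousLinearMap.integrable_comp
      hG.integrable.comp_neg
  have hadd : ∀ {u w : E3 → ℂ}, Integrable u → Integrable w → ∀ x,
      𝓕 (fun ξ => u ξ + w ξ) x = 𝓕 u x + 𝓕 w x := by
    intro u w hu hw x
    simp only [Real.fourier_eq, smul_add]
    rw [integral_add ((Real.fourierIntegral_convergent_iff x).2 hu)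
      ((Real.fourierIntegral_convergent_iff x).2 hw)]
  -- Hermitian symmetry of g makes conj F the transform of the restriction of g to the opposite
  -- half-space; the hyperplane between the two is null.
  have hf : ∀ x, 𝓕 g x = F x + conj (F x) := by
    intro x
    rw [hF, conj_fourier, ← hadd hG.integrable hGi', Real.fourier_eq, Real.fourier_eq]
    refine integral_congr_ae ?_
    filter_upwards [hne] with ξ hξ
    congr 1
    simp only [hm, inner_neg_left, map_mul, hh, Complex.conj_conj]
    rcases lt_or_gt_of_ne hξ with h | h
    · simp [h, h.not_gt]
    · simp [h, h.not_gt]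
  have hH : ∀ x, 𝓕 (fun ξ => signSymbol θ ξ * g ξ) x = Complex.I * F x - Complex.I * conj (F x) := by
    intro x
    have e1 : ∀ (c : ℂ) (u : E3 → ℂ), 𝓕 (fun ξ => c * u ξ) x = c * 𝓕 u x := by
      intro c u
      simp only [Real.fourier_eq, ← integral_const_mul]
      refine integral_congr_ae (Eventually.of_forall fun ξ => ?_)
      simp only [Circle.smul_def, smul_eq_mul]; ring
    rw [hF, conj_fourier, sub_eq_add_neg, ← neg_mul, ← e1, ← e1,
      ← hadd (hG.integrable.const_mul _) (hGi'.const_mul _), Real.fourier_eq, Real.fourier_eq]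
    refine integral_congr_ae ?_
    filter_upwards [hne] with ξ hξ
    congr 1
    simp only [hm, inner_neg_left, map_mul, hh, Complex.conj_conj, signSymbol]
    rcases lt_or_gt_of_ne hξ with h | h
    · simp [h, h.not_gt, Real.sign_of_neg h]
    · simp [h, h.not_gt, Real.sign_of_pos h]
  rw [lintegral_enorm_fourier_pow hS hk2, lintegral_enorm_fourier_pow hg hk2,
    show (1088 : ℝ≥0∞) = ENNReal.ofReal 1088 by simp, ← ENNReal.ofReal_mul (by norm_num)]
  refine ENNReal.ofReal_le_ofReal ?_
  have hFi : Integrable fun x => ‖F x‖ ^ k := hG.integrable_fourier_pow hk2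
  have hfi := hg.integrable_fourier_pow hk2
  have hFc : Continuous F := continuous_fourier hG.integrable
  have hFk : Integrable fun x => F x ^ k :=
    hFi.mono' (hFc.pow k).aestronglyMeasurable (Eventually.of_forall fun x => by rw [norm_pow])
  have hre : ∀ h0 : ∫ x, F x ^ k = 0, ∫ x, (F x ^ k).re = 0 := by
    intro h0
    have := integral_re hFk
    simp only [RCLike.re_to_complex] at this
    rw [this, h0]; simp
  -- Absorbing ¾∫|F|⁴ gives 4 · 17 = 68 for k = 4, and for k = 2 the constant 1 suffices. The
  -- transform is iF - i conj F, hence at most 2|F|, and 2^k · 68 ≤ 16 · 68 = 1088.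
  have hmain : ∫ x, ‖F x‖ ^ k ≤ 68 * ∫ x, ‖𝓕 g x‖ ^ k := by
    rcases hk with rfl | rfl
    · have h0 := hre (hG.integral_fourier_sq_eq_zero hGs)
      have hsum : Integrable fun x => 1 / 2 * ‖F x‖ ^ 2 + 1 / 2 * ‖𝓕 g x‖ ^ 2 :=
        (hFi.const_mul (1 / 2)).add (hfi.const_mul (1 / 2))
      have := integral_mono hFi (hsum.sub hFk.re)
        (fun x => norm_sq_le (F x) (𝓕 g x) (hf x))
      simp only [Pi.sub_apply] at this
      rw [integral_sub hsum hFk.re,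
        integral_add (hFi.const_mul (1 / 2)) (hfi.const_mul (1 / 2)), integral_const_mul,
        integral_const_mul] at this
      simp only [RCLike.re_to_complex] at this
      rw [h0] at this
      have : 0 ≤ ∫ x, ‖𝓕 g x‖ ^ 2 := integral_nonneg fun x => by positivity
      linarith
    · have h0 := hre (hG.integral_fourier_pow_four_eq_zero hGs)
      have hsum : Integrable fun x => 3 / 4 * ‖F x‖ ^ 4 + 17 * ‖𝓕 g x‖ ^ 4 :=
        (hFi.const_mul (3 / 4)).add (hfi.const_mul 17)
      have := integral_mono hFi (hsum.add hFk.re)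
        (fun x => norm_pow_four_le (F x) (𝓕 g x) (hf x))
      simp only [Pi.add_apply] at this
      rw [integral_add hsum hFk.re,
        integral_add (hFi.const_mul (3 / 4)) (hfi.const_mul 17), integral_const_mul,
        integral_const_mul] at this
      simp only [RCLike.re_to_complex] at this
      rw [h0] at this
      linarith
  calc ∫ x, ‖𝓕 (fun ξ => signSymbol θ ξ * g ξ) x‖ ^ k ≤ ∫ x, 16 * ‖F x‖ ^ k := by
        refine integral_mono (hS.integrable_fourier_pow hk2) (hFi.const_mul 16) fun x => ?_
        simp only
        have h2 : ‖𝓕 (fun ξ => signSymbol θ ξ * g ξ) x‖ ≤ 2 * ‖F x‖ := by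
          rw [hH]
          refine (norm_sub_le _ _).trans ?_
          rw [norm_mul, norm_mul, RCLike.norm_conj, Complex.norm_I]; linarith
        refine (pow_le_pow_left₀ (norm_nonneg _) h2 k).trans ?_
        rw [mul_pow]
        gcongr
        rcases hk with rfl | rfl <;> norm_num
    _ ≤ _ := by
        rw [integral_const_mul]; linarith

/-! ### Averages over directions -/

/-- The mean of `|θ₁|` over the unit ball. -/
def ballMoment : ℝ := ∫ θ in Metric.closedBall (0 : E3) 1, |inner ℝ (EuclideanSpace.single 0 1) θ|

theorem setIntegral_ball_isometry (A : E3 ≃ₗᵢ[ℝ] E3) (f : E3 → ℝ) :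
    ∫ θ in Metric.closedBall (0 : E3) 1, f (A θ) = ∫ θ in Metric.closedBall (0 : E3) 1, f θ := by
  have := A.measurePreserving.setIntegral_preimage_emb
    A.toHomeomorph.measurableEmbedding f (Metric.closedBall (0 : E3) 1)
  rw [← this]
  congr 2
  ext θ
  simp

theorem integrableOn_closedBall_of_bdd {f : E3 → ℝ} (hf : Measurable f) {C : ℝ}
    (hC : ∀ θ ∈ Metric.closedBall (0 : E3) 1, |f θ| ≤ C) :
    IntegrableOn f (Metric.closedBall (0 : E3) 1) := by
  refine Measure.integrableOn_of_bounded (M := C) measure_closedBall_lt_top.ne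
    hf.aestronglyMeasurable ?_
  rw [ae_restrict_iff' Metric.isClosed_closedBall.measurableSet]
  exact Eventually.of_forall hC

theorem ballMoment_pos : 0 < ballMoment := by
  unfold ballMoment
  have hc : Continuous fun θ : E3 => |inner ℝ (EuclideanSpace.single (0 : Fin 3) (1 : ℝ)) θ| := by
    fun_prop
  rw [setIntegral_pos_iff_support_of_nonneg_ae (Eventually.of_forall fun θ => abs_nonneg _)
    (hc.continuousOn.integrableOn_compact (isCompact_closedBall 0 1))]
  have hopen : IsOpen (Function.support (fun θ : E3 => |inner ℝ (EuclideanSpace.single (0 : Fin 3) (1 : ℝ)) θ|)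
      ∩ Metric.ball (0 : E3) 1) := hc.isOpen_support.inter Metric.isOpen_ball
  refine (hopen.measure_pos volume ⟨(1 / 2 : ℝ) • EuclideanSpace.single 0 1, ?_, ?_⟩).trans_le
    (measure_mono (Set.inter_subset_inter_right _ Metric.ball_subset_closedBall))
  · rw [Function.mem_support, real_inner_smul_right, real_inner_self_eq_norm_sq]; simp
  · simp [norm_smul]; norm_num

theorem integral_abs_inner_unit {u : E3} (hu : ‖u‖ = 1) :
    ∫ θ in Metric.closedBall (0 : E3) 1, |inner ℝ u θ| = ballMoment := by
  set e : E3 := EuclideanSpace.single 0 1 with he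
  have hne : ‖u‖ = ‖e‖ := by rw [hu, he]; simp
  set A := Submodule.reflection (Submodule.span ℝ {u - e})ᗮ with hA
  have hAu : A u = e := Submodule.reflection_sub hne
  rw [ballMoment, ← setIntegral_ball_isometry A fun θ => |inner ℝ (EuclideanSpace.single 0 1) θ|]
  refine integral_congr_ae (Eventually.of_forall fun θ => ?_)
  simp only
  rw [← he, ← hAu, LinearIsometryEquiv.inner_map_map]

/-- The method of rotations on the symbol side. Decompose e along and across ξ. The transverse part
averages to zero by the reflection that fixes ξ and flips its orthogonal complement; the parallel
part gives |⟨u, θ⟩| with u = ξ/|ξ|, whose mean does not depend on the unit vector u. -/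
theorem integral_inner_mul_sign (e : E3) {ξ : E3} (hξ : ξ ≠ 0) :
    ∫ θ in Metric.closedBall (0 : E3) 1, inner ℝ e θ * Real.sign (inner ℝ ξ θ)
      = ballMoment * (inner ℝ e ξ / ‖ξ‖) := by
  have hn : 0 < ‖ξ‖ := norm_pos_iff.2 hξ
  set u := ‖ξ‖⁻¹ • ξ with hu
  have hu1 : ‖u‖ = 1 := by rw [hu, norm_smul]; simp [hn.ne']
  set w := e - inner ℝ e u • u with hw
  have hsm : Measurable fun θ : E3 => Real.sign (inner ℝ ξ θ) :=
    measurable_real_sign.comp (by fun_prop)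
  have hint : ∀ a : E3, IntegrableOn (fun θ => inner ℝ a θ * Real.sign (inner ℝ ξ θ))
      (Metric.closedBall (0 : E3) 1) := by
    intro a
    refine integrableOn_closedBall_of_bdd (C := ‖a‖) (Measurable.mul (by fun_prop) hsm) fun θ hθ => ?_
    rw [abs_mul]
    have h1 := abs_real_inner_le_norm a θ
    have h2 : ‖θ‖ ≤ 1 := by simpa using hθ
    have h3 := abs_real_sign_le (inner ℝ ξ θ)
    calc _ ≤ (‖a‖ * 1) * 1 := by gcongr; exact h1.trans (by gcongr)
      _ = _ := by ring
  have hdec : ∀ θ : E3, inner ℝ e θ * Real.sign (inner ℝ ξ θ)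
      = inner ℝ w θ * Real.sign (inner ℝ ξ θ)
        + inner ℝ e u * (inner ℝ u θ * Real.sign (inner ℝ ξ θ)) := by
    intro θ
    rw [hw, inner_sub_left, real_inner_smul_left]; ring
  have hsign : ∀ θ : E3, inner ℝ u θ * Real.sign (inner ℝ ξ θ) = |inner ℝ u θ| := by
    intro θ
    rw [hu, real_inner_smul_left, abs_mul, abs_of_pos (inv_pos.2 hn), mul_assoc]
    congr 1
    rcases lt_trichotomy (inner ℝ ξ θ) 0 with h | h | h
    · rw [Real.sign_of_neg h, abs_of_neg h]; ring
    · rw [h]; simp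
    · rw [Real.sign_of_pos h, abs_of_pos h]; ring
  have horth : ∫ θ in Metric.closedBall (0 : E3) 1, inner ℝ w θ * Real.sign (inner ℝ ξ θ) = 0 := by
    set A := Submodule.reflection (Submodule.span ℝ {ξ}) with hA
    have hAξ : A ξ = ξ := Submodule.reflection_mem_subspace_eq_self (Submodule.mem_span_singleton_self ξ)
    have hwξ : inner ℝ ξ w = 0 := by
      rw [hw, inner_sub_right, real_inner_smul_right, hu, real_inner_smul_right,
        real_inner_smul_right, real_inner_self_eq_norm_sq, real_inner_comm]
      field_simp; ring
    have hAw : A w = -w := Submodule.reflection_mem_subspace_orthogonalComplement_eq_neg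
      (Submodule.mem_orthogonal_singleton_iff_inner_right.2 hwξ)
    have h1 := setIntegral_ball_isometry A fun θ => inner ℝ w θ * Real.sign (inner ℝ ξ θ)
    have h2 : ∀ θ, inner ℝ w (A θ) * Real.sign (inner ℝ ξ (A θ))
        = -(inner ℝ w θ * Real.sign (inner ℝ ξ θ)) := by
      intro θ
      have a1 : inner ℝ w (A θ) = - inner ℝ w θ := by
        rw [← LinearIsometryEquiv.inner_map_map A w θ, hAw, inner_neg_left, neg_neg]
      have a2 : inner ℝ ξ (A θ) = inner ℝ ξ θ := by
        nth_rewrite 1 [← hAξ]; rw [LinearIsometryEquiv.inner_map_map]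
      rw [a1, a2]; ring
    simp_rw [h2] at h1
    rw [integral_neg] at h1
    linarith
  simp_rw [hdec]
  rw [integral_add (hint w) ((hint u).const_mul _), horth, integral_const_mul]
  simp_rw [hsign]
  rw [integral_abs_inner_unit hu1, hu, real_inner_smul_right]
  field_simp; ring

/-! ### Riesz transforms as averages of directional Hilbert transforms. -/

/-- The Fourier symbol of the (real) Riesz transform in direction `e`. -/
def rieszSymbol (e ξ : E3) : ℂ := Complex.I * ((inner ℝ e ξ / ‖ξ‖ : ℝ) : ℂ)

theorem measurable_rieszSymbol (e : E3) : Measurable (rieszSymbol e) := by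
  unfold rieszSymbol
  have h1 : Measurable fun ξ : E3 => (inner ℝ e ξ / ‖ξ‖ : ℝ) := by fun_prop
  exact measurable_const.mul (Complex.measurable_ofReal.comp h1)

theorem norm_rieszSymbol_le (e ξ : E3) : ‖rieszSymbol e ξ‖ ≤ ‖e‖ := by
  rw [rieszSymbol, norm_mul, Complex.norm_I, one_mul, Complex.norm_real, norm_div, norm_norm]
  rcases eq_or_ne ξ 0 with rfl | h
  · simp
  rw [div_le_iff₀ (norm_pos_iff.2 h)]
  exact norm_inner_le_norm e ξ

theorem rieszSymbol_neg (e ξ : E3) : rieszSymbol e (-ξ) = conj (rieszSymbol e ξ) := by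
  simp only [rieszSymbol, map_mul, Complex.conj_I, Complex.conj_ofReal, norm_neg, inner_neg_right,
    neg_div, Complex.ofReal_neg]
  ring

/-- The constant in the `L²` and `L⁴` bounds for the Riesz transforms. -/
def rieszConst : ℝ≥0∞ :=
  1088 * volume (Metric.closedBall (0 : E3) 1) * ENNReal.ofReal ballMoment⁻¹

theorem rieszConst_ne_top : rieszConst ≠ ⊤ := by
  unfold rieszConst
  exact ENNReal.mul_ne_top (ENNReal.mul_ne_top (by simp) measure_closedBall_lt_top.ne)
    ENNReal.ofReal_ne_top

theorem rieszSymbol_eq_integral (e : E3) {ξ : E3} (hξ : ξ ≠ 0) :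
    rieszSymbol e ξ = (ballMoment⁻¹ : ℝ) *
      ∫ θ in Metric.closedBall (0 : E3) 1, (inner ℝ e θ : ℂ) * signSymbol θ ξ := by
  have h := integral_inner_mul_sign e hξ
  have h2 : ∫ θ in Metric.closedBall (0 : E3) 1, (inner ℝ e θ : ℂ) * signSymbol θ ξ
      = Complex.I * ((ballMoment * (inner ℝ e ξ / ‖ξ‖) : ℝ) : ℂ) := by
    rw [← h, ← integral_complex_ofReal, ← integral_const_mul]
    refine integral_congr_ae (Eventually.of_forall fun θ => ?_)
    simp only [signSymbol]
    push_cast; ring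
  rw [h2, rieszSymbol]
  have : (ballMoment : ℂ) ≠ 0 := by exact_mod_cast ballMoment_pos.ne'
  push_cast
  field_simp

theorem fourier_rieszSymbol_eq {g : E3 → ℂ} (hgi : Integrable g) (e x : E3) :
    𝓕 (fun ξ => rieszSymbol e ξ * g ξ) x = (ballMoment⁻¹ : ℝ) *
      ∫ θ in Metric.closedBall (0 : E3) 1, (inner ℝ e θ : ℂ) *
        𝓕 (fun ξ => signSymbol θ ξ * g ξ) x := by
  have : IsFiniteMeasure (volume.restrict (Metric.closedBall (0 : E3) 1)) :=
    ⟨by simp⟩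
  have hmeas : AEStronglyMeasurable
      (fun z : E3 × E3 => (inner ℝ e z.1 : ℂ) * (Real.fourierChar (-inner ℝ z.2 x) •
        (signSymbol z.1 z.2 * g z.2)))
      ((volume.restrict (Metric.closedBall (0 : E3) 1)).prod volume) := by
    have h1 : Measurable fun z : E3 × E3 => ((inner ℝ e z.1 : ℝ) : ℂ) :=
      Complex.measurable_ofReal.comp (by fun_prop)
    refine h1.aestronglyMeasurable.mul ?_
    have h2 : Continuous fun z : E3 × E3 => Real.fourierChar (-inner ℝ z.2 x) :=
      Real.continuous_fourierChar.comp (by fun_prop)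
    exact h2.aestronglyMeasurable.smul
      (measurable_signSymbol.aestronglyMeasurable.mul hgi.aestronglyMeasurable.comp_snd)
  have hint : Integrable (fun z : E3 × E3 => (inner ℝ e z.1 : ℂ) *
      (Real.fourierChar (-inner ℝ z.2 x) • (signSymbol z.1 z.2 * g z.2)))
      ((volume.restrict (Metric.closedBall (0 : E3) 1)).prod volume) := by
    have hb : Integrable (fun z : E3 × E3 => ‖e‖ * ‖g z.2‖)
        ((volume.restrict (Metric.closedBall (0 : E3) 1)).prod volume) :=
      (integrable_const ‖e‖).mul_prod hgi.norm
    refine hb.mono' hmeas ?_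
    have : ∀ᵐ z ∂((volume.restrict (Metric.closedBall (0 : E3) 1)).prod (volume : Measure E3)),
        z.1 ∈ Metric.closedBall (0 : E3) 1 :=
      Measure.quasiMeasurePreserving_fst.ae
        (ae_restrict_mem Metric.isClosed_closedBall.measurableSet)
    filter_upwards [this] with z hz
    have hz1 : ‖z.1‖ ≤ 1 := by simpa using hz
    rw [norm_mul, Complex.norm_real, Circle.norm_smul, norm_mul]
    have h1 := norm_inner_le_norm (𝕜 := ℝ) e z.1
    have h2 := norm_signSymbol_le z.1 z.2
    calc _ ≤ (‖e‖ * 1) * (1 * ‖g z.2‖) := by gcongr; exact h1.trans (by gcongr)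
      _ = _ := by ring
  have e1 : ∀ θ, (inner ℝ e θ : ℂ) * 𝓕 (fun ξ => signSymbol θ ξ * g ξ) x
      = ∫ ξ, (inner ℝ e θ : ℂ) * (Real.fourierChar (-inner ℝ ξ x) • (signSymbol θ ξ * g ξ)) := by
    intro θ
    rw [Real.fourier_eq, integral_const_mul]
  simp_rw [e1]
  rw [integral_integral_swap hint, Real.fourier_eq, ← integral_const_mul]
  refine integral_congr_ae ?_
  have hne : ∀ᵐ ξ : E3, ξ ≠ 0 := by
    rw [ae_iff]; simp
  filter_upwards [hne] with ξ hξ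
  rw [rieszSymbol_eq_integral e hξ]
  simp only [Circle.smul_def, smul_eq_mul]
  have : ∀ θ : E3, (inner ℝ e θ : ℂ) * ((Real.fourierChar (-inner ℝ ξ x) : ℂ) * (signSymbol θ ξ * g ξ))
      = ((inner ℝ e θ : ℂ) * signSymbol θ ξ) * ((Real.fourierChar (-inner ℝ ξ x) : ℂ) * g ξ) :=
    fun θ => by ring
  simp_rw [this, integral_mul_const]
  ring

theorem measurable_fourier_signSymbol {g : E3 → ℂ} (hgm : Measurable g) :
    Measurable fun z : E3 × E3 => 𝓕 (fun ξ => signSymbol z.2 ξ * g ξ) z.1 := by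
  have h2 : Continuous fun z : (E3 × E3) × E3 => Real.fourierChar (-inner ℝ z.2 z.1.1) :=
    Real.continuous_fourierChar.comp (by fun_prop)
  have h1 : Measurable fun z : (E3 × E3) × E3 => (inner ℝ z.2 z.1.2 : ℝ) := by fun_prop
  have h3 : Measurable fun z : (E3 × E3) × E3 => signSymbol z.1.2 z.2 :=
    measurable_const.mul (Complex.measurable_ofReal.comp (measurable_real_sign.comp h1))
  have hm : StronglyMeasurable fun z : (E3 × E3) × E3 =>
      Real.fourierChar (-inner ℝ z.2 z.1.1) • (signSymbol z.1.2 z.2 * g z.2) :=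
    h2.stronglyMeasurable.smul (h3.mul (hgm.comp measurable_snd)).stronglyMeasurable
  simp_rw [Real.fourier_eq]
  exact (hm.integral_prod_right (ν := (volume : Measure E3))).measurable

/-- The Riesz transforms are bounded on `L²` and `L⁴`. -/
theorem lintegral_fourier_rieszSymbol_le {g : E3 → ℂ} (hg : IntegrableBdd g) (hgm : Measurable g)
    (hh : ∀ ξ, g (-ξ) = conj (g ξ)) (e : E3) {k : ℕ} (hk : k = 2 ∨ k = 4) :
    ∫⁻ x, ‖𝓕 (fun ξ => rieszSymbol e ξ * g ξ) x‖ₑ ^ k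
      ≤ (rieszConst * ‖e‖ₑ) ^ k * ∫⁻ x, ‖𝓕 g x‖ₑ ^ k := by
  have hk2 : 2 ≤ k := by omega
  have hk1 : (1 : ℝ) < k := by exact_mod_cast hk2
  set B := Metric.closedBall (0 : E3) 1 with hB
  set N := ∫⁻ x, ‖𝓕 g x‖ₑ ^ k with hN
  have hpt : ∀ x, ‖𝓕 (fun ξ => rieszSymbol e ξ * g ξ) x‖ₑ ≤ ENNReal.ofReal ballMoment⁻¹ * ‖e‖ₑ *
      ∫⁻ θ in B, ‖𝓕 (fun ξ => signSymbol θ ξ * g ξ) x‖ₑ := by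
    intro x
    rw [fourier_rieszSymbol_eq hg.integrable, enorm_mul, mul_assoc]
    have h1 : ‖((ballMoment⁻¹ : ℝ) : ℂ)‖ₑ = ENNReal.ofReal ballMoment⁻¹ := by
      rw [← ofReal_norm, Complex.norm_real, Real.norm_of_nonneg (inv_nonneg.2 ballMoment_pos.le)]
    rw [h1]
    gcongr
    rw [← lintegral_const_mul' _ _ enorm_ne_top]
    refine (enorm_integral_le_lintegral_enorm _).trans ?_
    refine setLIntegral_mono' Metric.isClosed_closedBall.measurableSet fun θ hθ => ?_
    rw [enorm_mul]
    gcongr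
    have hθ1 : ‖θ‖ ≤ 1 := by simpa using hθ
    rw [← ofReal_norm, ← ofReal_norm, Complex.norm_real]
    refine ENNReal.ofReal_le_ofReal ((norm_inner_le_norm e θ).trans ?_)
    exact mul_le_of_le_one_right (norm_nonneg _) hθ1
  have hmink := lintegral_rpow_lintegral_le (μ := (volume : Measure E3)) (ν := volume.restrict B)
    (F := fun x θ => ‖𝓕 (fun ξ => signSymbol θ ξ * g ξ) x‖ₑ)
    (measurable_fourier_signSymbol hgm).enorm
    (c := fun _ => (1088 * N) ^ (1 / k : ℝ)) measurable_const hk1 (fun θ => by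
      rw [← ENNReal.rpow_mul, one_div_mul_cancel (by positivity), ENNReal.rpow_one]
      simp_rw [ENNReal.rpow_natCast]
      exact lintegral_fourier_signSymbol_le hg hh θ hk)
  simp_rw [ENNReal.rpow_natCast] at hmink
  rw [setLIntegral_const, mul_pow, ← ENNReal.rpow_natCast ((1088 * N) ^ (1 / k : ℝ)),
    ← ENNReal.rpow_mul, one_div_mul_cancel (by positivity), ENNReal.rpow_one] at hmink
  calc ∫⁻ x, ‖𝓕 (fun ξ => rieszSymbol e ξ * g ξ) x‖ₑ ^ k
      ≤ ∫⁻ x, (ENNReal.ofReal ballMoment⁻¹ * ‖e‖ₑ) ^ k *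
        (∫⁻ θ in B, ‖𝓕 (fun ξ => signSymbol θ ξ * g ξ) x‖ₑ) ^ k := by
        refine lintegral_mono fun x => ?_
        rw [← mul_pow]
        exact pow_le_pow_left' (hpt x) k
    _ ≤ (ENNReal.ofReal ballMoment⁻¹ * ‖e‖ₑ) ^ k * (1088 * N * volume B ^ k) := by
        rw [lintegral_const_mul' _ _ (ENNReal.pow_ne_top (ENNReal.mul_ne_top ENNReal.ofReal_ne_top
          enorm_ne_top))]
        gcongr
    -- Minkowski yields 1088^{1/k}; enlarging it to 1088 lets one constant serve both exponents.
    _ ≤ (ENNReal.ofReal ballMoment⁻¹ * ‖e‖ₑ) ^ k * (1088 ^ k * N * volume B ^ k) := by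
        gcongr
        exact le_self_pow₀ (by norm_num) (by omega)
    _ = _ := by rw [rieszConst]; ring

/-! ### Convolution with Gaussians -/

/-- The convolution theorem, arranged so that the physical-space function f enters through 𝓕⁻ f and
operators appear as 𝓕 (m 𝓕⁻ f). Only integrability of m and f is used, since a modulation of m turns
the convolution into the pairing ∫ 𝓕n · f. -/
theorem integral_fourier_sub_mul {m f : E3 → ℂ} (hm : Integrable m) (hf : Integrable f) (x : E3) :
    ∫ w, 𝓕 m (x - w) * f w = 𝓕 (fun ξ => m ξ * 𝓕⁻ f ξ) x := by
  set n : E3 → ℂ := fun ξ => Real.fourierChar (inner ℝ ξ x) • m (-ξ) with hn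
  have hni : Integrable n := by
    have h1 : Integrable fun ξ => m (-ξ) := hm.comp_neg
    have := (Real.fourierIntegral_convergent_iff (-x)).2 h1
    simpa [hn, inner_neg_right] using this
  have e1 : ∀ w, 𝓕 m (x - w) = 𝓕 n w := by
    intro w
    rw [Real.fourier_eq, Real.fourier_eq, ← integral_neg_eq_self]
    refine integral_congr_ae (Eventually.of_forall fun ξ => ?_)
    simp only [hn, smul_smul]
    rw [← AddChar.map_add_eq_mul]
    congr 2
    rw [inner_neg_left, inner_sub_right]; ring
  simp_rw [e1]
  rw [integral_fourier_mul_flip hni hf, Real.fourier_eq, ← integral_neg_eq_self]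
  refine integral_congr_ae (Eventually.of_forall fun ξ => ?_)
  simp only [hn, inner_neg_left, neg_neg]
  rw [Real.fourierInv_eq_fourier_neg, smul_mul_assoc]

theorem fourier_gauss {s : ℝ} (hs : 0 < s) (x : E3) :
    𝓕 (fun ξ : E3 => (gauss s ξ : ℂ)) x = (heat s x : ℂ) := by
  have := fourier_gauss_modulated hs 0 x
  simp only [inner_zero_left, Complex.ofReal_zero, mul_zero, Complex.exp_zero, mul_one,
    zero_sub] at this
  rw [this]
  simp [heat]

/-- The operator is convolution with a positive kernel of mass one, so Minkowski makes it a
contraction. -/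
theorem lintegral_fourier_gauss_mul_le {f : E3 → ℂ} (hf : Integrable f) (hfm : Measurable f)
    {s : ℝ} (hs : 0 < s) {k : ℕ} (hk : 2 ≤ k) :
    ∫⁻ x, ‖𝓕 (fun ξ => (gauss s ξ : ℂ) * 𝓕⁻ f ξ) x‖ₑ ^ k ≤ ∫⁻ x, ‖f x‖ₑ ^ k := by
  have hk1 : (1 : ℝ) < k := by exact_mod_cast hk
  set N := ∫⁻ x, ‖f x‖ₑ ^ k with hN
  have hpt : ∀ x, ‖𝓕 (fun ξ => (gauss s ξ : ℂ) * 𝓕⁻ f ξ) x‖ₑ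
      ≤ ∫⁻ w, ENNReal.ofReal (heat s w) * ‖f (x - w)‖ₑ := by
    intro x
    rw [← integral_fourier_sub_mul (m := fun ξ => (gauss s ξ : ℂ)) (integrable_gauss hs).ofReal hf]
    rw [← integral_sub_left_eq_self _ volume x]
    refine (enorm_integral_le_lintegral_enorm _).trans (lintegral_mono fun w => ?_)
    simp only
    rw [enorm_mul, sub_sub_cancel, fourier_gauss hs, ← ofReal_norm ((heat s w : ℝ) : ℂ),
      Complex.norm_real, Real.norm_of_nonneg (heat_nonneg hs w)]
  have hmink := lintegral_rpow_lintegral_le (μ := (volume : Measure E3)) (ν := (volume : Measure E3))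
    (F := fun x w => ENNReal.ofReal (heat s w) * ‖f (x - w)‖ₑ)
    (by
      have h1 : Measurable fun z : E3 × E3 => heat s z.2 :=
        (continuous_heat s).measurable.comp measurable_snd
      have h2 : Measurable fun z : E3 × E3 => f (z.1 - z.2) := hfm.comp (by fun_prop)
      exact h1.ennreal_ofReal.mul h2.enorm)
    (c := fun w => ENNReal.ofReal (heat s w) * N ^ (1 / k : ℝ))
    ((continuous_heat s).measurable.ennreal_ofReal.mul_const _) hk1 (fun w => by
      rw [ENNReal.mul_rpow_of_nonneg _ _ (by positivity), ← ENNReal.rpow_mul,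
        one_div_mul_cancel (by positivity), ENNReal.rpow_one]
      simp_rw [ENNReal.mul_rpow_of_nonneg _ _ (show (0 : ℝ) ≤ k by positivity), ENNReal.rpow_natCast]
      rw [lintegral_const_mul' _ _ (ENNReal.pow_ne_top ENNReal.ofReal_ne_top), hN,
        lintegral_sub_right_eq_self (fun x => ‖f x‖ₑ ^ k) w])
  rw [lintegral_mul_const _ (continuous_heat s).measurable.ennreal_ofReal,
    ← ofReal_integral_eq_lintegral_ofReal (integrable_heat hs)
      (Eventually.of_forall (heat_nonneg hs)), integral_heat hs, ENNReal.ofReal_one, one_mul,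
    ← ENNReal.rpow_mul, one_div_mul_cancel (by positivity), ENNReal.rpow_one] at hmink
  simp_rw [ENNReal.rpow_natCast] at hmink
  exact (lintegral_mono fun x => pow_le_pow_left' (hpt x) k).trans hmink

theorem hasFDerivAt_heat (s : ℝ) (x : E3) :
    HasFDerivAt (heat s) ((-2 * Real.pi * s * heat s x) • innerSL ℝ x) x := by
  have h1 := ((hasStrictFDerivAt_norm_sq x).hasFDerivAt.const_mul (-Real.pi * s)).exp.const_mul
    (s ^ (3 / 2 : ℝ))
  refine h1.congr_fderiv ?_
  ext y
  simp [heat]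
  ring

theorem fderiv_fourier_apply {f : E3 → ℂ} (hf : Integrable f)
    (hf' : Integrable fun v => ‖v‖ * ‖f v‖) (x z : E3) :
    fderiv ℝ (𝓕 f) x z = 𝓕 (fun v => (-(2 * Real.pi * Complex.I) * (inner ℝ v z : ℝ)) * f v) x := by
  rw [Real.fderiv_fourier hf hf']
  have hi : Integrable (VectorFourier.fourierSMulRight (innerSL ℝ) f) := by
    refine (hf'.const_mul (2 * Real.pi * ‖(innerSL ℝ : E3 →L[ℝ] E3 →L[ℝ] ℝ)‖)).mono'
      hf.aestronglyMeasurable.fourierSMulRight (Eventually.of_forall fun v => ?_)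
    refine (VectorFourier.norm_fourierSMulRight_le _ _ _).trans (le_of_eq ?_)
    ring
  rw [Real.fourier_eq, ContinuousLinearMap.integral_apply]
  · rw [Real.fourier_eq]
    refine integral_congr_ae (Eventually.of_forall fun v => ?_)
    change Real.fourierChar (-inner ℝ v x) • (VectorFourier.fourierSMulRight (innerSL ℝ) f v z) = _
    rw [VectorFourier.fourierSMulRight_apply]
    congr 1
    simp only [Complex.real_smul, smul_eq_mul]
    rw [show (innerSL ℝ) v z = inner ℝ v z from rfl]
    ring
  · exact (Real.fourierIntegral_convergent_iff x).2 hi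

/-- With u = |ξ|/√s this is u ≤ e^{πu²/2}: doubling s pays for one factor |ξ|. All moments of the
regularised symbols are integrated in this way. -/
theorem norm_mul_gauss_le {s : ℝ} (hs : 0 < s) (ξ : E3) :
    ‖ξ‖ * gauss s ξ ≤ Real.sqrt s * gauss (2 * s) ξ := by
  have hsq : 0 < Real.sqrt s := Real.sqrt_pos.2 hs
  have hss : Real.sqrt s ^ 2 = s := Real.sq_sqrt hs.le
  set u := ‖ξ‖ / Real.sqrt s with hu
  have hξ : ‖ξ‖ = u * Real.sqrt s := by rw [hu]; field_simp
  have hu0 : 0 ≤ u := by positivity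
  have h1 : u ≤ Real.exp (Real.pi * u ^ 2 / 2) := by
    have := Real.add_one_le_exp (Real.pi * u ^ 2 / 2)
    nlinarith [Real.pi_gt_three, sq_nonneg (u - 1), sq_nonneg u]
  have h2 : gauss (2 * s) ξ = gauss s ξ * Real.exp (Real.pi * u ^ 2 / 2) := by
    unfold gauss
    rw [← Real.exp_add, hξ, mul_pow, hss]
    congr 1; field_simp; ring
  rw [h2, hξ]
  have := gauss_pos s ξ
  calc u * Real.sqrt s * gauss s ξ ≤ Real.exp (Real.pi * u ^ 2 / 2) * Real.sqrt s * gauss s ξ := by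
        gcongr
    _ = _ := by ring

theorem integrable_norm_mul_gauss {s : ℝ} (hs : 0 < s) : Integrable fun ξ => ‖ξ‖ * gauss s ξ :=
  ((integrable_gauss (by positivity : 0 < 2 * s)).const_mul (Real.sqrt s)).mono'
    (Continuous.aestronglyMeasurable (by fun_prop)) (Eventually.of_forall fun ξ => by
      rw [Real.norm_of_nonneg (mul_nonneg (norm_nonneg _) (gauss_pos _ _).le)]
      exact norm_mul_gauss_le hs ξ)

theorem integrable_norm_sq_mul_gauss {s : ℝ} (hs : 0 < s) :
    Integrable fun ξ => ‖ξ‖ * (‖ξ‖ * gauss s ξ) :=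
  ((integrable_norm_mul_gauss (by positivity : 0 < 2 * s)).const_mul (Real.sqrt s)).mono'
    (Continuous.aestronglyMeasurable (by fun_prop)) (Eventually.of_forall fun ξ => by
      have := gauss_pos s ξ
      rw [Real.norm_of_nonneg (by positivity)]
      calc _ ≤ ‖ξ‖ * (Real.sqrt s * gauss (2 * s) ξ) := by
            exact mul_le_mul_of_nonneg_left (norm_mul_gauss_le hs ξ) (norm_nonneg _)
        _ = _ := by ring)

theorem fourier_coord_mul_gauss {s : ℝ} (hs : 0 < s) (e x : E3) :
    𝓕 (fun ξ : E3 => ((inner ℝ ξ e : ℝ) : ℂ) * (gauss s ξ : ℂ)) x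
      = -Complex.I * s * (inner ℝ x e : ℝ) * (heat s x : ℂ) := by
  have hi : Integrable fun ξ : E3 => (gauss s ξ : ℂ) := (integrable_gauss hs).ofReal
  have hi' : Integrable fun ξ : E3 => ‖ξ‖ * ‖(gauss s ξ : ℂ)‖ := by
    refine (integrable_norm_mul_gauss hs).congr (Eventually.of_forall fun ξ => ?_)
    simp only [Complex.norm_real, Real.norm_of_nonneg (gauss_pos s ξ).le]
  have h := fderiv_fourier_apply hi hi' x e
  have h2 : 𝓕 (fun ξ : E3 => (gauss s ξ : ℂ)) = fun x => (heat s x : ℂ) :=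
    funext fun x => fourier_gauss hs x
  have h3 : HasFDerivAt (fun x => (heat s x : ℂ)) _ x :=
    Complex.ofRealCLM.hasFDerivAt.comp x (hasFDerivAt_heat s x)
  have e1 : ∀ (c : ℂ) (u : E3 → ℂ), 𝓕 (fun ξ => c * u ξ) x = c * 𝓕 u x := by
    intro c u
    simp only [Real.fourier_eq, ← integral_const_mul]
    refine integral_congr_ae (Eventually.of_forall fun ξ => ?_)
    simp only [Circle.smul_def, smul_eq_mul]; ring
  simp_rw [mul_assoc (-(2 * (Real.pi : ℂ) * Complex.I))] at h
  rw [h2, h3.fderiv, e1] at h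
  simp only [ContinuousLinearMap.comp_apply, smul_apply,
    Complex.ofRealCLM_apply, smul_eq_mul, innerSL_apply_apply] at h
  have hpi : (Real.pi : ℂ) ≠ 0 := by exact_mod_cast Real.pi_ne_zero
  have hne : -(2 * (Real.pi : ℂ) * Complex.I) ≠ 0 := by simp [hpi]
  apply mul_left_cancel₀ hne
  rw [← h]
  push_cast
  linear_combination (-2 * (Real.pi : ℂ) * s * heat s x * (inner ℝ x e : ℝ)) * Complex.I_sq

/-! ### The regularised gradient of the Newton potential -/

/-- `∫_a^b ½ s⁻¹ G_s(x) ds`, with `G_s = heat s`. -/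
def kap (a b : ℝ) (x : E3) : ℝ := ∫ s in Set.Ioc a b, 1 / 2 * s⁻¹ * heat s x

/-- The regularisation `x_i ∫_a^b ½ s⁻¹ G_s(x) ds` of `x_i / (4π|x|³)`. -/
def kern (a b : ℝ) (i : Fin 3) (x : E3) : ℝ := x i * kap a b x

/-- `∫_a^b s⁻² e^{-π|ξ|²/s} ds`. -/
def kapHat (a b : ℝ) (ξ : E3) : ℝ := ∫ s in Set.Ioc a b, (s ^ 2)⁻¹ * gauss s ξ

/-- The function with Fourier transform `kern a b i`. -/
def kernHat (a b : ℝ) (i : Fin 3) (ξ : E3) : ℂ := Complex.I / 2 * (ξ i : ℂ) * (kapHat a b ξ : ℂ)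

theorem gauss_mono {s t : ℝ} (hs : 0 < s) (hst : s ≤ t) (ξ : E3) : gauss s ξ ≤ gauss t ξ := by
  unfold gauss
  rw [Real.exp_le_exp, neg_mul, neg_div, neg_div, neg_le_neg_iff]
  have := Real.pi_pos
  gcongr


theorem continuousOn_gauss_param {a b : ℝ} (ha : 0 < a) (ξ : E3) :
    ContinuousOn (fun s => (s ^ 2)⁻¹ * gauss s ξ) (Set.Icc a b) := by
  unfold gauss
  refine ContinuousOn.mul (ContinuousOn.inv₀ (by fun_prop) fun s hs => ?_)
    (ContinuousOn.rexp (ContinuousOn.div (by fun_prop) (by fun_prop) fun s hs => ?_))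
  · have := ha.trans_le hs.1; positivity
  · have := ha.trans_le hs.1; positivity

theorem integrableOn_gauss_param {a b : ℝ} (ha : 0 < a) (ξ : E3) :
    IntegrableOn (fun s => (s ^ 2)⁻¹ * gauss s ξ) (Set.Ioc a b) :=
  ((continuousOn_gauss_param ha ξ).integrableOn_Icc).mono_set Set.Ioc_subset_Icc_self

theorem kapHat_nonneg {a b : ℝ} (ha : 0 < a) (ξ : E3) : 0 ≤ kapHat a b ξ :=
  setIntegral_nonneg measurableSet_Ioc fun s hs => by
    have := ha.trans hs.1
    exact mul_nonneg (by positivity) (gauss_pos _ _).le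

theorem kapHat_le {a b : ℝ} (ha : 0 < a) (hab : a ≤ b) (ξ : E3) : kapHat a b ξ ≤ (b - a) * (a ^ 2)⁻¹ * gauss b ξ := by
  have h : kapHat a b ξ ≤ ∫ s in Set.Ioc a b, (a ^ 2)⁻¹ * gauss b ξ := by
    refine setIntegral_mono_on (integrableOn_gauss_param ha ξ) (integrableOn_const (by simp))
      measurableSet_Ioc fun s hs => ?_
    have h0 := ha.trans hs.1
    have h1 := gauss_mono h0 hs.2 ξ
    have h3 := (gauss_pos s ξ).le
    have h2 := hs.1.le
    gcongr
  refine h.trans (le_of_eq ?_)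
  rw [setIntegral_const, Real.volume_real_Ioc_of_le hab, smul_eq_mul]; ring

/-- The integrand times π|ξ|² is the derivative in s of e^{-π|ξ|²/s}. This is why the integral over
s inverts the Laplacian up to two Gaussian cut-offs. -/
theorem pi_norm_sq_mul_kapHat {a b : ℝ} (ha : 0 < a) (hab : a ≤ b) (ξ : E3) :
    Real.pi * ‖ξ‖ ^ 2 * kapHat a b ξ = gauss b ξ - gauss a ξ := by
  rw [kapHat, ← integral_const_mul, ← intervalIntegral.integral_of_le hab]
  have hc := (continuousOn_gauss_param ha (b := b) ξ)
  refine intervalIntegral.integral_eq_sub_of_hasDerivAt (f := fun s => gauss s ξ) (fun s hs => ?_) ?_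
  · rw [Set.uIcc_of_le hab] at hs
    have h0 : s ≠ 0 := (ha.trans_le hs.1).ne'
    have := ((hasDerivAt_inv h0).const_mul (-Real.pi * ‖ξ‖ ^ 2)).exp
    unfold gauss
    simp only [div_eq_mul_inv]
    refine this.congr_deriv ?_
    ring
  · refine ContinuousOn.intervalIntegrable ?_
    rw [Set.uIcc_of_le hab]
    exact continuousOn_const.mul hc

theorem measurable_kapHat (a b : ℝ) : Measurable (kapHat a b) := by
  have h : Measurable fun z : E3 × ℝ => (z.2 ^ 2)⁻¹ * gauss z.2 z.1 := by
    unfold gauss; fun_prop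
  exact (h.stronglyMeasurable.integral_prod_right (ν := volume.restrict (Set.Ioc a b))).measurable

theorem measurable_kernHat (a b : ℝ) (i : Fin 3) : Measurable (kernHat a b i) := by
  unfold kernHat
  have h1 : Measurable fun ξ : E3 => ξ i := by fun_prop
  exact (measurable_const.mul (Complex.measurable_ofReal.comp h1)).mul
    (Complex.measurable_ofReal.comp (measurable_kapHat a b))

theorem norm_kernHat_le {a b : ℝ} (ha : 0 < a) (hab : a ≤ b) (i : Fin 3) (ξ : E3) :
    ‖kernHat a b i ξ‖ ≤ 1 / 2 * ((b - a) * (a ^ 2)⁻¹) * (‖ξ‖ * gauss b ξ) := by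
  rw [kernHat, norm_mul, norm_mul, norm_div, Complex.norm_I, Complex.norm_real, Complex.norm_real,
    Real.norm_of_nonneg (kapHat_nonneg ha ξ), Complex.norm_ofNat]
  have h1 := kapHat_le ha hab ξ
  have h2 := PiLp.norm_apply_le ξ i
  have h3 := kapHat_nonneg (b := b) ha ξ
  calc _ ≤ 1 / 2 * ‖ξ‖ * ((b - a) * (a ^ 2)⁻¹ * gauss b ξ) := by gcongr
    _ = _ := by ring

theorem integrable_kernHat {a b : ℝ} (ha : 0 < a) (hab : a ≤ b) (i : Fin 3) : Integrable (kernHat a b i) :=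
  ((integrable_norm_mul_gauss (ha.trans_le hab)).const_mul _).mono'
    (measurable_kernHat a b i).aestronglyMeasurable (Eventually.of_forall (norm_kernHat_le ha hab i))

theorem integrable_norm_mul_kernHat {a b : ℝ} (ha : 0 < a) (hab : a ≤ b) (i : Fin 3) : Integrable fun ξ => ‖ξ‖ * ‖kernHat a b i ξ‖ :=
  ((integrable_norm_sq_mul_gauss (ha.trans_le hab)).const_mul
    (1 / 2 * ((b - a) * (a ^ 2)⁻¹))).mono'
    (Measurable.aestronglyMeasurable (measurable_norm.mul (measurable_kernHat a b i).norm))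
    (Eventually.of_forall fun ξ => by
      rw [norm_mul, norm_norm, norm_norm]
      calc _ ≤ ‖ξ‖ * (1 / 2 * ((b - a) * (a ^ 2)⁻¹) * (‖ξ‖ * gauss b ξ)) := by
            gcongr; exact norm_kernHat_le ha hab i ξ
        _ = _ := by ring)

theorem fourier_kernHat {a b : ℝ} (ha : 0 < a) (hab : a ≤ b) (i : Fin 3) (x : E3) : 𝓕 (kernHat a b i) x = (kern a b i x : ℂ) := by
  set e : E3 := EuclideanSpace.single i 1 with he
  have hin : ∀ y : E3, inner ℝ y e = y i := fun y => by
    rw [he, EuclideanSpace.inner_single_right]; simp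
  have hb := ha.trans_le hab
  have hmeas : AEStronglyMeasurable (fun z : E3 × ℝ => Real.fourierChar (-inner ℝ z.1 x) •
      (Complex.I / 2 * (z.1 i : ℂ) * (((z.2 ^ 2)⁻¹ * gauss z.2 z.1 : ℝ) : ℂ)))
      (volume.prod (volume.restrict (Set.Ioc a b))) := by
    have h2 : Continuous fun z : E3 × ℝ => Real.fourierChar (-inner ℝ z.1 x) :=
      Real.continuous_fourierChar.comp (by fun_prop)
    have h3 : Measurable fun z : E3 × ℝ => (z.2 ^ 2)⁻¹ * gauss z.2 z.1 := by
      unfold gauss; fun_prop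
    have h4 : Measurable fun z : E3 × ℝ => z.1 i := by fun_prop
    exact h2.aestronglyMeasurable.smul ((measurable_const.mul (Complex.measurable_ofReal.comp h4)).mul
      (Complex.measurable_ofReal.comp h3)).aestronglyMeasurable
  have hint : Integrable (fun z : E3 × ℝ => Real.fourierChar (-inner ℝ z.1 x) •
      (Complex.I / 2 * (z.1 i : ℂ) * (((z.2 ^ 2)⁻¹ * gauss z.2 z.1 : ℝ) : ℂ)))
      (volume.prod (volume.restrict (Set.Ioc a b))) := by
    refine ((integrable_norm_mul_gauss hb).mul_prod (integrable_const (a ^ 2)⁻¹)).mono' hmeas ?_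
    have : ∀ᵐ z ∂((volume : Measure E3).prod (volume.restrict (Set.Ioc a b))),
        z.2 ∈ Set.Ioc a b :=
      Measure.quasiMeasurePreserving_snd.ae (ae_restrict_mem measurableSet_Ioc)
    filter_upwards [this] with z hz
    have h0 := ha.trans hz.1
    rw [Circle.norm_smul, norm_mul, norm_mul, norm_div, Complex.norm_I, Complex.norm_real,
      Complex.norm_real, norm_mul, Real.norm_of_nonneg (gauss_pos _ _).le, Complex.norm_ofNat,
      Real.norm_of_nonneg (by positivity : (0 : ℝ) ≤ (z.2 ^ 2)⁻¹)]
    have h1 := gauss_mono h0 hz.2 z.1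
    have h2 := PiLp.norm_apply_le z.1 i
    have h3 : (z.2 ^ 2)⁻¹ ≤ (a ^ 2)⁻¹ := by have := hz.1.le; gcongr
    have h4 := gauss_pos z.2 z.1
    calc _ ≤ 1 * ‖z.1‖ * ((a ^ 2)⁻¹ * gauss b z.1) := by gcongr; norm_num
      _ = _ := by ring
  have e1 : ∀ ξ : E3, Real.fourierChar (-inner ℝ ξ x) • kernHat a b i ξ
      = ∫ s in Set.Ioc a b, Real.fourierChar (-inner ℝ ξ x) •
        (Complex.I / 2 * (ξ i : ℂ) * (((s ^ 2)⁻¹ * gauss s ξ : ℝ) : ℂ)) := by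
    intro ξ
    simp only [Circle.smul_def, smul_eq_mul]
    rw [integral_const_mul, integral_const_mul, integral_complex_ofReal, kernHat, kapHat]
  rw [Real.fourier_eq]
  simp_rw [e1]
  rw [integral_integral_swap hint, kern, kap, ← integral_const_mul, ← integral_complex_ofReal]
  refine setIntegral_congr_fun measurableSet_Ioc fun s hs => ?_
  have hs0 := ha.trans hs.1
  have h := fourier_coord_mul_gauss hs0 e x
  simp_rw [hin] at h
  have : ∀ ξ : E3, Real.fourierChar (-inner ℝ ξ x) •
        (Complex.I / 2 * (ξ i : ℂ) * (((s ^ 2)⁻¹ * gauss s ξ : ℝ) : ℂ))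
      = (Complex.I / 2 * ((s : ℂ) ^ 2)⁻¹) *
        (Real.fourierChar (-inner ℝ ξ x) • ((ξ i : ℂ) * (gauss s ξ : ℂ))) := by
    intro ξ
    simp only [Circle.smul_def, smul_eq_mul]
    push_cast; ring
  simp_rw [this]
  rw [integral_const_mul, ← Real.fourier_eq, h]
  have hsc : (s : ℂ) ≠ 0 := by exact_mod_cast hs0.ne'
  push_cast
  field_simp
  linear_combination (-(x i : ℂ) * heat s x) * Complex.I_sq

theorem continuous_fourierInv {f : E3 → ℂ} (hf : Integrable f) : Continuous (𝓕⁻ f) := by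
  rw [funext fun x => Real.fourierInv_eq_fourier_neg f x]
  exact (continuous_fourier hf).comp continuous_neg

theorem norm_fourierInv_le (f : E3 → ℂ) (x : E3) : ‖𝓕⁻ f x‖ ≤ ∫ y, ‖f y‖ := by
  rw [Real.fourierInv_eq_fourier_neg]; exact norm_fourier_le _

theorem fourierInv_ofReal_neg (f : E3 → ℝ) (ξ : E3) :
    𝓕⁻ (fun x => (f x : ℂ)) (-ξ) = conj (𝓕⁻ (fun x => (f x : ℂ)) ξ) := by
  simp only [Real.fourierInv_eq', ← integral_conj]
  refine integral_congr_ae (Eventually.of_forall fun y => ?_)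
  simp only [smul_eq_mul, map_mul, Complex.conj_ofReal, ← Complex.exp_conj, inner_neg_right,
    Complex.conj_I]
  congr 2
  push_cast; ring

/-- The symbol of `∂_z (kern a b i * ·)`. -/
def gradSymbol (a b : ℝ) (i : Fin 3) (z ξ : E3) : ℂ :=
  -(2 * Real.pi * Complex.I) * (inner ℝ ξ z : ℝ) * kernHat a b i ξ

/-- π|ξ|² times the integral over s telescopes, so the gradient of the regularised kernel is the
difference of two Gaussian smoothings of a double Riesz transform. Its bounds therefore do not
depend on a and b. -/
theorem gradSymbol_eq {a b : ℝ} (ha : 0 < a) (hab : a ≤ b) (i : Fin 3) (z ξ : E3) :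
    gradSymbol a b i z ξ = -(rieszSymbol z ξ * (rieszSymbol (EuclideanSpace.single i 1) ξ *
      (gauss b ξ - gauss a ξ : ℂ))) := by
  have hin : inner ℝ (EuclideanSpace.single i (1 : ℝ)) ξ = ξ i := by
    rw [EuclideanSpace.inner_single_left]; simp
  rcases eq_or_ne ξ 0 with rfl | hξ
  · simp [gradSymbol, rieszSymbol]
  have hn : (‖ξ‖ : ℂ) ≠ 0 := by exact_mod_cast (norm_pos_iff.2 hξ).ne'
  have h : ((gauss b ξ : ℂ) - gauss a ξ) = Real.pi * ‖ξ‖ ^ 2 * kapHat a b ξ := by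
    have := pi_norm_sq_mul_kapHat ha hab ξ
    exact_mod_cast this.symm
  rw [h, gradSymbol, kernHat, rieszSymbol, rieszSymbol, hin, real_inner_comm]
  push_cast
  field_simp

theorem integrable_conv_kern {a b : ℝ} (ha : 0 < a) (hab : a ≤ b) (i : Fin 3) {f : E3 → ℂ}
    (hf : Integrable f) (x : E3) : Integrable fun w => (kern a b i (x - w) : ℂ) * f w := by
  refine hf.bdd_mul (c := ∫ ξ, ‖kernHat a b i ξ‖) ?_ (Eventually.of_forall fun w => ?_)
  · simp_rw [← fourier_kernHat ha hab]
    exact ((continuous_fourier (integrable_kernHat ha hab i)).comp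
      (continuous_const.sub continuous_id)).aestronglyMeasurable
  · rw [← fourier_kernHat ha hab]; exact norm_fourier_le _

/-- The fundamental theorem of calculus along the segment from x to x+z: an increment becomes an
average of translates of the directional derivative, so an L^p bound for the derivative passes to
increments with the factor |z|. -/
theorem conv_kern_sub_eq {a b : ℝ} (ha : 0 < a) (hab : a ≤ b) (i : Fin 3) {f : E3 → ℂ}
    (hf : Integrable f) (x z : E3) :
    ∫ w, ((kern a b i (x + z - w) - kern a b i (x - w) : ℝ) : ℂ) * f w
      = ∫ t in (0 : ℝ)..1, 𝓕 (fun ξ => gradSymbol a b i z ξ * 𝓕⁻ f ξ) (x + t • z) := by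
  set g : E3 → ℂ := fun ξ => kernHat a b i ξ * 𝓕⁻ f ξ with hg
  have hfm := (continuous_fourierInv hf).measurable
  have hgi : Integrable g := (integrable_kernHat ha hab i).mul_bdd (c := ∫ y, ‖f y‖)
    hfm.aestronglyMeasurable (Eventually.of_forall (norm_fourierInv_le f))
  have hgi' : Integrable fun ξ => ‖ξ‖ * ‖g ξ‖ := by
    have := (integrable_norm_mul_kernHat ha hab i).mul_bdd (c := ∫ y, ‖f y‖)
      (f := fun ξ => ‖ξ‖ * ‖kernHat a b i ξ‖) (g := fun ξ => ‖𝓕⁻ f ξ‖)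
      hfm.norm.aestronglyMeasurable (Eventually.of_forall fun ξ => by
        rw [norm_norm]; exact norm_fourierInv_le f ξ)
    refine this.congr (Eventually.of_forall fun ξ => ?_)
    simp only [hg, norm_mul]; ring
  have hconv : ∀ y, ∫ w, (kern a b i (y - w) : ℂ) * f w = 𝓕 g y := by
    intro y
    rw [hg, ← integral_fourier_sub_mul (integrable_kernHat ha hab i) hf]
    simp_rw [fourier_kernHat ha hab]
  have hsym : (fun ξ => gradSymbol a b i z ξ * 𝓕⁻ f ξ)
      = fun ξ => (-(2 * Real.pi * Complex.I) * (inner ℝ ξ z : ℝ)) * g ξ := by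
    ext ξ; simp only [gradSymbol, hg]; ring
  have hderiv : ∀ t : ℝ, HasDerivAt (fun t : ℝ => 𝓕 g (x + t • z))
      (𝓕 (fun ξ => gradSymbol a b i z ξ * 𝓕⁻ f ξ) (x + t • z)) t := by
    intro t
    have h1 : HasFDerivAt (𝓕 g) (fderiv ℝ (𝓕 g) (x + t • z)) (x + t • z) :=
      (Real.differentiable_fourier hgi hgi' _).hasFDerivAt
    have h2 : HasDerivAt (fun t : ℝ => x + t • z) z t := by
      simpa using ((hasDerivAt_id t).smul_const z).const_add x
    have := h1.comp_hasDerivAt t h2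
    rwa [fderiv_fourier_apply hgi hgi', ← hsym] at this
  have hi : Integrable fun ξ => gradSymbol a b i z ξ * 𝓕⁻ f ξ := by
    rw [hsym]
    refine (hgi'.const_mul (2 * Real.pi * ‖z‖)).mono'
      (Continuous.aestronglyMeasurable (by fun_prop) |>.mul hgi.aestronglyMeasurable)
      (Eventually.of_forall fun ξ => ?_)
    rw [norm_mul, norm_mul, norm_neg, norm_mul, norm_mul, Complex.norm_I, Complex.norm_real,
      Complex.norm_real, Complex.norm_ofNat, Real.norm_of_nonneg Real.pi_pos.le]
    have := norm_inner_le_norm (𝕜 := ℝ) ξ z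
    calc _ ≤ 2 * Real.pi * 1 * (‖ξ‖ * ‖z‖) * ‖g ξ‖ := by gcongr
      _ = _ := by ring
  have hcont : Continuous fun t : ℝ => 𝓕 (fun ξ => gradSymbol a b i z ξ * 𝓕⁻ f ξ) (x + t • z) :=
    (continuous_fourier hi).comp (by fun_prop)
  rw [intervalIntegral.integral_eq_sub_of_hasDerivAt (fun t _ => hderiv t)
    (hcont.intervalIntegrable 0 1)]
  simp only [one_smul, zero_smul, add_zero]
  rw [← hconv, ← hconv, ← integral_sub (integrable_conv_kern ha hab i hf _)
    (integrable_conv_kern ha hab i hf _)]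
  refine integral_congr_ae (Eventually.of_forall fun w => ?_)
  simp only
  push_cast; ring

/-! ### Calderón-Zygmund bounds for the regularised gradient. -/

/-- The constant in the estimate of `∇ (kern a b i * f)`. -/
def gradConst : ℝ≥0∞ := 4 * rieszConst ^ 2

theorem gradConst_ne_top : gradConst ≠ ⊤ :=
  ENNReal.mul_ne_top (by simp) (ENNReal.pow_ne_top rieszConst_ne_top)

theorem integrableBdd_gauss_mul {s : ℝ} (hs : 0 < s) {f : E3 → ℂ} (hf : Integrable f) :
    IntegrableBdd fun ξ => (gauss s ξ : ℂ) * 𝓕⁻ f ξ := by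
  refine ⟨(integrable_gauss hs).ofReal.mul_bdd (c := ∫ y, ‖f y‖)
    (continuous_fourierInv hf).aestronglyMeasurable (Eventually.of_forall (norm_fourierInv_le f)),
    1 * ∫ y, ‖f y‖, fun ξ => ?_⟩
  rw [norm_mul, Complex.norm_real, Real.norm_of_nonneg (gauss_pos _ _).le]
  gcongr
  · exact gauss_le_one hs ξ
  · exact norm_fourierInv_le f ξ

/-- The two Gaussian terms are treated separately. In each, the Riesz transforms act on a smoothed
f, whose frequency side is integrable and bounded, and Hermitian symmetry survives each Riesz
symbol, so their bound can be applied twice. -/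
theorem lintegral_gradSymbol_le {a b : ℝ} (ha : 0 < a) (hab : a ≤ b) (i : Fin 3) {f : E3 → ℝ}
    (hf : Integrable f) (hfm : Measurable f) (z : E3) {k : ℕ} (hk : k = 2 ∨ k = 4) :
    ∫⁻ x, ‖𝓕 (fun ξ => gradSymbol a b i z ξ * 𝓕⁻ (fun x => (f x : ℂ)) ξ) x‖ₑ ^ k
      ≤ (gradConst * ‖z‖ₑ) ^ k * ∫⁻ x, ‖f x‖ₑ ^ k := by
  have hk2 : 2 ≤ k := by omega
  set fc : E3 → ℂ := fun x => (f x : ℂ) with hfc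
  have hfci : Integrable fc := hf.ofReal
  have hfcm : Measurable fc := Complex.measurable_ofReal.comp hfm
  set e : E3 := EuclideanSpace.single i 1 with he
  set T : ℝ → E3 → ℂ := fun s =>
    𝓕 fun ξ => rieszSymbol z ξ * (rieszSymbol e ξ * ((gauss s ξ : ℂ) * 𝓕⁻ fc ξ)) with hT
  have hb := ha.trans_le hab
  have hsingle : ∀ s, 0 < s → IntegrableBdd fun ξ => rieszSymbol z ξ * (rieszSymbol e ξ *
      ((gauss s ξ : ℂ) * 𝓕⁻ fc ξ)) := fun s hs =>
    (((integrableBdd_gauss_mul hs hfci).mul (measurable_rieszSymbol e) (norm_rieszSymbol_le e)).mul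
      (measurable_rieszSymbol z) (norm_rieszSymbol_le z))
  have hbound : ∀ s, 0 < s → ∫⁻ x, ‖T s x‖ₑ ^ k
      ≤ (rieszConst ^ 2 * ‖z‖ₑ) ^ k * ∫⁻ x, ‖f x‖ₑ ^ k := by
    intro s hs
    have hm1 : Measurable fun ξ => (gauss s ξ : ℂ) * 𝓕⁻ fc ξ :=
      (Complex.measurable_ofReal.comp (continuous_gauss s).measurable).mul
        (continuous_fourierInv hfci).measurable
    have hh1 : ∀ ξ, (gauss s (-ξ) : ℂ) * 𝓕⁻ fc (-ξ) = conj ((gauss s ξ : ℂ) * 𝓕⁻ fc ξ) := by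
      intro ξ
      rw [map_mul, Complex.conj_ofReal, hfc, fourierInv_ofReal_neg]
      simp [gauss]
    have hb1 := integrableBdd_gauss_mul hs hfci
    have h1 := lintegral_fourier_rieszSymbol_le hb1 hm1 hh1 e hk
    have h2 := lintegral_fourier_rieszSymbol_le
      (hb1.mul (measurable_rieszSymbol e) (norm_rieszSymbol_le e))
      ((measurable_rieszSymbol e).mul hm1)
      (fun ξ => by rw [hh1, rieszSymbol_neg, ← map_mul]) z hk
    have h3 := lintegral_fourier_gauss_mul_le hfci hfcm hs hk2
    have he1 : ‖e‖ₑ = 1 := by rw [he, ← ofReal_norm]; simp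
    calc ∫⁻ x, ‖T s x‖ₑ ^ k
        ≤ (rieszConst * ‖z‖ₑ) ^ k * ((rieszConst * ‖e‖ₑ) ^ k * ∫⁻ x, ‖fc x‖ₑ ^ k) := by
          refine h2.trans ?_
          gcongr
          refine h1.trans ?_
          gcongr
      _ = _ := by
          have : ∀ x, ‖fc x‖ₑ = ‖f x‖ₑ := fun x => by
            rw [hfc, ← ofReal_norm, ← ofReal_norm, Complex.norm_real]
          simp_rw [this]
          rw [he1, mul_one]; ring
  have hsub : ∀ x, 𝓕 (fun ξ => gradSymbol a b i z ξ * 𝓕⁻ fc ξ) x = T a x - T b x := by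
    intro x
    simp only [hT, Real.fourier_eq]
    rw [← integral_sub ((Real.fourierIntegral_convergent_iff x).2 (hsingle a ha).integrable)
      ((Real.fourierIntegral_convergent_iff x).2 (hsingle b hb).integrable)]
    refine integral_congr_ae (Eventually.of_forall fun ξ => ?_)
    simp only
    rw [← smul_sub, gradSymbol_eq ha hab]
    congr 1; ring
  have hTm : ∀ s, 0 < s → Measurable fun x => ‖T s x‖ₑ ^ k := fun s hs =>
    (continuous_fourier (hsingle s hs).integrable).measurable.enorm.pow_const k
  calc ∫⁻ x, ‖𝓕 (fun ξ => gradSymbol a b i z ξ * 𝓕⁻ fc ξ) x‖ₑ ^ k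
      ≤ ∫⁻ x, 2 ^ k * (‖T a x‖ₑ ^ k + ‖T b x‖ₑ ^ k) := by
        refine lintegral_mono fun x => ?_
        rw [hsub]
        have h1 : ‖T a x - T b x‖ₑ ≤ 2 * max ‖T a x‖ₑ ‖T b x‖ₑ := by
          refine (enorm_sub_le).trans ?_
          rw [two_mul]
          exact add_le_add (le_max_left _ _) (le_max_right _ _)
        refine (pow_le_pow_left' h1 k).trans ?_
        rw [mul_pow]
        gcongr
        rcases max_cases ‖T a x‖ₑ ‖T b x‖ₑ with ⟨h, -⟩ | ⟨h, -⟩ <;> rw [h]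
        · exact le_self_add
        · exact le_add_self
    _ = 2 ^ k * ((∫⁻ x, ‖T a x‖ₑ ^ k) + ∫⁻ x, ‖T b x‖ₑ ^ k) := by
        rw [lintegral_const_mul' _ _ (ENNReal.pow_ne_top (by simp)), lintegral_add_left (hTm a ha)]
    _ ≤ 2 ^ k * ((rieszConst ^ 2 * ‖z‖ₑ) ^ k * (∫⁻ x, ‖f x‖ₑ ^ k)
        + (rieszConst ^ 2 * ‖z‖ₑ) ^ k * ∫⁻ x, ‖f x‖ₑ ^ k) := by
        gcongr
        · exact hbound a ha
        · exact hbound b hb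
    _ = (2 * 2 ^ k) * ((rieszConst ^ 2 * ‖z‖ₑ) ^ k * ∫⁻ x, ‖f x‖ₑ ^ k) := by ring
    -- The factor 2 from the two terms is enlarged to 2^k, so that the constant is the k-th power of
    -- 4 times the square of the Riesz constant.
    _ ≤ (2 ^ k * 2 ^ k) * ((rieszConst ^ 2 * ‖z‖ₑ) ^ k * ∫⁻ x, ‖f x‖ₑ ^ k) := by
        gcongr
        exact le_self_pow₀ (by norm_num) (by omega)
    _ = _ := by
        rw [gradConst, ← mul_pow, show (2 : ℝ≥0∞) * 2 = 4 by norm_num, ← mul_assoc, ← mul_pow]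
        ring

/-- Restricted strong type `(3,3)` for differences of `kern a b i * f`. -/
theorem lintegral_conv_kern_sub_le {a b : ℝ} (ha : 0 < a) (hab : a ≤ b) (i : Fin 3) {f : E3 → ℝ}
    (hfm : Measurable f) (hf1 : ∀ x, |f x| ≤ 1) (hfs : volume (Function.support f) ≠ ⊤) (z : E3) :
    ∫⁻ x, ‖∫ w, (kern a b i (x + z - w) - kern a b i (x - w)) * f w‖ₑ ^ (3 : ℝ)
      ≤ (gradConst * ‖z‖ₑ) ^ (3 : ℝ) * volume (Function.support f) := by
  set A := Function.support f with hA
  have hAm : MeasurableSet A := measurableSet_support hfm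
  have hf : Integrable f := by
    have h1 : IntegrableOn f A := Measure.integrableOn_of_bounded (M := 1) hfs
      hfm.aestronglyMeasurable (Eventually.of_forall hf1)
    exact (integrableOn_iff_integrable_of_support_subset subset_rfl).1 h1
  set fc : E3 → ℂ := fun x => (f x : ℂ) with hfc
  have hfci : Integrable fc := hf.ofReal
  set M : E3 → ℂ := 𝓕 (fun ξ => gradSymbol a b i z ξ * 𝓕⁻ fc ξ) with hM
  have hsym : Integrable fun ξ => gradSymbol a b i z ξ * 𝓕⁻ fc ξ := by
    have h1 : Integrable (gradSymbol a b i z) := by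
      refine ((integrable_norm_mul_kernHat ha hab i).const_mul (2 * Real.pi * ‖z‖)).mono'
        ((Continuous.aestronglyMeasurable (by fun_prop)).mul
          (measurable_kernHat a b i).aestronglyMeasurable) (Eventually.of_forall fun ξ => ?_)
      rw [gradSymbol, norm_mul, norm_mul, norm_neg, norm_mul, norm_mul, Complex.norm_I,
        Complex.norm_real, Complex.norm_real, Complex.norm_ofNat,
        Real.norm_of_nonneg Real.pi_pos.le]
      have := norm_inner_le_norm (𝕜 := ℝ) ξ z
      calc _ ≤ 2 * Real.pi * 1 * (‖ξ‖ * ‖z‖) * ‖kernHat a b i ξ‖ := by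
            gcongr
        _ = _ := by ring
    exact h1.mul_bdd (c := ∫ y, ‖fc y‖) (continuous_fourierInv hfci).aestronglyMeasurable
      (Eventually.of_forall (norm_fourierInv_le fc))
  have hMc : Continuous M := continuous_fourier hsym
  have hfk : ∀ k : ℕ, k ≠ 0 → ∫⁻ x, ‖f x‖ₑ ^ k ≤ volume A := by
    intro k hk
    rw [← lintegral_indicator_one hAm]
    refine lintegral_mono fun x => ?_
    by_cases hx : x ∈ A
    · rw [Set.indicator_of_mem hx]
      refine pow_le_one' ?_ k
      rw [Real.enorm_eq_ofReal_abs, ENNReal.ofReal_le_one]; exact hf1 x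
    · have : f x = 0 := by simpa [hA] using hx
      simp [this, hk]
  have hMk : ∀ k : ℕ, (k = 2 ∨ k = 4) →
      ∫⁻ x, ‖M x‖ₑ ^ k ≤ (gradConst * ‖z‖ₑ) ^ k * volume A := fun k hk =>
    (lintegral_gradSymbol_le ha hab i hf hfm z hk).trans (by gcongr; exact hfk k (by omega))
  -- Interpolation by Cauchy-Schwarz, |M|³ = |M| · |M|². Since |f| ≤ 1, both the L² and the L⁴
  -- integrals of f are at most |A|, and the geometric mean again carries |A| to the first power.
  have hM3 : ∫⁻ x, ‖M x‖ₑ ^ (3 : ℝ) ≤ (gradConst * ‖z‖ₑ) ^ (3 : ℝ) * volume A := by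
    have hcs := ENNReal.lintegral_mul_le_Lp_mul_Lq (volume : Measure E3)
      (Real.HolderConjugate.two_two) (f := fun x => ‖M x‖ₑ) (g := fun x => ‖M x‖ₑ ^ 2)
      hMc.measurable.enorm.aemeasurable (hMc.measurable.enorm.pow_const 2).aemeasurable
    calc ∫⁻ x, ‖M x‖ₑ ^ (3 : ℝ) = ∫⁻ x, ((fun x => ‖M x‖ₑ) * fun x => ‖M x‖ₑ ^ 2) x := by
          refine lintegral_congr fun x => ?_
          rw [show (3 : ℝ) = ((3 : ℕ) : ℝ) by norm_num, ENNReal.rpow_natCast, Pi.mul_apply]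
          ring
      _ ≤ _ := hcs
      _ = (∫⁻ x, ‖M x‖ₑ ^ 2) ^ (1 / 2 : ℝ) * (∫⁻ x, ‖M x‖ₑ ^ 4) ^ (1 / 2 : ℝ) := by
          have h2 : ∀ y : ℝ≥0∞, y ^ (2 : ℝ) = y ^ 2 := fun y => by
            rw [← ENNReal.rpow_natCast]; norm_num
          simp_rw [h2, ← pow_mul]
      _ ≤ ((gradConst * ‖z‖ₑ) ^ 2 * volume A) ^ (1 / 2 : ℝ)
          * ((gradConst * ‖z‖ₑ) ^ 4 * volume A) ^ (1 / 2 : ℝ) := by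
          gcongr
          · exact hMk 2 (by simp)
          · exact hMk 4 (by simp)
      _ = _ := by
          rw [← ENNReal.mul_rpow_of_nonneg _ _ (by norm_num)]
          have : (gradConst * ‖z‖ₑ) ^ 2 * volume A * ((gradConst * ‖z‖ₑ) ^ 4 * volume A)
              = ((gradConst * ‖z‖ₑ) ^ 3 * volume A) ^ 2 := by ring
          rw [this, ← ENNReal.rpow_natCast (_ * _) 2, ← ENNReal.rpow_mul]
          norm_num
  have hpt : ∀ x, ‖∫ w, (kern a b i (x + z - w) - kern a b i (x - w)) * f w‖ₑ
      ≤ ∫⁻ t in Set.Ioc (0 : ℝ) 1, ‖M (x + t • z)‖ₑ := by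
    intro x
    have h := conv_kern_sub_eq ha hab i hfci x z
    rw [intervalIntegral.integral_of_le zero_le_one] at h
    have h2 : ‖∫ w, (kern a b i (x + z - w) - kern a b i (x - w)) * f w‖ₑ
        = ‖∫ w, ((kern a b i (x + z - w) - kern a b i (x - w) : ℝ) : ℂ) * fc w‖ₑ := by
      have : ∀ w, ((kern a b i (x + z - w) - kern a b i (x - w) : ℝ) : ℂ) * fc w
          = (((kern a b i (x + z - w) - kern a b i (x - w)) * f w : ℝ) : ℂ) := fun w => by
        simp only [hfc]; push_cast; ring
      simp_rw [this]
      rw [integral_complex_ofReal, ← ofReal_norm, ← ofReal_norm, Complex.norm_real]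
    rw [h2, h]
    exact enorm_integral_le_lintegral_enorm _
  set N := (gradConst * ‖z‖ₑ) ^ (3 : ℝ) * volume A with hN
  have hmink := lintegral_rpow_lintegral_le (μ := (volume : Measure E3))
    (ν := volume.restrict (Set.Ioc (0 : ℝ) 1)) (F := fun x t => ‖M (x + t • z)‖ₑ)
    (hMc.comp (by fun_prop : Continuous fun p : E3 × ℝ => p.1 + p.2 • z)).measurable.enorm
    (c := fun _ => N ^ (1 / 3 : ℝ)) measurable_const (by norm_num : (1 : ℝ) < 3) (fun t => by
      rw [lintegral_add_right_eq_self (fun x => ‖M x‖ₑ ^ (3 : ℝ)) (t • z), ← ENNReal.rpow_mul]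
      norm_num
      exact_mod_cast hM3)
  refine (lintegral_mono fun x => ENNReal.rpow_le_rpow (hpt x) (by norm_num)).trans
    (hmink.trans (le_of_eq ?_))
  rw [setLIntegral_const, Real.volume_Ioc, sub_zero, ENNReal.ofReal_one, mul_one,
    ← ENNReal.rpow_mul]
  norm_num

/-! ### Pointwise bounds for the regularised kernel, uniform in a and b. -/

theorem half_inv_mul_heat {s : ℝ} (hs : 0 < s) (x : E3) :
    1 / 2 * s⁻¹ * heat s x = 1 / 2 * (s ^ (1 / 2 : ℝ) * Real.exp (-(Real.pi * ‖x‖ ^ 2 * s))) := by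
  unfold heat
  have : s⁻¹ * s ^ (3 / 2 : ℝ) = s ^ (1 / 2 : ℝ) := by
    rw [← Real.rpow_neg_one, ← Real.rpow_add hs]; norm_num
  rw [← this]; ring_nf

theorem integrableOn_sqrt_mul_exp {r : ℝ} (hr : 0 < r) :
    IntegrableOn (fun s : ℝ => s ^ (1 / 2 : ℝ) * Real.exp (-(r * s))) (Set.Ioi 0) := by
  have := integrableOn_rpow_mul_exp_neg_mul_rpow (p := 1) (s := 1 / 2) (b := r)
    (by norm_num) (by norm_num) hr
  simpa using this

theorem setIntegral_sqrt_mul_exp_le {a b r : ℝ} (ha : 0 < a) (hr : 0 < r) :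
    ∫ s in Set.Ioc a b, s ^ (1 / 2 : ℝ) * Real.exp (-(r * s))
      ≤ (1 / r) ^ (3 / 2 : ℝ) * Real.Gamma (3 / 2) := by
  have h := Real.integral_rpow_mul_exp_neg_mul_Ioi (a := 3 / 2) (by norm_num) hr
  rw [← h]
  rw [show (3 / 2 - 1 : ℝ) = 1 / 2 by norm_num]
  refine setIntegral_mono_set (integrableOn_sqrt_mul_exp hr) ?_
    (LE.le.eventuallyLE fun s (hs : s ∈ Set.Ioc a b) => ha.trans hs.1)
  filter_upwards [ae_restrict_mem measurableSet_Ioi] with s hs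
  have : (0 : ℝ) < s := hs
  simp only [Pi.zero_apply]
  positivity

theorem one_div_mul_sq_rpow {c x : ℝ} (hc : 0 < c) (hx : 0 < x) :
    (1 / (c ^ 2 * x ^ 2)) ^ (3 / 2 : ℝ) = (c ^ 3)⁻¹ * (x ^ 3)⁻¹ := by
  rw [show 1 / (c ^ 2 * x ^ 2) = ((c * x)⁻¹) ^ 2 by field_simp, ← Real.rpow_natCast,
    ← Real.rpow_mul (by positivity)]
  norm_num
  rw [mul_pow]; ring

theorem continuousOn_half_inv_mul_heat {a b : ℝ} (ha : 0 < a) (x : E3) :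
    ContinuousOn (fun s => 1 / 2 * s⁻¹ * heat s x) (Set.Icc a b) := by
  unfold heat
  refine ContinuousOn.mul (ContinuousOn.mul (by fun_prop) (ContinuousOn.inv₀ (by fun_prop)
    fun s hs => (ha.trans_le hs.1).ne')) (ContinuousOn.mul (ContinuousOn.rpow_const (by fun_prop)
      fun s hs => Or.inl (ha.trans_le hs.1).ne') (by fun_prop))

theorem integrableOn_half_inv_mul_heat {a b : ℝ} (ha : 0 < a) (x : E3) :
    IntegrableOn (fun s => 1 / 2 * s⁻¹ * heat s x) (Set.Ioc a b) :=
  (continuousOn_half_inv_mul_heat ha x).integrableOn_Icc.mono_set Set.Ioc_subset_Icc_self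

theorem kap_nonneg {a b : ℝ} (ha : 0 < a) (x : E3) : 0 ≤ kap a b x :=
  setIntegral_nonneg measurableSet_Ioc fun s hs => by
    have := ha.trans hs.1
    exact mul_nonneg (by positivity) (heat_nonneg this x)

/-- By positivity the integral over (a, b] is at most the one over (0, ∞), a Gamma integral
homogeneous of degree -3 in |x|; the numerical factor is then relaxed. -/
theorem kap_le {a b : ℝ} (ha : 0 < a) {x : E3} (hx : x ≠ 0) :
    kap a b x ≤ Real.Gamma (3 / 2) * (‖x‖ ^ 3)⁻¹ := by
  have hn : 0 < ‖x‖ := norm_pos_iff.2 hx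
  have hG : 0 < Real.Gamma (3 / 2) := Real.Gamma_pos_of_pos (by norm_num)
  have hr : 0 < Real.pi * ‖x‖ ^ 2 := by positivity
  have e : kap a b x = 1 / 2 * ∫ s in Set.Ioc a b,
      s ^ (1 / 2 : ℝ) * Real.exp (-(Real.pi * ‖x‖ ^ 2 * s)) := by
    rw [kap, ← integral_const_mul]
    exact setIntegral_congr_fun measurableSet_Ioc fun s hs => half_inv_mul_heat (ha.trans hs.1) x
  rw [e]
  have h1 := setIntegral_sqrt_mul_exp_le (b := b) ha hr
  have h2 : (1 / (Real.pi * ‖x‖ ^ 2)) ^ (3 / 2 : ℝ) ≤ (‖x‖ ^ 3)⁻¹ := by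
    have := one_div_mul_sq_rpow (c := 1) one_pos hn
    simp only [one_pow, one_mul, inv_one] at this
    rw [← this]
    have hp : 1 ≤ Real.pi := by linarith [Real.pi_gt_three]
    gcongr
    nlinarith [sq_nonneg ‖x‖]
  have h3 : (0 : ℝ) < (‖x‖ ^ 3)⁻¹ := by positivity
  nlinarith

theorem abs_kern_le {a b : ℝ} (ha : 0 < a) (i : Fin 3) (x : E3) :
    |kern a b i x| ≤ Real.Gamma (3 / 2) * (‖x‖ ^ 2)⁻¹ := by
  rcases eq_or_ne x 0 with rfl | hx
  · simp [kern]
  have hn : 0 < ‖x‖ := norm_pos_iff.2 hx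
  rw [kern, abs_mul, abs_of_nonneg (kap_nonneg ha x)]
  have h1 := kap_le (b := b) ha hx
  have h2 := PiLp.norm_apply_le x i
  rw [Real.norm_eq_abs] at h2
  calc _ ≤ ‖x‖ * (Real.Gamma (3 / 2) * (‖x‖ ^ 3)⁻¹) :=
        mul_le_mul h2 h1 (kap_nonneg ha x) (norm_nonneg _)
    _ = _ := by field_simp

/-- Mean value inequality on the ball of radius |q|/2 about q, where every point has norm at least
|q|/2. With u = πs|x|², the gradient is at most (1 + 2u) times the Gaussian; the factor 1 + 2u ≤
3e^{u/2} uses half of the decay, and u/2 ≥ π|q|²s/8. -/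
theorem abs_coord_mul_heat_sub_le {s : ℝ} (hs : 0 < s) (i : Fin 3) {p q : E3}
    (h : ‖p - q‖ ≤ ‖q‖ / 2) :
    |p i * heat s p - q i * heat s q|
      ≤ 3 * s ^ (3 / 2 : ℝ) * Real.exp (-(Real.pi / 8 * ‖q‖ ^ 2 * s)) * ‖p - q‖ := by
  set D : E3 → E3 →L[ℝ] ℝ := fun x => x i • ((-2 * Real.pi * s * heat s x) • innerSL ℝ x)
    + heat s x • EuclideanSpace.proj i with hD
  have hd : ∀ x, HasFDerivAt (fun x : E3 => x i * heat s x) (D x) x := fun x =>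
    ((EuclideanSpace.proj (𝕜 := ℝ) i : E3 →L[ℝ] ℝ).hasFDerivAt (x := x)).mul (hasFDerivAt_heat s x)
  have hDn : ∀ x ∈ Metric.closedBall q (‖q‖ / 2),
      ‖D x‖ ≤ 3 * s ^ (3 / 2 : ℝ) * Real.exp (-(Real.pi / 8 * ‖q‖ ^ 2 * s)) := by
    intro x hx
    have hxq : ‖q‖ / 2 ≤ ‖x‖ := by
      have h1 : ‖x - q‖ ≤ ‖q‖ / 2 := by simpa [dist_eq_norm] using hx
      have h2 := norm_sub_norm_le q x
      rw [norm_sub_rev] at h2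
      linarith
    have hh := heat_nonneg hs x
    have hpi := Real.pi_pos
    have h1 : ‖D x‖ ≤ heat s x * (1 + 2 * (Real.pi * s * ‖x‖ ^ 2)) := by
      refine ContinuousLinearMap.opNorm_le_bound _ (by positivity) fun y => ?_
      have e1 : D x y = heat s x * (y i - 2 * Real.pi * s * x i * inner ℝ x y) := by
        simp only [hD, add_apply, smul_apply,
          innerSL_apply_apply, smul_eq_mul, EuclideanSpace.coe_proj]
        ring
      rw [e1, norm_mul, Real.norm_of_nonneg hh, mul_assoc (heat s x)]
      refine mul_le_mul_of_nonneg_left ?_ hh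
      have a1 := PiLp.norm_apply_le y i
      have a2 := PiLp.norm_apply_le x i
      have a3 := norm_inner_le_norm (𝕜 := ℝ) x y
      calc ‖y i - 2 * Real.pi * s * x i * inner ℝ x y‖
          ≤ ‖y i‖ + ‖2 * Real.pi * s * x i * inner ℝ x y‖ := norm_sub_le _ _
        _ = ‖y i‖ + 2 * Real.pi * s * ‖x i‖ * ‖inner ℝ x y‖ := by
            rw [norm_mul, norm_mul, Real.norm_of_nonneg (by positivity : 0 ≤ 2 * Real.pi * s)]
        _ ≤ ‖y‖ + 2 * Real.pi * s * ‖x‖ * (‖x‖ * ‖y‖) := by gcongr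
        _ = _ := by ring
    refine h1.trans ?_
    set u := Real.pi * s * ‖x‖ ^ 2 with hu
    have hu0 : 0 ≤ u := by positivity
    have h2 : 1 + 2 * u ≤ 3 * Real.exp (u / 2) := by
      have := Real.quadratic_le_exp_of_nonneg (by positivity : 0 ≤ u / 2)
      nlinarith [sq_nonneg (u - 1)]
    have h3 : heat s x * Real.exp (u / 2) = s ^ (3 / 2 : ℝ) * Real.exp (-(u / 2)) := by
      rw [heat, mul_assoc, ← Real.exp_add]
      congr 2; rw [hu]; ring
    have h4 : Real.exp (-(u / 2)) ≤ Real.exp (-(Real.pi / 8 * ‖q‖ ^ 2 * s)) := by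
      rw [Real.exp_le_exp, neg_le_neg_iff, hu]
      have : ‖q‖ ^ 2 / 4 ≤ ‖x‖ ^ 2 := by
        have := pow_le_pow_left₀ (by positivity) hxq 2
        linarith [this, show (‖q‖ / 2) ^ 2 = ‖q‖ ^ 2 / 4 by ring]
      nlinarith [mul_pos hpi hs]
    calc heat s x * (1 + 2 * u) ≤ heat s x * (3 * Real.exp (u / 2)) := by gcongr
      _ = 3 * s ^ (3 / 2 : ℝ) * Real.exp (-(u / 2)) := by linarith [h3]
      _ ≤ _ := by gcongr
  have := (convex_closedBall q (‖q‖ / 2)).norm_image_sub_le_of_norm_hasFDerivWithin_le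
    (fun x _ => (hd x).hasFDerivWithinAt) hDn (Metric.mem_closedBall_self (by positivity))
    (show p ∈ Metric.closedBall q (‖q‖ / 2) by simpa [dist_eq_norm] using h)
  simpa using this

/-- If |p-q| ≤ |q|/2, the mean value bound integrated in s gives the Lipschitz constant |q|⁻³
expected of a kernel homogeneous of degree -2, and the constant 12 is (3/2) · 8. Otherwise |q| <
2|p-q| and the size bounds for the two values suffice. The extra factor |q| is what lowers the
non-integrable |q|⁻³ to |q|⁻². -/
theorem abs_kern_sub_mul_le {a b : ℝ} (ha : 0 < a) (i : Fin 3) (p q : E3) :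
    |kern a b i p - kern a b i q| * ‖q‖
      ≤ 12 * Real.Gamma (3 / 2) * ‖p - q‖ * ((‖p‖ ^ 2)⁻¹ + (‖q‖ ^ 2)⁻¹) := by
  have hG : 0 < Real.Gamma (3 / 2) := Real.Gamma_pos_of_pos (by norm_num)
  rcases eq_or_ne q 0 with rfl | hq
  · rw [norm_zero, mul_zero]; positivity
  have hn : 0 < ‖q‖ := norm_pos_iff.2 hq
  rcases le_or_gt ‖p - q‖ (‖q‖ / 2) with h | h
  · have e : kern a b i p - kern a b i q
        = ∫ s in Set.Ioc a b, 1 / 2 * s⁻¹ * (p i * heat s p - q i * heat s q) := by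
      rw [kern, kern, kap, kap, ← integral_const_mul, ← integral_const_mul, ← integral_sub
        ((integrableOn_half_inv_mul_heat ha p).const_mul _)
        ((integrableOn_half_inv_mul_heat ha q).const_mul _)]
      congr 1; ext s; ring
    have hr : 0 < Real.pi / 8 * ‖q‖ ^ 2 := by have := Real.pi_pos; positivity
    have h1 : |kern a b i p - kern a b i q| ≤ ∫ s in Set.Ioc a b, 3 / 2 * ‖p - q‖ *
        (s ^ (1 / 2 : ℝ) * Real.exp (-(Real.pi / 8 * ‖q‖ ^ 2 * s))) := by
      rw [e, ← Real.norm_eq_abs]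
      refine norm_integral_le_of_norm_le (((integrableOn_sqrt_mul_exp hr).mono_set
        (fun s hs => ha.trans hs.1)).const_mul _) ?_
      filter_upwards [ae_restrict_mem measurableSet_Ioc] with s hs
      have hs0 := ha.trans hs.1
      rw [norm_mul, Real.norm_of_nonneg (by positivity : 0 ≤ 1 / 2 * s⁻¹), Real.norm_eq_abs]
      have hss : s⁻¹ * s ^ (3 / 2 : ℝ) = s ^ (1 / 2 : ℝ) := by
        rw [← Real.rpow_neg_one, ← Real.rpow_add hs0]; norm_num
      rw [← hss]
      calc _ ≤ 1 / 2 * s⁻¹ * (3 * s ^ (3 / 2 : ℝ) * Real.exp (-(Real.pi / 8 * ‖q‖ ^ 2 * s))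
            * ‖p - q‖) := by
            gcongr; exact abs_coord_mul_heat_sub_le hs0 i h
        _ = _ := by ring
    rw [integral_const_mul] at h1
    have h2 := setIntegral_sqrt_mul_exp_le (b := b) ha hr
    have h3 : (1 / (Real.pi / 8 * ‖q‖ ^ 2)) ^ (3 / 2 : ℝ) ≤ 8 * (‖q‖ ^ 3)⁻¹ := by
      have := one_div_mul_sq_rpow (c := 1 / 2) (by norm_num) hn
      have h8 : ((1 / 2 : ℝ) ^ 3)⁻¹ = 8 := by norm_num
      rw [h8] at this
      rw [← this]
      have hp := Real.pi_gt_three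
      have : (1 / 2 : ℝ) ^ 2 ≤ Real.pi / 8 := by norm_num; linarith
      gcongr
    calc _ ≤ 3 / 2 * ‖p - q‖ * ((8 * (‖q‖ ^ 3)⁻¹) * Real.Gamma (3 / 2)) * ‖q‖ := by
          gcongr
          refine h1.trans ?_
          gcongr
          exact h2.trans (by gcongr)
      _ = 12 * Real.Gamma (3 / 2) * ‖p - q‖ * (0 + (‖q‖ ^ 2)⁻¹) := by field_simp; ring
      _ ≤ _ := by gcongr; positivity
  · have h1 := abs_kern_le (b := b) ha i p
    have h2 := abs_kern_le (b := b) ha i q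
    have h3 := abs_sub (kern a b i p) (kern a b i q)
    calc _ ≤ (Real.Gamma (3 / 2) * ((‖p‖ ^ 2)⁻¹ + (‖q‖ ^ 2)⁻¹)) * (12 * ‖p - q‖) := by
          gcongr
          · linarith
          · linarith
      _ = _ := by ring

theorem continuous_kern {a b : ℝ} (ha : 0 < a) (hab : a ≤ b) (i : Fin 3) :
    Continuous (kern a b i) := by
  have h := Complex.continuous_re.comp (continuous_fourier (integrable_kernHat ha hab i))
  refine h.congr fun x => ?_
  rw [Function.comp_apply, fourier_kernHat ha hab, Complex.ofReal_re]

theorem integrable_kern_mul {a b : ℝ} (ha : 0 < a) (hab : a ≤ b) (i : Fin 3) {f : E3 → ℝ}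
    (hf : Measurable f) (hZ : lorentzNorm 3 1 f ≠ ⊤) (x : E3) :
    Integrable fun w => kern a b i (x - w) * f w := by
  have hc := continuous_kern ha hab i
  refine ⟨(Measurable.mul (by fun_prop) hf).aestronglyMeasurable, ?_⟩
  have hG : 0 < Real.Gamma (3 / 2) := Real.Gamma_pos_of_pos (by norm_num)
  calc ∫⁻ w, ‖kern a b i (x - w) * f w‖ₑ
      ≤ ∫⁻ w, ENNReal.ofReal (Real.Gamma (3 / 2)) *
          (‖f w‖ₑ * ENNReal.ofReal (‖x - w‖ ^ 2)⁻¹) := by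
        refine lintegral_mono fun w => ?_
        rw [enorm_mul, mul_comm, ← mul_assoc, mul_comm _ ‖f w‖ₑ, mul_assoc]
        gcongr
        rw [← ENNReal.ofReal_mul hG.le, Real.enorm_eq_ofReal_abs]
        exact ENNReal.ofReal_le_ofReal (abs_kern_le ha i _)
    _ ≤ ENNReal.ofReal (Real.Gamma (3 / 2)) * (potConst * lorentzNorm 3 1 f) := by
        rw [lintegral_const_mul' _ _ ENNReal.ofReal_ne_top]
        gcongr
        exact lintegral_enorm_mul_inv_sq_le hf x
    _ < ⊤ := (ENNReal.mul_ne_top ENNReal.ofReal_ne_top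
        (ENNReal.mul_ne_top potConst_ne_top hZ)).lt_top

/-- Needed because 0 · ∞ = 0: a level set of infinite measure makes the layer bound trivial only if
its coefficient does not vanish. -/
theorem gradConst_ne_zero : gradConst ≠ 0 := by
  unfold gradConst rieszConst
  refine mul_ne_zero (by norm_num) (pow_ne_zero 2 (mul_ne_zero (mul_ne_zero (by norm_num) ?_) ?_))
  · exact (Metric.measure_closedBall_pos volume _ one_pos).ne'
  · rw [ENNReal.ofReal_ne_zero_iff]; exact inv_pos.2 ballMoment_pos

/-! ### From level sets to L^{3,1}: the L³ Lipschitz bound. -/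

/-- The layers of `f`: the sign of `f` on `{|f| > l}`. -/
def layer (f : E3 → ℝ) (l : ℝ) (w : E3) : ℝ := if l < |f w| then Real.sign (f w) else 0

theorem measurable_layer {f : E3 → ℝ} (hf : Measurable f) :
    Measurable fun z : E3 × ℝ => layer f z.2 z.1 := by
  unfold layer
  have h1 : Measurable fun z : E3 × ℝ => |f z.1| := (hf.comp measurable_fst).abs
  exact Measurable.ite (measurableSet_lt measurable_snd h1)
    (measurable_real_sign.comp (hf.comp measurable_fst)) measurable_const

theorem abs_layer_le (f : E3 → ℝ) (l : ℝ) (w : E3) : |layer f l w| ≤ 1 := by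
  unfold layer; split_ifs
  · exact abs_real_sign_le _
  · simp

theorem setIntegral_layer (f : E3 → ℝ) (w : E3) : ∫ l in Set.Ioi (0 : ℝ), layer f l w = f w := by
  have : (fun l => layer f l w) = Set.indicator (Set.Iio |f w|) fun _ => Real.sign (f w) := by
    ext l; simp [layer, Set.indicator_apply]
  rw [this, setIntegral_indicator measurableSet_Iio, setIntegral_const, Set.Ioi_inter_Iio,
    Real.volume_real_Ioo_of_le (abs_nonneg _), smul_eq_mul, sub_zero]
  rcases lt_trichotomy (f w) 0 with h | h | h
  · rw [abs_of_neg h, Real.sign_of_neg h]; ring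
  · simp [h]
  · rw [abs_of_pos h, Real.sign_of_pos h]; ring

theorem lintegral_enorm_layer (f : E3 → ℝ) (w : E3) :
    ∫⁻ l in Set.Ioi (0 : ℝ), ‖layer f l w‖ₑ ≤ ‖f w‖ₑ := by
  rw [enorm_eq_lintegral_layer]
  refine lintegral_mono fun l => ?_
  by_cases h : l < |f w|
  · rw [Set.indicator_of_mem (by simpa using h), Real.enorm_eq_ofReal_abs, ENNReal.ofReal_le_one]
    exact abs_layer_le f l w
  · simp [layer, h]

/-- Differences of `kern a b i * f` are Lipschitz in `L³` for `f` in the Lorentz space `L^{3,1}`. -/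
theorem lintegral_kern_sub_rpow_le {a b : ℝ} (ha : 0 < a) (hab : a ≤ b) (i : Fin 3) {f : E3 → ℝ}
    (hf : Measurable f) (hZ : lorentzNorm 3 1 f ≠ ⊤) (z : E3) :
    ∫⁻ x, ‖∫ w, (kern a b i (x + z - w) - kern a b i (x - w)) * f w‖ₑ ^ (3 : ℝ)
      ≤ (gradConst * ‖z‖ₑ * lorentzNorm 3 1 f) ^ (3 : ℝ) := by
  rcases eq_or_ne z 0 with rfl | hz
  · simp
  have hc := continuous_kern ha hab i
  have hcz : gradConst * ‖z‖ₑ ≠ 0 := mul_ne_zero gradConst_ne_zero (by simpa using hz)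
  have hcz' : gradConst * ‖z‖ₑ ≠ ⊤ := ENNReal.mul_ne_top gradConst_ne_top enorm_ne_top
  set K : E3 → E3 → ℝ := fun x w => kern a b i (x + z - w) - kern a b i (x - w) with hK
  have hKm : Continuous fun p : E3 × E3 => K p.1 p.2 := by
    simp only [hK]; fun_prop
  have hlm := measurable_layer hf
  have hKf : ∀ x, Integrable fun w => K x w * f w := by
    intro x
    refine ((integrable_kern_mul ha hab i hf hZ (x + z)).sub
      (integrable_kern_mul ha hab i hf hZ x)).congr (Eventually.of_forall fun w => ?_)
    simp only [hK, Pi.sub_apply]; ring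
  have hpt : ∀ x, ‖∫ w, K x w * f w‖ₑ
      ≤ ∫⁻ l in Set.Ioi (0 : ℝ), ‖∫ w, K x w * layer f l w‖ₑ := by
    intro x
    have hKx : Measurable fun w => K x w := (hKm.comp (by fun_prop : Continuous fun w => (x, w))).measurable
    have hint : Integrable (fun p : E3 × ℝ => K x p.1 * layer f p.2 p.1)
        (volume.prod (volume.restrict (Set.Ioi 0))) := by
      have hm : Measurable fun p : E3 × ℝ => K x p.1 * layer f p.2 p.1 :=
        (hKx.comp measurable_fst).mul hlm
      refine ⟨hm.aestronglyMeasurable, ?_⟩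
      rw [hasFiniteIntegral_iff_enorm, lintegral_prod _ hm.enorm.aemeasurable]
      refine lt_of_le_of_lt (lintegral_mono fun w => ?_) (hKf x).2
      simp only [enorm_mul]
      rw [lintegral_const_mul' _ _ enorm_ne_top]
      gcongr
      exact lintegral_enorm_layer f w
    -- Fubini for f = ∫₀^∞ (layer at level l) dl. Absolute convergence holds because the absolute
    -- values of the layers integrate to at most |f|.
    have e : ∫ w, K x w * f w = ∫ l in Set.Ioi (0 : ℝ), ∫ w, K x w * layer f l w := by
      rw [← integral_integral_swap hint]
      refine integral_congr_ae (Eventually.of_forall fun w => ?_)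
      simp only
      rw [integral_const_mul, setIntegral_layer]
    rw [e]
    exact enorm_integral_le_lintegral_enorm _
  have hFm : Measurable fun p : E3 × ℝ => ‖∫ w, K p.1 w * layer f p.2 w‖ₑ := by
    have h1 : Measurable fun q : (E3 × ℝ) × E3 => K q.1.1 q.2 * layer f q.1.2 q.2 :=
      (hKm.comp (by fun_prop : Continuous fun q : (E3 × ℝ) × E3 => (q.1.1, q.2))).measurable.mul
        (hlm.comp (by fun_prop : Measurable fun q : (E3 × ℝ) × E3 => (q.2, q.1.2)))
    exact (h1.stronglyMeasurable.integral_prod_right (ν := (volume : Measure E3))).measurable.enorm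
  have hmink := lintegral_rpow_lintegral_le (μ := (volume : Measure E3))
    (ν := volume.restrict (Set.Ioi (0 : ℝ))) (F := fun x l => ‖∫ w, K x w * layer f l w‖ₑ) hFm
    (c := fun l => gradConst * ‖z‖ₑ * distrib f l ^ (1 / 3 : ℝ))
    (measurable_const.mul ((distrib_antitone f).measurable.pow_const _))
    (by norm_num : (1 : ℝ) < 3) (fun l => by
      rw [ENNReal.mul_rpow_of_nonneg _ _ (by norm_num), ← ENNReal.rpow_mul,
        one_div_mul_cancel (by norm_num), ENNReal.rpow_one]
      rcases eq_or_ne (distrib f l) ⊤ with ht | ht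
      -- The right-hand side is infinite here since z ≠ 0; the case z = 0 was split off for this
      -- reason.
      · rw [ht, ENNReal.mul_top (by simpa using hcz)]; exact le_top
      · have hsub : Function.support (layer f l) ⊆ {x | l < |f x|} := by
          intro w hw
          by_contra hw'
          exact hw (by simp only [layer]; exact if_neg hw')
        have hmono := measure_mono (μ := volume) hsub
        refine (lintegral_conv_kern_sub_le ha hab i
          (hlm.comp (by fun_prop : Measurable fun w : E3 => (w, l))) (abs_layer_le f l)
          (ne_top_of_le_ne_top ht hmono) z).trans ?_
        gcongr
        exact hmono)
  refine (lintegral_mono fun x => ENNReal.rpow_le_rpow (hpt x) (by norm_num)).trans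
    (hmink.trans ?_)
  rw [lintegral_const_mul' _ _ hcz']
  gcongr
  exact lintegral_distrib_rpow_le f

/-! ### Axisymmetric fields without swirl -/

theorem rad_pos_iff (x : E3) : rad x ≠ 0 ↔ 0 < x 0 ^ 2 + x 1 ^ 2 := by
  unfold rad
  rw [Ne, Real.sqrt_eq_zero (by positivity)]
  constructor
  · intro h; positivity
  · intro h; exact h.ne'

theorem continuous_rad : Continuous rad := by unfold rad; fun_prop

theorem isOpen_rad_ne_zero : IsOpen {x : E3 | rad x ≠ 0} :=
  isOpen_ne_fun continuous_rad continuous_const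

theorem hasFDerivAt_coord {v : E3 → E3} (hv : ContDiff ℝ 1 v) (x : E3) (j : Fin 3) :
    HasFDerivAt (fun y => v y j) ((EuclideanSpace.proj j : E3 →L[ℝ] ℝ) ∘L fderiv ℝ v x) x :=
  (EuclideanSpace.proj (𝕜 := ℝ) j : E3 →L[ℝ] ℝ).hasFDerivAt.comp x
    (hv.differentiable one_ne_zero x).hasFDerivAt

theorem IsAxisymmetricNoSwirl.coord {v : E3 → E3} (h : IsAxisymmetricNoSwirl v) :
    ∃ m vz : ℝ → ℝ → ℝ, ∀ x : E3, rad x ≠ 0 →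
      v x 0 = m (rad x) (x 2) * x 0 ∧ v x 1 = m (rad x) (x 2) * x 1 ∧ v x 2 = vz (rad x) (x 2) := by
  obtain ⟨vr, vz, h⟩ := h
  refine ⟨fun r z => vr r z / r, vz, fun x hx => ?_⟩
  rw [h x hx]
  simp [eR, eZ]
  constructor <;> ring

/-- The swirl-free condition, differentiated. -/
theorem IsAxisymmetricNoSwirl.swirl_deriv {v : E3 → E3} (h : IsAxisymmetricNoSwirl v)
    (hv : ContDiff ℝ 1 v) {x : E3} (hx : rad x ≠ 0) (y : E3) :
    x 1 * (fderiv ℝ v x y) 0 + v x 0 * y 1 = x 0 * (fderiv ℝ v x y) 1 + v x 1 * y 0 := by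
  obtain ⟨m, vz, h⟩ := h.coord
  -- The horizontal part of v is parallel to x_h, so x₂v¹ = x₁v² off the axis; differentiating this
  -- relation avoids any regularity of the profiles v^r and v^z.
  have hev : (fun y : E3 => y 1 * v y 0) =ᶠ[𝓝 x] fun y => y 0 * v y 1 := by
    filter_upwards [isOpen_rad_ne_zero.mem_nhds hx] with y hy
    obtain ⟨h0, h1, -⟩ := h y hy
    rw [h0, h1]; ring
  have hc : ∀ i : Fin 3, HasFDerivAt (fun y : E3 => y i) (EuclideanSpace.proj i : E3 →L[ℝ] ℝ) x :=
    fun i => (EuclideanSpace.proj (𝕜 := ℝ) i : E3 →L[ℝ] ℝ).hasFDerivAt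
  have d1 := (hc 1).mul (hasFDerivAt_coord hv x 0)
  have d2 := (hc 0).mul (hasFDerivAt_coord hv x 1)
  have := d1.unique (d2.congr_of_eventuallyEq hev)
  have := congrArg (fun L : E3 →L[ℝ] ℝ => L y) this
  simpa [smul_eq_mul] using this

theorem hasDerivAt_e3_iff {f : ℝ → E3} {f' : E3} {t : ℝ} :
    HasDerivAt f f' t ↔ ∀ i, HasDerivAt (fun s => f s i) (f' i) t := by
  simp only [hasDerivAt_iff_hasFDerivAt, ← hasFDerivWithinAt_univ]
  rw [hasFDerivWithinAt_euclidean]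
  refine forall_congr' fun i => ?_
  constructor <;> intro h <;> refine h.congr_fderiv ?_ <;> ext <;> simp

/-- The rotation of `x` about the axis by the angle `t`. -/
def rot (x : E3) (t : ℝ) : E3 :=
  !₂[x 0 * Real.cos t - x 1 * Real.sin t, x 0 * Real.sin t + x 1 * Real.cos t, x 2]

theorem rad_rot (x : E3) (t : ℝ) : rad (rot x t) = rad x := by
  unfold rad rot
  congr 1
  simp
  linear_combination (x 0 ^ 2 + x 1 ^ 2) * Real.sin_sq_add_cos_sq t

theorem hasDerivAt_rot (x : E3) : HasDerivAt (rot x) !₂[-x 1, x 0, 0] 0 := by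
  rw [hasDerivAt_e3_iff]
  intro i
  have hc := Real.hasDerivAt_cos 0
  have hs := Real.hasDerivAt_sin 0
  fin_cases i
  · have := (hc.const_mul (x 0)).sub (hs.const_mul (x 1))
    simpa [rot] using! this
  · have := (hs.const_mul (x 0)).add (hc.const_mul (x 1))
    simpa [rot] using! this
  · simpa [rot] using! hasDerivAt_const (0 : ℝ) (x 2)

/-- The rotational equivariance, differentiated. -/
theorem IsAxisymmetricNoSwirl.rot_deriv {v : E3 → E3} (h : IsAxisymmetricNoSwirl v)
    (hv : ContDiff ℝ 1 v) {x : E3} (hx : rad x ≠ 0) :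
    fderiv ℝ v x !₂[-x 1, x 0, 0] = !₂[-v x 1, v x 0, 0] := by
  obtain ⟨m, vz, h⟩ := h.coord
  obtain ⟨hx0, hx1, -⟩ := h x hx
  have h0 : rot x 0 = x := by
    ext i; fin_cases i <;> simp [rot]
  have hvd : HasFDerivAt v (fderiv ℝ v x) (rot x 0) := by
    rw [h0]; exact (hv.differentiable one_ne_zero x).hasFDerivAt
  have d1 := hvd.comp_hasDerivAt 0 (hasDerivAt_rot x)
  set M := m (rad x) (x 2) with hM
  -- Along a rotation orbit r and z are constant, so the profiles are frozen numbers and need not be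
  -- differentiable.
  have e : v ∘ rot x = fun t => !₂[M * (rot x t) 0, M * (rot x t) 1, vz (rad x) (x 2)] := by
    ext t i
    obtain ⟨a0, a1, a2⟩ := h (rot x t) (by rw [rad_rot]; exact hx)
    have a3 : (rot x t) 2 = x 2 := by simp [rot]
    rw [rad_rot, a3] at a0 a1 a2
    fin_cases i
    · simpa using a0
    · simpa using a1
    · simpa using a2
  have d2 : HasDerivAt (v ∘ rot x) !₂[M * -x 1, M * x 0, 0] 0 := by
    rw [e, hasDerivAt_e3_iff]
    have hr := hasDerivAt_e3_iff.1 (hasDerivAt_rot x)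
    intro i
    fin_cases i
    · simpa using! (hr 0).const_mul M
    · simpa using! (hr 1).const_mul M
    · simpa using! hasDerivAt_const (0 : ℝ) (vz (rad x) (x 2))
  rw [d1.unique d2, hx0, hx1]
  ext i; fin_cases i <;> simp

/-- The vorticity of an axisymmetric field without swirl is `(ω_θ / r) (-x₂, x₁, 0)`. -/
theorem IsAxisymmetricNoSwirl.curl_eq {v : E3 → E3} (h : IsAxisymmetricNoSwirl v)
    (hv : ContDiff ℝ 1 v) {x : E3} (hx : rad x ≠ 0) :
    pderiv 1 2 v x - pderiv 2 1 v x = -x 1 * (omegaTheta v x / rad x) ∧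
    pderiv 2 0 v x - pderiv 0 2 v x = x 0 * (omegaTheta v x / rad x) ∧
    pderiv 0 1 v x - pderiv 1 0 v x = 0 := by
  have hpos := (rad_pos_iff x).1 hx
  have hr2 : rad x ^ 2 = x 0 ^ 2 + x 1 ^ 2 := by
    unfold rad; rw [Real.sq_sqrt hpos.le]
  have hrot := h.rot_deriv hv hx
  have hdec : (!₂[-x 1, x 0, 0] : E3)
      = (-x 1) • EuclideanSpace.single 0 1 + (x 0) • EuclideanSpace.single 1 1 := by
    ext i; fin_cases i <;> simp
  rw [hdec, map_add, map_smul, map_smul] at hrot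
  have r0 : -x 1 * pderiv 0 0 v x + x 0 * pderiv 1 0 v x = -v x 1 := by
    simpa [pderiv] using congrArg (fun u : E3 => u 0) hrot
  have r1 : -x 1 * pderiv 0 1 v x + x 0 * pderiv 1 1 v x = v x 0 := by
    simpa [pderiv] using congrArg (fun u : E3 => u 1) hrot
  have r2 : -x 1 * pderiv 0 2 v x + x 0 * pderiv 1 2 v x = 0 := by
    simpa [pderiv] using congrArg (fun u : E3 => u 2) hrot
  have s0 : x 1 * pderiv 0 0 v x = x 0 * pderiv 0 1 v x + v x 1 := by
    simpa [pderiv] using h.swirl_deriv hv hx (EuclideanSpace.single 0 1)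
  have s1 : x 1 * pderiv 1 0 v x + v x 0 = x 0 * pderiv 1 1 v x := by
    simpa [pderiv] using h.swirl_deriv hv hx (EuclideanSpace.single 1 1)
  have s2 : x 1 * pderiv 2 0 v x = x 0 * pderiv 2 1 v x := by
    simpa [pderiv] using h.swirl_deriv hv hx (EuclideanSpace.single 2 1)
  set c0 := pderiv 1 2 v x - pderiv 2 1 v x with hc0
  set c1 := pderiv 2 0 v x - pderiv 0 2 v x with hc1
  set c2 := pderiv 0 1 v x - pderiv 1 0 v x with hc2
  -- Each relation compares a rotation identity with a no-swirl identity: the third pair makes curl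
  -- v orthogonal to e_r, the first two kill its vertical component off the axis.
  have hperp : x 0 * c0 + x 1 * c1 = 0 := by rw [hc0, hc1]; linarith
  have a0 : x 0 * c2 = 0 := by rw [hc2]; linarith
  have a1 : x 1 * c2 = 0 := by rw [hc2]; linarith
  have hom : omegaTheta v x / rad x = (-x 1 * c0 + x 0 * c1) / rad x ^ 2 := by
    have : omegaTheta v x = (-x 1 * c0 + x 0 * c1) / rad x := by
      simp only [omegaTheta, curl, eTheta, PiLp.inner_apply, Fin.sum_univ_three]
      simp [← hc0, ← hc1]
      ring
    rw [this]; field_simp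
  rw [hom, hr2]
  refine ⟨?_, ?_, ?_⟩
  · field_simp
    linear_combination x 0 * hperp
  · field_simp
    linear_combination x 1 * hperp
  · have : (x 0 ^ 2 + x 1 ^ 2) * c2 = 0 := by linear_combination x 0 * a0 + x 1 * a1
    rcases mul_eq_zero.1 this with h | h
    · exact absurd h hpos.ne'
    · exact h

theorem volume_rad_eq_zero : volume {x : E3 | rad x = 0} = 0 := by
  have hne : EuclideanSpace.single (0 : Fin 3) (1 : ℝ) ≠ 0 := by simp
  refine measure_mono_null (fun x hx => ?_) (volume_inner_eq_zero hne)
  have h : ¬ 0 < x 0 ^ 2 + x 1 ^ 2 := fun h => (rad_pos_iff x).2 h hx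
  have h0 : x 0 = 0 := by
    by_contra h'
    exact h (by positivity)
  change inner ℝ x (EuclideanSpace.single (0 : Fin 3) (1 : ℝ)) = 0
  rw [EuclideanSpace.inner_single_right, h0]; simp

theorem continuous_pderiv {v : E3 → E3} (hv : ContDiff ℝ 1 v) (i j : Fin 3) :
    Continuous (pderiv i j v) := by
  unfold pderiv
  have := (hv.continuous_fderiv one_ne_zero).clm_apply
    (continuous_const (y := EuclideanSpace.single i (1 : ℝ)))
  fun_prop

theorem measurable_omegaTheta_div {v : E3 → E3} (hv : ContDiff ℝ 1 v) :
    Measurable fun x => omegaTheta v x / rad x := by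
  have h := fun i j => (continuous_pderiv hv i j).measurable
  have hr := continuous_rad.measurable
  have e : omegaTheta v = fun x => (pderiv 1 2 v x - pderiv 2 1 v x) * (-(x 1) / rad x)
      + (pderiv 2 0 v x - pderiv 0 2 v x) * (x 0 / rad x) := by
    ext x
    simp only [omegaTheta, curl, eTheta, PiLp.inner_apply, Fin.sum_univ_three]
    simp
    ring
  rw [e]
  have hx : ∀ i : Fin 3, Measurable fun x : E3 => x i := fun i => by fun_prop
  exact ((((h 1 2).sub (h 2 1)).mul ((hx 1).neg.div hr)).add
    (((h 2 0).sub (h 0 2)).mul ((hx 0).div hr))).div hr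

/-! ### Derivatives of the regularised kernel -/

/-- `∂_j (kern a b i)`. -/
def dkern (a b : ℝ) (i j : Fin 3) (x : E3) : ℝ :=
  (𝓕 (gradSymbol a b i (EuclideanSpace.single j 1)) x).re

theorem gradSymbol_single (a b : ℝ) (i j : Fin 3) (ξ : E3) :
    gradSymbol a b i (EuclideanSpace.single j 1) ξ = Real.pi * ξ i * ξ j * kapHat a b ξ := by
  rw [gradSymbol, kernHat, EuclideanSpace.inner_single_right]
  simp only [one_mul, conj_trivial]
  linear_combination (-(Real.pi : ℂ) * ξ j * ξ i * kapHat a b ξ) * Complex.I_sq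

/-- The kernel is a gradient, so its Jacobian is symmetric; on the Fourier side the symbol is
visibly symmetric in i and j. -/
theorem dkern_comm (a b : ℝ) (i j : Fin 3) (x : E3) : dkern a b i j x = dkern a b j i x := by
  have h : gradSymbol a b i (EuclideanSpace.single j 1)
      = gradSymbol a b j (EuclideanSpace.single i 1) := by
    ext ξ
    rw [gradSymbol_single, gradSymbol_single]; ring
  rw [dkern, h, dkern]

theorem integrable_gradSymbol {a b : ℝ} (ha : 0 < a) (hab : a ≤ b) (i : Fin 3) (z : E3) :
    Integrable (gradSymbol a b i z) := by
  refine ((integrable_norm_mul_kernHat ha hab i).const_mul (2 * Real.pi * ‖z‖)).mono'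
    ((Continuous.aestronglyMeasurable (by fun_prop)).mul
      (measurable_kernHat a b i).aestronglyMeasurable) (Eventually.of_forall fun ξ => ?_)
  rw [gradSymbol, norm_mul, norm_mul, norm_neg, norm_mul, norm_mul, Complex.norm_I,
    Complex.norm_real, Complex.norm_real, Complex.norm_ofNat,
    Real.norm_of_nonneg Real.pi_pos.le]
  have := norm_inner_le_norm (𝕜 := ℝ) ξ z
  calc _ ≤ 2 * Real.pi * 1 * (‖ξ‖ * ‖z‖) * ‖kernHat a b i ξ‖ := by gcongr
    _ = _ := by ring

theorem continuous_dkern {a b : ℝ} (ha : 0 < a) (hab : a ≤ b) (i j : Fin 3) :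
    Continuous (dkern a b i j) :=
  Complex.continuous_re.comp (continuous_fourier (integrable_gradSymbol ha hab i _))

theorem differentiable_kern {a b : ℝ} (ha : 0 < a) (hab : a ≤ b) (i : Fin 3) :
    Differentiable ℝ (kern a b i) := by
  have h := Real.differentiable_fourier (integrable_kernHat ha hab i)
    (integrable_norm_mul_kernHat ha hab i)
  have h2 : kern a b i = fun x => Complex.reCLM (𝓕 (kernHat a b i) x) := by
    ext x; rw [fourier_kernHat ha hab]; simp
  rw [h2]
  exact Complex.reCLM.differentiable.comp h

theorem fderiv_kern {a b : ℝ} (ha : 0 < a) (hab : a ≤ b) (i j : Fin 3) (x : E3) :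
    fderiv ℝ (kern a b i) x (EuclideanSpace.single j 1) = dkern a b i j x := by
  have h := Real.differentiable_fourier (integrable_kernHat ha hab i)
    (integrable_norm_mul_kernHat ha hab i)
  have h2 : kern a b i = fun x => Complex.reCLM (𝓕 (kernHat a b i) x) := by
    ext x; rw [fourier_kernHat ha hab]; simp
  rw [h2]
  have h3 := (Complex.reCLM.hasFDerivAt.comp x (h x).hasFDerivAt).fderiv
  have h4 : (fun x => Complex.reCLM (𝓕 (kernHat a b i) x)) = ⇑Complex.reCLM ∘ 𝓕 (kernHat a b i) := rfl
  rw [h4, h3, ContinuousLinearMap.comp_apply, fderiv_fourier_apply (integrable_kernHat ha hab i)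
    (integrable_norm_mul_kernHat ha hab i)]
  rfl

/-- Summing ξ_i² to |ξ|² makes the symbols telescope. This is the regularised form of
div(x/(4π|x|³)) = δ₀. -/
theorem sum_dkern {a b : ℝ} (ha : 0 < a) (hab : a ≤ b) (x : E3) :
    ∑ i, dkern a b i i x = heat b x - heat a x := by
  have hb := ha.trans_le hab
  have e : ∑ i, 𝓕 (gradSymbol a b i (EuclideanSpace.single i 1)) x
      = (heat b x : ℂ) - heat a x := by
    rw [← fourier_gauss ha, ← fourier_gauss hb]
    simp only [Real.fourier_eq]
    rw [← integral_finsetSum _ fun i _ =>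
      (Real.fourierIntegral_convergent_iff x).2 (integrable_gradSymbol ha hab i _),
      ← integral_sub ((Real.fourierIntegral_convergent_iff x).2 (integrable_gauss hb).ofReal)
      ((Real.fourierIntegral_convergent_iff x).2 (integrable_gauss ha).ofReal)]
    refine integral_congr_ae (Eventually.of_forall fun ξ => ?_)
    simp only
    rw [← Finset.smul_sum, ← smul_sub]
    congr 1
    simp_rw [gradSymbol_single]
    have h := pi_norm_sq_mul_kapHat ha hab ξ
    rw [EuclideanSpace.real_norm_sq_eq] at h
    rw [← Complex.ofReal_sub, ← h, Fin.sum_univ_three, Fin.sum_univ_three]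
    push_cast; ring
  have := congrArg Complex.re e
  rw [Complex.re_sum] at this
  simpa [dkern] using this

theorem integral_dkern_mul {a b : ℝ} (ha : 0 < a) (hab : a ≤ b) (i j : Fin 3) {u : E3 → ℝ}
    (hu : ContDiff ℝ 1 u) (hus : HasCompactSupport u) (x : E3) :
    ∫ w, dkern a b i j (x - w) * u w
      = ∫ w, kern a b i (x - w) * fderiv ℝ u w (EuclideanSpace.single j 1) := by
  set e : E3 := EuclideanSpace.single j 1 with he
  have hk := differentiable_kern ha hab i
  have hd : ∀ w, fderiv ℝ (fun w => kern a b i (x - w)) w e = -dkern a b i j (x - w) := by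
    intro w
    have h1 : HasFDerivAt (fun w => x - w) (-ContinuousLinearMap.id ℝ E3) w :=
      (hasFDerivAt_id w).const_sub x
    have h2 := ((hk (x - w)).hasFDerivAt.comp w h1).fderiv
    change fderiv ℝ (kern a b i ∘ fun w => x - w) w e = _
    rw [h2, ContinuousLinearMap.comp_apply]
    simp only [neg_apply, ContinuousLinearMap.id_apply, map_neg]
    rw [he, fderiv_kern ha hab]
  have hkc := continuous_kern ha hab i
  have hdc := continuous_dkern ha hab i j
  have huc := hu.continuous
  have hud : Continuous fun w => fderiv ℝ u w e :=
    (hu.continuous_fderiv one_ne_zero).clm_apply continuous_const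
  have huds : HasCompactSupport fun w => fderiv ℝ u w e := hus.fderiv_apply ℝ e
  have hkd : Differentiable ℝ fun w => kern a b i (x - w) := hk.comp (by fun_prop)
  have := integral_mul_fderiv_eq_neg_fderiv_mul_of_integrable (μ := (volume : Measure E3))
    (f := fun w => kern a b i (x - w)) (g := u) (v := e) ?_ ?_ ?_
    (fun w _ => hkd w) (fun w _ => hu.differentiable one_ne_zero w)
  · rw [this, ← integral_neg]
    refine integral_congr_ae (Eventually.of_forall fun w => ?_)
    simp only [hd]; ring
  · simp_rw [hd]
    exact (Continuous.mul (by fun_prop) huc).integrable_of_hasCompactSupport hus.mul_left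
  · exact (Continuous.mul (by fun_prop) hud).integrable_of_hasCompactSupport huds.mul_left
  · exact (Continuous.mul (by fun_prop) huc).integrable_of_hasCompactSupport hus.mul_left

/-! ### Decay of the regularised kernels -/

/-- On (a, b] the slowest Gaussian is the one at s = a. The constant depends on a and b: this decay
and its corollaries secure absolute convergence only and never enter the final constant. -/
theorem exists_kern_le_gaussian {a b : ℝ} (ha : 0 < a) (hab : a ≤ b) :
    ∃ D : ℝ, 0 ≤ D ∧ ∀ i x, |kern a b i x| ≤ D * ‖x‖ * Real.exp (-Real.pi * a * ‖x‖ ^ 2) := by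
  refine ⟨1 / 2 * a⁻¹ * b ^ (3 / 2 : ℝ) * (b - a), ?_, fun i x => ?_⟩
  · have := sub_nonneg.2 hab
    have := ha.le.trans hab
    positivity
  have h1 : ‖kap a b x‖ ≤ 1 / 2 * a⁻¹ * (b ^ (3 / 2 : ℝ) * Real.exp (-Real.pi * a * ‖x‖ ^ 2))
      * volume.real (Set.Ioc a b) := by
    refine norm_setIntegral_le_of_norm_le_const (by simp) fun s hs => ?_
    have hs0 := ha.trans hs.1
    rw [Real.norm_of_nonneg (mul_nonneg (by positivity) (heat_nonneg hs0 x)), heat]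
    have h : -Real.pi * s * ‖x‖ ^ 2 ≤ -Real.pi * a * ‖x‖ ^ 2 := by
      have : a * (Real.pi * ‖x‖ ^ 2) ≤ s * (Real.pi * ‖x‖ ^ 2) := by gcongr; exact hs.1.le
      linarith
    have h1 := hs.1.le
    have h2 := hs.2
    have hb := hs0.le.trans h2
    gcongr
  rw [kern, abs_mul]
  rw [Real.norm_eq_abs, Measure.real, Real.volume_Ioc, ENNReal.toReal_ofReal (sub_nonneg.2 hab)] at h1
  have h2 := PiLp.norm_apply_le x i
  rw [Real.norm_eq_abs] at h2
  calc |x i| * |kap a b x| ≤ ‖x‖ * _ := mul_le_mul h2 h1 (abs_nonneg _) (norm_nonneg _)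
    _ = _ := by ring

theorem exists_kern_le_heat {a b : ℝ} (ha : 0 < a) (hab : a ≤ b) :
    ∃ D : ℝ, ∀ i x, |kern a b i x| ≤ D * heat (a / 2) x := by
  obtain ⟨D, hD, h⟩ := exists_kern_le_gaussian ha hab
  refine ⟨D * (1 + 2 / (Real.pi * a)) * ((a / 2) ^ (3 / 2 : ℝ))⁻¹, fun i x => (h i x).trans ?_⟩
  have hp := Real.pi_pos
  set y := Real.pi * (a / 2) * ‖x‖ ^ 2 with hy
  have hy0 : 0 ≤ y := by positivity
  have h1 : ‖x‖ ≤ (1 + 2 / (Real.pi * a)) * Real.exp y := by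
    have e1 : 2 / (Real.pi * a) * y = ‖x‖ ^ 2 := by rw [hy]; field_simp
    have e2 : 0 ≤ 2 / (Real.pi * a) := by positivity
    calc ‖x‖ ≤ 1 + ‖x‖ ^ 2 := by nlinarith [sq_nonneg (‖x‖ - 1)]
      _ ≤ (1 + 2 / (Real.pi * a)) * (y + 1) := by nlinarith
      _ ≤ _ := by gcongr; exact Real.add_one_le_exp y
  have e3 : Real.exp (-Real.pi * a * ‖x‖ ^ 2) = Real.exp (-y) * Real.exp (-y) := by
    rw [← Real.exp_add]; congr 1; rw [hy]; ring
  have e4 : heat (a / 2) x = (a / 2) ^ (3 / 2 : ℝ) * Real.exp (-y) := by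
    rw [heat, hy]; congr 2; ring
  have e5 : ((a / 2) ^ (3 / 2 : ℝ))⁻¹ * (a / 2) ^ (3 / 2 : ℝ) = 1 :=
    inv_mul_cancel₀ (by positivity)
  have e6 : Real.exp y * Real.exp (-y) = 1 := by rw [← Real.exp_add]; simp
  calc D * ‖x‖ * Real.exp (-Real.pi * a * ‖x‖ ^ 2)
      ≤ D * ((1 + 2 / (Real.pi * a)) * Real.exp y) * (Real.exp (-y) * Real.exp (-y)) := by
        rw [e3]; gcongr
    _ = D * (1 + 2 / (Real.pi * a)) * Real.exp (-y) * (Real.exp y * Real.exp (-y)) := by ring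
    _ = D * (1 + 2 / (Real.pi * a)) * Real.exp (-y)
          * (((a / 2) ^ (3 / 2 : ℝ))⁻¹ * (a / 2) ^ (3 / 2 : ℝ)) := by rw [e6, e5]
    _ = _ := by rw [e4]; ring

/-- One more power of decay than is available uniformly in a and b; it pays for the linear growth of
the factor w_l in w_l ζ(w). -/
theorem exists_kern_mul_norm_le {a b : ℝ} (ha : 0 < a) (hab : a ≤ b) :
    ∃ D : ℝ, 0 ≤ D ∧ ∀ i x, |kern a b i x| * ‖x‖ ≤ D * (‖x‖ ^ 2)⁻¹ := by
  obtain ⟨D, hD, h⟩ := exists_kern_le_gaussian ha hab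
  have hp := Real.pi_pos
  refine ⟨2 * D / (Real.pi * a) ^ 2, by positivity, fun i x => ?_⟩
  rcases eq_or_ne x 0 with rfl | hx
  · simp
  have hn : 0 < ‖x‖ := norm_pos_iff.2 hx
  set y := Real.pi * a * ‖x‖ ^ 2 with hy
  have hy0 : 0 ≤ y := by positivity
  have h1 : y ^ 2 / 2 ≤ Real.exp y := by
    have := Real.pow_div_factorial_le_exp y hy0 2
    simpa using this
  have e6 : Real.exp y * Real.exp (-y) = 1 := by rw [← Real.exp_add]; simp
  have e3 : Real.exp (-Real.pi * a * ‖x‖ ^ 2) = Real.exp (-y) := by rw [hy]; congr 1; ring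
  have h2 : ‖x‖ ^ 4 * Real.exp (-y) ≤ 2 / (Real.pi * a) ^ 2 := by
    have : ‖x‖ ^ 4 = 2 / (Real.pi * a) ^ 2 * (y ^ 2 / 2) := by rw [hy]; field_simp
    rw [this]
    calc _ ≤ 2 / (Real.pi * a) ^ 2 * Real.exp y * Real.exp (-y) := by gcongr
      _ = _ := by rw [mul_assoc, e6, mul_one]
  rw [← div_eq_mul_inv, le_div_iff₀ (by positivity)]
  calc _ ≤ D * ‖x‖ * Real.exp (-y) * ‖x‖ * ‖x‖ ^ 2 := by rw [← e3]; gcongr; exact h i x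
    _ = D * (‖x‖ ^ 4 * Real.exp (-y)) := by ring
    _ ≤ D * (2 / (Real.pi * a) ^ 2) := by gcongr
    _ = _ := by ring

theorem heat_sq_le {s : ℝ} (hs : 0 < s) (x : E3) :
    heat s x ^ 2 ≤ s ^ (3 / 2 : ℝ) * heat (2 * s) x := by
  unfold heat
  have e : Real.exp (-Real.pi * (2 * s) * ‖x‖ ^ 2) = Real.exp (-Real.pi * s * ‖x‖ ^ 2) ^ 2 := by
    rw [← Real.exp_nat_mul]; congr 1; push_cast; ring
  have h : s ^ (3 / 2 : ℝ) ≤ (2 * s) ^ (3 / 2 : ℝ) :=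
    Real.rpow_le_rpow hs.le (by linarith) (by norm_num)
  rw [e, mul_pow]
  calc _ = s ^ (3 / 2 : ℝ) * (s ^ (3 / 2 : ℝ) * Real.exp (-Real.pi * s * ‖x‖ ^ 2) ^ 2) := by ring
    _ ≤ _ := by gcongr

theorem memLp_heat {s : ℝ} (hs : 0 < s) : MemLp (heat s) 2 volume := by
  rw [memLp_two_iff_integrable_sq (continuous_heat s).aestronglyMeasurable]
  refine ((integrable_heat (s := 2 * s) (by positivity)).const_mul (s ^ (3 / 2 : ℝ))).mono'
    (by fun_prop) (Eventually.of_forall fun x => ?_)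
  rw [Real.norm_of_nonneg (sq_nonneg _)]
  exact heat_sq_le hs x

theorem memLp_kern {a b : ℝ} (ha : 0 < a) (hab : a ≤ b) (i : Fin 3) :
    MemLp (kern a b i) 2 volume := by
  obtain ⟨D, h⟩ := exists_kern_le_heat ha hab
  exact ((memLp_heat (half_pos ha)).const_mul D).mono'
    (continuous_kern ha hab i).aestronglyMeasurable (Eventually.of_forall fun x => h i x)

theorem integrable_sub_left_mul {k f : E3 → ℝ} (hk : MemLp k 2 volume) (hf : MemLp f 2 volume)
    (x : E3) : Integrable fun w => k (x - w) * f w :=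
  MemLp.integrable_mul (hk.comp_measurePreserving (Measure.measurePreserving_sub_left volume x)) hf

/-! ### The heat approximation of a continuous square integrable function -/

theorem integrable_sq_of_memLp {f : E3 → ℝ} (hf : MemLp f 2 volume) :
    Integrable fun x => f x ^ 2 :=
  (memLp_two_iff_integrable_sq hf.1).1 hf

/-- Cauchy-Schwarz in additive form, with weight s^{3/4} balancing G_s² ≤ s^{3/2} G_{2s} against f².
The power of s shows that very wide Gaussians annihilate L² functions. -/
theorem abs_integral_heat_mul_le {f : E3 → ℝ} (hf : MemLp f 2 volume) {s : ℝ} (hs : 0 < s) (x : E3) :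
    |∫ w, heat s (x - w) * f w| ≤ 1 / 2 * s ^ (3 / 4 : ℝ) * (1 + ∫ w, f w ^ 2) := by
  have hsq := integrable_sq_of_memLp hf
  have hh := (integrable_heat (s := 2 * s) (by positivity)).comp_sub_left x
  have hb : ∀ w, ‖heat s (x - w) * f w‖
      ≤ 1 / 2 * s ^ (3 / 4 : ℝ) * (heat (2 * s) (x - w) + f w ^ 2) := by
    intro w
    have h1 := heat_sq_le hs (x - w)
    set l := s ^ (3 / 4 : ℝ) with hl
    have hl0 : 0 < l := by positivity
    have e : s ^ (3 / 2 : ℝ) = l * l := by rw [hl, ← Real.rpow_add hs]; norm_num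
    rw [e] at h1
    rw [norm_mul, Real.norm_of_nonneg (heat_nonneg hs _), Real.norm_eq_abs]
    set p := heat s (x - w)
    have h3 : l⁻¹ * p ^ 2 ≤ l * heat (2 * s) (x - w) := by
      calc _ ≤ l⁻¹ * (l * l * heat (2 * s) (x - w)) := by gcongr
        _ = _ := by field_simp
    have h4 : 2 * (p * |f w|) ≤ l⁻¹ * p ^ 2 + l * f w ^ 2 := by
      have : 0 ≤ l⁻¹ * (p - l * |f w|) ^ 2 := by positivity
      have e2 : l⁻¹ * (p - l * |f w|) ^ 2 = l⁻¹ * p ^ 2 - 2 * (p * |f w|) + l * |f w| ^ 2 := by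
        field_simp
        ring
      rw [e2, sq_abs] at this
      linarith
    linarith
  calc |∫ w, heat s (x - w) * f w|
      ≤ ∫ w, 1 / 2 * s ^ (3 / 4 : ℝ) * (heat (2 * s) (x - w) + f w ^ 2) :=
        norm_integral_le_of_norm_le ((hh.add hsq).const_mul _) (Eventually.of_forall hb)
    _ = _ := by
        rw [integral_const_mul, integral_add hh hsq, integral_sub_left_eq_self (heat (2 * s)),
          integral_heat (by positivity)]

theorem tendsto_heat_mul_zero {f : E3 → ℝ} (hf : MemLp f 2 volume) (x : E3) :
    Tendsto (fun s => ∫ w, heat s (x - w) * f w) (𝓝[>] 0) (𝓝 0) := by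
  have h : Tendsto (fun s : ℝ => 1 / 2 * s ^ (3 / 4 : ℝ) * (1 + ∫ w, f w ^ 2)) (𝓝[>] 0) (𝓝 0) := by
    have h1 : Tendsto (fun s : ℝ => s ^ (3 / 4 : ℝ)) (𝓝[>] 0) (𝓝 0) := by
      have := (Real.continuousAt_rpow_const 0 (3 / 4 : ℝ) (Or.inr (by norm_num))).tendsto
      rw [Real.zero_rpow (by norm_num)] at this
      exact this.mono_left nhdsWithin_le_nhds
    have := (h1.const_mul (1 / 2)).mul_const (1 + ∫ w, f w ^ 2)
    rwa [mul_zero, zero_mul] at this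
  refine squeeze_zero_norm' ?_ h
  filter_upwards [self_mem_nhdsWithin] with s hs
  exact abs_integral_heat_mul_le hf hs x

/-- For |x| ≥ 1 the exponential gain π(s-1)|x|² beats s^{3/2} ≤ e^{2(s-1)}. It supplies a majorant
independent of s away from the concentration point. -/
theorem heat_le_heat_one {s : ℝ} (hs : 1 ≤ s) {x : E3} (hx : 1 ≤ ‖x‖) : heat s x ≤ heat 1 x := by
  unfold heat
  have h1 : s ^ (3 / 2 : ℝ) ≤ Real.exp (2 * (s - 1)) := by
    calc s ^ (3 / 2 : ℝ) ≤ s ^ (2 : ℝ) := Real.rpow_le_rpow_of_exponent_le hs (by norm_num)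
      _ ≤ Real.exp (s - 1) ^ (2 : ℝ) := by
          refine Real.rpow_le_rpow (by linarith) ?_ (by norm_num)
          have := Real.add_one_le_exp (s - 1); linarith
      _ = _ := by rw [← Real.exp_mul]; congr 1; ring
  rw [Real.one_rpow, one_mul]
  calc _ ≤ Real.exp (2 * (s - 1)) * Real.exp (-Real.pi * s * ‖x‖ ^ 2) := by gcongr
    _ = Real.exp (2 * (s - 1) + -Real.pi * s * ‖x‖ ^ 2) := by rw [Real.exp_add]
    _ ≤ _ := by
      refine Real.exp_le_exp.2 ?_
      have h2 : (2 : ℝ) ≤ Real.pi * ‖x‖ ^ 2 := by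
        have : (1 : ℝ) ≤ ‖x‖ ^ 2 := one_le_pow₀ hx
        nlinarith [Real.pi_gt_three]
      nlinarith

theorem tendsto_heat_atTop {x : E3} (hx : x ≠ 0) :
    Tendsto (fun s => heat s x) atTop (𝓝 0) := by
  have hp : 0 < Real.pi * ‖x‖ ^ 2 := by
    have := norm_pos_iff.2 hx; have := Real.pi_pos; positivity
  refine (tendsto_rpow_mul_exp_neg_mul_atTop_nhds_zero (3 / 2) _ hp).congr fun s => ?_
  rw [heat]; congr 2; ring

/-- As f is square integrable but perhaps not integrable, split at the unit ball about x: near x the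
L¹ approximate identity applies, and far away dominated convergence with majorant G₁(x-·)|f| gives
zero. -/
theorem tendsto_heat_mul {f : E3 → ℝ} (hf : MemLp f 2 volume) (hc : Continuous f) (x : E3) :
    Tendsto (fun s => ∫ w, heat s (x - w) * f w) atTop (𝓝 (f x)) := by
  set B := Metric.ball x 1 with hB
  have hBm : MeasurableSet B := Metric.isOpen_ball.measurableSet
  have hin : Integrable fun w => ((B.indicator f w : ℝ) : ℂ) := by
    refine Integrable.ofReal ((integrable_indicator_iff hBm).2 ?_)
    have : IsFiniteMeasure (volume.restrict B) := ⟨by simpa using measure_ball_lt_top⟩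
    exact (hf.restrict B).integrable (by norm_num)
  have hcx : ContinuousAt (fun w => ((B.indicator f w : ℝ) : ℂ)) x := by
    refine (Complex.continuous_ofReal.comp hc).continuousAt.congr ?_
    filter_upwards [Metric.ball_mem_nhds x one_pos] with w hw
    simp [Set.indicator_of_mem (show w ∈ B from hw)]
  have h1 := tendsto_heat_conv hin hcx
  have h1' : Tendsto (fun s => ∫ w, heat s (x - w) * B.indicator f w) atTop (𝓝 (f x)) := by
    have := (Complex.continuous_re.tendsto _).comp h1
    rw [Complex.ofReal_re, Set.indicator_of_mem (Metric.mem_ball_self one_pos)] at this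
    refine this.congr fun s => ?_
    simp only [Function.comp]
    simp_rw [← Complex.ofReal_mul]
    rw [integral_complex_ofReal, Complex.ofReal_re]
  have h2 : Tendsto (fun s => ∫ w, heat s (x - w) * Bᶜ.indicator f w) atTop (𝓝 0) := by
    have hd : Integrable fun w => heat 1 (x - w) * |f w| :=
      integrable_sub_left_mul (memLp_heat one_pos) hf.abs x
    have := tendsto_integral_filter_of_dominated_convergence (μ := (volume : Measure E3))
      (F := fun (s : ℝ) w => heat s (x - w) * Bᶜ.indicator f w) (f := fun _ => 0) (l := atTop)
      (fun w => heat 1 (x - w) * |f w|) ?_ ?_ hd ?_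
    · simpa using this
    · refine Eventually.of_forall fun s => ?_
      have := continuous_heat s
      exact (Continuous.aestronglyMeasurable (by fun_prop)).mul
        (hc.aestronglyMeasurable.indicator hBm.compl)
    · filter_upwards [eventually_ge_atTop 1] with s hs
      refine Eventually.of_forall fun w => ?_
      have hs0 : 0 < s := by linarith
      by_cases hw : w ∈ B
      · rw [Set.indicator_of_notMem (by simpa using hw)]
        simpa using mul_nonneg (heat_nonneg one_pos _) (abs_nonneg (f w))
      · rw [Set.indicator_of_mem hw, norm_mul, Real.norm_of_nonneg (heat_nonneg hs0 _),
          Real.norm_eq_abs]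
        refine mul_le_mul_of_nonneg_right (heat_le_heat_one hs ?_) (abs_nonneg _)
        simpa [hB, dist_eq_norm, norm_sub_rev] using hw
    · refine Eventually.of_forall fun w => ?_
      by_cases hw : w ∈ B
      · simp [Set.indicator_of_notMem (show w ∉ Bᶜ by simpa using hw)]
      · have hne : x - w ≠ 0 := by
          rw [sub_ne_zero]; rintro rfl; exact hw (Metric.mem_ball_self one_pos)
        simpa using (tendsto_heat_atTop hne).mul_const (Bᶜ.indicator f w)
  have h3 := h1'.add h2
  rw [add_zero] at h3
  refine h3.congr' ?_
  filter_upwards [eventually_gt_atTop 0] with s hs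
  rw [← integral_add]
  · refine integral_congr_ae (Eventually.of_forall fun w => ?_)
    simp only
    rw [← mul_add]; congr 1
    exact congrFun (Set.indicator_self_add_compl B f) w
  · exact integrable_sub_left_mul (memLp_heat hs) (hf.indicator hBm) x
  · exact integrable_sub_left_mul (memLp_heat hs) (hf.indicator hBm.compl) x

/-- The convolution of `f` with `heat b - heat a`. -/
def band (a b : ℝ) (f : E3 → ℝ) (x : E3) : ℝ := ∫ w, (heat b (x - w) - heat a (x - w)) * f w

theorem tendsto_band {f : E3 → ℝ} (hf : MemLp f 2 volume) (hc : Continuous f) (x : E3) :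
    Tendsto (fun n : ℕ => band (1 / ((n : ℝ) + 1)) ((n : ℝ) + 1) f x) atTop (𝓝 (f x)) := by
  have h0 : Tendsto (fun n : ℕ => (n : ℝ) + 1) atTop atTop :=
    tendsto_atTop_add_const_right _ _ tendsto_natCast_atTop_atTop
  have h1 := (tendsto_heat_mul hf hc x).comp h0
  have h2 := (tendsto_heat_mul_zero hf x).comp (x := atTop) (f := fun n : ℕ => 1 / ((n : ℝ) + 1)) <|
    tendsto_nhdsWithin_iff.2 ⟨tendsto_one_div_add_atTop_nhds_zero_nat,
      Eventually.of_forall fun n => Set.mem_Ioi.2 (by positivity)⟩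
  have h3 := h1.sub h2
  rw [sub_zero] at h3
  refine h3.congr fun n => ?_
  simp only [Function.comp, band]
  rw [← integral_sub (integrable_sub_left_mul (memLp_heat (by positivity)) hf x)
    (integrable_sub_left_mul (memLp_heat (by positivity)) hf x)]
  refine integral_congr_ae (Eventually.of_forall fun w => ?_)
  simp only; ring

/-! ### The regularised Biot-Savart law -/

/-- Integrate by parts and use ∂_j K_i = ∂_i K_j: the terms ∂_j u_i combine to the divergence, and Σ
∂_i K_i = G_b - G_a acts on u_j. It is the kernel form of Δ = ∇ div - curl curl. -/
theorem integral_band_of_hasCompactSupport {a b : ℝ} (ha : 0 < a) (hab : a ≤ b)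
    {u : Fin 3 → E3 → ℝ} (hu : ∀ j, ContDiff ℝ 1 (u j)) (hus : ∀ j, HasCompactSupport (u j))
    (j : Fin 3) (x : E3) :
    band a b (u j) x
      = (∑ i, ∫ w, kern a b i (x - w) * (fderiv ℝ (u j) w (EuclideanSpace.single i 1)
            - fderiv ℝ (u i) w (EuclideanSpace.single j 1)))
        + ∫ w, kern a b j (x - w) * ∑ i, fderiv ℝ (u i) w (EuclideanSpace.single i 1) := by
  have hkc := continuous_kern ha hab
  have hdc := continuous_dkern ha hab
  have hud : ∀ i l, Continuous fun w => fderiv ℝ (u i) w (EuclideanSpace.single l 1) := fun i l =>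
    ((hu i).continuous_fderiv one_ne_zero).clm_apply continuous_const
  have huds : ∀ i l, HasCompactSupport fun w => fderiv ℝ (u i) w (EuclideanSpace.single l 1) :=
    fun i l => (hus i).fderiv_apply ℝ _
  have huc := fun i => (hu i).continuous
  have hk : ∀ i l m, Integrable fun w =>
      kern a b i (x - w) * fderiv ℝ (u l) w (EuclideanSpace.single m 1) := fun i l m => by
    have := hkc i; have := hud l m
    exact (Continuous.mul (by fun_prop) this).integrable_of_hasCompactSupport (huds l m).mul_left
  have h1 : ∀ i, ∫ w, kern a b i (x - w) * (fderiv ℝ (u j) w (EuclideanSpace.single i 1)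
            - fderiv ℝ (u i) w (EuclideanSpace.single j 1))
      = (∫ w, dkern a b i i (x - w) * u j w)
        - ∫ w, kern a b j (x - w) * fderiv ℝ (u i) w (EuclideanSpace.single i 1) := by
    intro i
    simp_rw [mul_sub]
    rw [integral_sub (hk i j i) (hk i i j), ← integral_dkern_mul ha hab i i (hu j) (hus j),
      ← integral_dkern_mul ha hab i j (hu i) (hus i), ← integral_dkern_mul ha hab j i (hu i) (hus i)]
    simp_rw [dkern_comm a b i j]
  simp_rw [h1, Finset.mul_sum]
  rw [integral_finsetSum _ fun i _ => hk j i i, Finset.sum_sub_distrib, sub_add_cancel,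
    ← integral_finsetSum]
  · simp_rw [← Finset.sum_mul, sum_dkern ha hab]
    rfl
  · intro i _
    have := hdc i i; have := huc j
    exact (Continuous.mul (by fun_prop) this).integrable_of_hasCompactSupport (hus j).mul_left

/-- Dilates β(·/(n+1)) of one bump function. The gradients are uniformly bounded and vanish near any
given point for large n, which is all that dominated convergence requires. -/
theorem exists_cutoff : ∃ (η : ℕ → E3 → ℝ) (M : ℝ), 0 ≤ M ∧
    (∀ n, ContDiff ℝ 1 (η n)) ∧ (∀ n, HasCompactSupport (η n)) ∧ (∀ n w, |η n w| ≤ 1) ∧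
    (∀ n w i, |fderiv ℝ (η n) w (EuclideanSpace.single i 1)| ≤ M) ∧
    (∀ w, Tendsto (fun n => η n w) atTop (𝓝 1)) ∧
    ∀ w y, Tendsto (fun n => fderiv ℝ (η n) w y) atTop (𝓝 0) := by
  let β : ContDiffBump (0 : E3) := ⟨1, 2, one_pos, one_lt_two⟩
  have hβ : ContDiff ℝ 1 β := β.contDiff
  obtain ⟨M, hM⟩ := (β.hasCompactSupport.fderiv ℝ).exists_bound_of_continuous
    (hβ.continuous_fderiv one_ne_zero)
  have hM0 : 0 ≤ M := (norm_nonneg _).trans (hM 0)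
  set c : ℕ → ℝ := fun n => ((n : ℝ) + 1)⁻¹ with hc
  have hc0 : ∀ n, 0 < c n := fun n => by simp only [hc]; positivity
  have hc1 : ∀ n, c n ≤ 1 := fun n => inv_le_one_of_one_le₀ (by linarith [n.cast_nonneg (α := ℝ)])
  have hct : Tendsto c atTop (𝓝 0) := by
    simpa only [hc, one_div] using tendsto_one_div_add_atTop_nhds_zero_nat (𝕜 := ℝ)
  have hcd : ∀ n, ContDiff ℝ 1 fun w : E3 => β (c n • w) := fun n => hβ.comp (by fun_prop)
  have hev : ∀ w : E3, ∀ᶠ n in atTop, (fun y : E3 => β (c n • y)) =ᶠ[𝓝 w] fun _ => 1 := by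
    intro w
    have h1 : Tendsto (fun n => c n • w) atTop (𝓝 0) := by simpa using hct.smul_const w
    filter_upwards [h1 (Metric.ball_mem_nhds 0 one_pos)] with n hn
    have h2 : Continuous fun y : E3 => c n • y := by fun_prop
    filter_upwards [h2.continuousAt (Metric.isOpen_ball.mem_nhds hn)] with y hy
    exact β.one_of_mem_closedBall (Metric.ball_subset_closedBall hy)
  refine ⟨fun n w => β (c n • w), M, hM0, hcd, fun n => ?_, fun n w => ?_, fun n w i => ?_,
    fun w => ?_, fun w y => ?_⟩
  · exact β.hasCompactSupport.comp_smul (hc0 n).ne'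
  · rw [abs_of_nonneg β.nonneg]; exact β.le_one
  · have h1 : HasFDerivAt (fun w : E3 => c n • w) (c n • ContinuousLinearMap.id ℝ E3) w :=
      (hasFDerivAt_id w).const_smul (c n)
    have h2 := ((hβ.differentiable one_ne_zero (c n • w)).hasFDerivAt.comp w h1).fderiv
    change |fderiv ℝ (β ∘ fun w : E3 => c n • w) w _| ≤ M
    rw [h2, ← Real.norm_eq_abs]
    refine (ContinuousLinearMap.le_opNorm _ _).trans ?_
    rw [PiLp.norm_single, norm_one, mul_one]
    refine (ContinuousLinearMap.opNorm_comp_le _ _).trans ?_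
    rw [norm_smul, Real.norm_of_nonneg (hc0 n).le]
    calc _ ≤ M * (1 * 1) := by
          gcongr
          · exact hM _
          · exact hc1 n
          · exact ContinuousLinearMap.norm_id_le
      _ = M := by ring
  · refine tendsto_const_nhds.congr' ?_
    filter_upwards [hev w] with n hn
    exact hn.eq_of_nhds.symm
  · refine tendsto_const_nhds.congr' ?_
    filter_upwards [hev w] with n hn
    rw [hn.fderiv_eq]; simp

theorem memLp_coord {v : E3 → E3} (hv : MemLp v 2 volume) (j : Fin 3) :
    MemLp (fun x => v x j) 2 volume :=
  hv.continuousLinearMap_comp (EuclideanSpace.proj (𝕜 := ℝ) j : E3 →L[ℝ] ℝ)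

theorem contDiff_coord {v : E3 → E3} (hv : ContDiff ℝ 1 v) (j : Fin 3) :
    ContDiff ℝ 1 fun x => v x j :=
  (EuclideanSpace.proj (𝕜 := ℝ) j : E3 →L[ℝ] ℝ).contDiff.comp hv

theorem fderiv_mul_coord {v : E3 → E3} (hv : ContDiff ℝ 1 v) {η : E3 → ℝ} (hη : ContDiff ℝ 1 η)
    (i j : Fin 3) (w : E3) :
    fderiv ℝ (fun w => η w * v w j) w (EuclideanSpace.single i 1)
      = η w * pderiv i j v w + fderiv ℝ η w (EuclideanSpace.single i 1) * v w j := by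
  have h := ((hη.differentiable one_ne_zero w).hasFDerivAt.mul (hasFDerivAt_coord hv w j)).fderiv
  change fderiv ℝ (η * fun w => v w j) w _ = _
  rw [h, pderiv]
  simp [mul_comm]

/-- Apply the compactly supported identity to η_n v and let n → ∞. The terms with ∇η_n are dominated
by |K_i||v|, integrable because both factors are in L²; the curl terms need the assumed absolute
convergence, no global bound on the curl being at hand. -/
theorem band_eq_sum {v : E3 → E3} (hv : ContDiff ℝ 1 v) (hv2 : MemLp v 2 volume)
    (hdiv : ∀ x, divergence v x = 0) {a b : ℝ} (ha : 0 < a) (hab : a ≤ b) (x : E3) (j : Fin 3)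
    (hint : ∀ i, Integrable fun w => kern a b i (x - w) * (pderiv i j v w - pderiv j i v w)) :
    band a b (fun w => v w j) x
      = ∑ i, ∫ w, kern a b i (x - w) * (pderiv i j v w - pderiv j i v w) := by
  obtain ⟨η, M, hM, hηc, hηs, hη1, hηM, hηt, hηd⟩ := exists_cutoff
  have hkc := continuous_kern ha hab
  have hpc := continuous_pderiv hv
  have hvc : ∀ j, Continuous fun w => v w j := fun j => (contDiff_coord hv j).continuous
  have hηd' : ∀ n i, Continuous fun w => fderiv ℝ (η n) w (EuclideanSpace.single i 1) := fun n i =>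
    ((hηc n).continuous_fderiv one_ne_zero).clm_apply continuous_const
  have hkv : ∀ i j, Integrable fun w => kern a b i (x - w) * v w j := fun i j =>
    integrable_sub_left_mul (memLp_kern ha hab i) (memLp_coord hv2 j) x
  have key : ∀ n, band a b (fun w => η n w * v w j) x
      = (∑ i, ∫ w, kern a b i (x - w) * (η n w * (pderiv i j v w - pderiv j i v w)
          + fderiv ℝ (η n) w (EuclideanSpace.single i 1) * v w j
          - fderiv ℝ (η n) w (EuclideanSpace.single j 1) * v w i))
        + ∫ w, kern a b j (x - w)
            * ∑ i, fderiv ℝ (η n) w (EuclideanSpace.single i 1) * v w i := by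
    intro n
    rw [integral_band_of_hasCompactSupport ha hab (u := fun j w => η n w * v w j)
      (fun j => (hηc n).mul (contDiff_coord hv j)) (fun j => (hηs n).mul_right) j x]
    simp_rw [fderiv_mul_coord hv (hηc n)]
    congr 1
    · refine Finset.sum_congr rfl fun i _ => integral_congr_ae (Eventually.of_forall fun w => ?_)
      simp only; ring
    · refine integral_congr_ae (Eventually.of_forall fun w => ?_)
      simp only
      rw [Finset.sum_add_distrib, ← Finset.mul_sum]
      have : ∑ i, pderiv i i v w = 0 := hdiv w
      rw [this]; ring
  have L : Tendsto (fun n => band a b (fun w => η n w * v w j) x) atTop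
      (𝓝 (band a b (fun w => v w j) x)) := by
    have hb := ha.trans_le hab
    have hI : Integrable fun w => (heat b (x - w) - heat a (x - w)) * v w j :=
      integrable_sub_left_mul (k := fun y => heat b y - heat a y)
        ((memLp_heat hb).sub (memLp_heat ha)) (memLp_coord hv2 j) x
    have h1 := continuous_heat a
    have h2 := continuous_heat b
    refine tendsto_integral_of_dominated_convergence _ (fun n => ?_) hI.norm (fun n => ?_) ?_
    · have := (hηc n).continuous; have := hvc j
      exact Continuous.aestronglyMeasurable (by fun_prop)
    · refine Eventually.of_forall fun w => ?_
      rw [norm_mul, norm_mul, norm_mul, Real.norm_eq_abs (η n w)]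
      gcongr
      exact mul_le_of_le_one_left (norm_nonneg _) (hη1 n w)
    · refine Eventually.of_forall fun w => ?_
      simpa using ((hηt w).mul_const (v w j)).const_mul (heat b (x - w) - heat a (x - w))
  have R1 : ∀ i, Tendsto (fun n => ∫ w, kern a b i (x - w) *
          (η n w * (pderiv i j v w - pderiv j i v w)
          + fderiv ℝ (η n) w (EuclideanSpace.single i 1) * v w j
          - fderiv ℝ (η n) w (EuclideanSpace.single j 1) * v w i)) atTop
      (𝓝 (∫ w, kern a b i (x - w) * (pderiv i j v w - pderiv j i v w))) := by
    intro i
    refine tendsto_integral_of_dominated_convergence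
      (fun w => ‖kern a b i (x - w) * (pderiv i j v w - pderiv j i v w)‖
        + M * ‖kern a b i (x - w) * v w j‖ + M * ‖kern a b i (x - w) * v w i‖)
      (fun n => ?_) (((hint i).norm.add ((hkv i j).norm.const_mul M)).add
        ((hkv i i).norm.const_mul M)) (fun n => ?_) ?_
    · have := (hηc n).continuous; have := hvc j; have := hvc i; have := hkc i
      have := hpc i j; have := hpc j i; have := hηd' n i; have := hηd' n j
      exact Continuous.aestronglyMeasurable (by fun_prop)
    · refine Eventually.of_forall fun w => ?_
      rw [mul_sub, mul_add]
      refine (norm_sub_le _ _).trans (add_le_add ((norm_add_le _ _).trans (add_le_add ?_ ?_)) ?_)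
      · rw [norm_mul, norm_mul, norm_mul, Real.norm_eq_abs (η n w)]
        gcongr
        exact mul_le_of_le_one_left (norm_nonneg _) (hη1 n w)
      · rw [norm_mul, norm_mul, norm_mul, mul_left_comm, Real.norm_eq_abs (fderiv ℝ _ _ _)]
        gcongr
        exact hηM n w i
      · rw [norm_mul, norm_mul, norm_mul, mul_left_comm, Real.norm_eq_abs (fderiv ℝ _ _ _)]
        gcongr
        exact hηM n w j
    · refine Eventually.of_forall fun w => ?_
      have := ((((hηt w).mul_const (pderiv i j v w - pderiv j i v w)).add
        ((hηd w (EuclideanSpace.single i 1)).mul_const (v w j))).sub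
        ((hηd w (EuclideanSpace.single j 1)).mul_const (v w i))).const_mul (kern a b i (x - w))
      simpa using this
  have R2 : Tendsto (fun n => ∫ w, kern a b j (x - w)
            * ∑ i, fderiv ℝ (η n) w (EuclideanSpace.single i 1) * v w i) atTop (𝓝 0) := by
    have := tendsto_integral_of_dominated_convergence (μ := (volume : Measure E3))
      (F := fun n w => kern a b j (x - w)
            * ∑ i, fderiv ℝ (η n) w (EuclideanSpace.single i 1) * v w i) (f := fun _ => 0)
      (fun w => ∑ i, M * ‖kern a b j (x - w) * v w i‖) (fun n => ?_)
      (integrable_finsetSum _ fun i _ => (hkv j i).norm.const_mul M) (fun n => ?_) ?_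
    · simpa using this
    · have := hvc; have := hkc j; have := hηd' n
      exact Continuous.aestronglyMeasurable (by fun_prop)
    · refine Eventually.of_forall fun w => ?_
      rw [Finset.mul_sum]
      refine (norm_sum_le _ _).trans (Finset.sum_le_sum fun i _ => ?_)
      rw [norm_mul, norm_mul, norm_mul, mul_left_comm, Real.norm_eq_abs (fderiv ℝ _ _ _)]
      gcongr
      exact hηM n w i
    · refine Eventually.of_forall fun w => ?_
      have := (tendsto_finsetSum Finset.univ fun i _ =>
        (hηd w (EuclideanSpace.single i 1)).mul_const (v w i)).const_mul (kern a b j (x - w))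
      simpa using this
  have R := (tendsto_finsetSum Finset.univ fun i _ => R1 i).add R2
  rw [add_zero] at R
  exact tendsto_nhds_unique L (R.congr fun n => (key n).symm)

/-! ### Increments of the regularised velocity -/

/-- Every entry of the antisymmetric part of ∇v is 0 or ±x_l ζ with l horizontal. A uniform
description by a coefficient and an index spares a distinction of nine cases later. -/
theorem IsAxisymmetricNoSwirl.exists_skew_eq {v : E3 → E3} (h : IsAxisymmetricNoSwirl v)
    (hv : ContDiff ℝ 1 v) (i j : Fin 3) :
    ∃ (σ : ℝ) (l : Fin 3), |σ| ≤ 1 ∧ (l = 0 ∨ l = 1) ∧ ∀ x, rad x ≠ 0 →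
      pderiv i j v x - pderiv j i v x = σ * (x l * (omegaTheta v x / rad x)) := by
  have hc := fun x (hx : rad x ≠ 0) => h.curl_eq hv hx
  fin_cases i <;> fin_cases j
  · exact ⟨0, 0, by simp, by simp, fun x hx => by simp⟩
  · refine ⟨0, 0, by simp, by simp, fun x hx => ?_⟩
    simpa using (hc x hx).2.2
  · refine ⟨-1, 0, by simp, by simp, fun x hx => ?_⟩
    have := (hc x hx).2.1; simp only [Fin.zero_eta, Fin.reduceFinMk]; linarith
  · refine ⟨0, 0, by simp, by simp, fun x hx => ?_⟩
    have := (hc x hx).2.2; simp only [Fin.zero_eta, Fin.mk_one]; linarith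
  · exact ⟨0, 0, by simp, by simp, fun x hx => by simp⟩
  · refine ⟨-1, 1, by simp, by simp, fun x hx => ?_⟩
    have := (hc x hx).1; simp only [Fin.mk_one, Fin.reduceFinMk]; linarith
  · refine ⟨1, 0, by simp, by simp, fun x hx => ?_⟩
    have := (hc x hx).2.1; simp only [Fin.zero_eta, Fin.reduceFinMk]; linarith
  · refine ⟨1, 1, by simp, by simp, fun x hx => ?_⟩
    have := (hc x hx).1; simp only [Fin.mk_one, Fin.reduceFinMk]; linarith
  · exact ⟨0, 0, by simp, by simp, fun x hx => by simp⟩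

theorem integrable_enorm_bound {g : E3 → ℝ} (hg : AEStronglyMeasurable g volume) {B : ℝ≥0∞}
    (hB : B ≠ ⊤) (h : ∫⁻ w, ‖g w‖ₑ ≤ B) : Integrable g := ⟨hg, h.trans_lt hB.lt_top⟩

theorem integrable_inv_sq_mul {f : E3 → ℝ} (hf : Measurable f) (hZ : lorentzNorm 3 1 f ≠ ⊤)
    (x : E3) : Integrable fun w => (‖x - w‖ ^ 2)⁻¹ * |f w| := by
  refine integrable_enorm_bound (Measurable.aestronglyMeasurable (by fun_prop))
    (ENNReal.mul_ne_top potConst_ne_top hZ) (le_trans (lintegral_mono fun w => ?_)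
      (lintegral_enorm_mul_inv_sq_le hf x))
  rw [enorm_mul, mul_comm, Real.enorm_of_nonneg (abs_nonneg _), Real.enorm_of_nonneg (by positivity),
    Real.enorm_eq_ofReal_abs]

theorem integrable_kern_mul_coord {a b : ℝ} (ha : 0 < a) (hab : a ≤ b) (i l : Fin 3) {f : E3 → ℝ}
    (hf : Measurable f) (hZ : lorentzNorm 3 1 f ≠ ⊤) (x : E3) :
    Integrable fun w => kern a b i (x - w) * (w l * f w) := by
  obtain ⟨D, hD, h⟩ := exists_kern_mul_norm_le ha hab
  have hc := continuous_kern ha hab i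
  have hl : Measurable fun w : E3 => w l := by fun_prop
  refine ((integrable_inv_sq_mul hf hZ x).const_mul
    (D + ‖x‖ * Real.Gamma (3 / 2))).mono' ((Measurable.mul (by fun_prop) (hl.mul hf)).aestronglyMeasurable)
      (Eventually.of_forall fun w => ?_)
  have h1 : |w l| ≤ ‖x - w‖ + ‖x‖ := by
    have := PiLp.norm_apply_le w l
    rw [Real.norm_eq_abs] at this
    refine this.trans ?_
    have := norm_sub_le x (x - w)
    rw [sub_sub_cancel] at this; linarith
  rw [norm_mul, norm_mul, Real.norm_eq_abs, Real.norm_eq_abs, Real.norm_eq_abs]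
  calc |kern a b i (x - w)| * (|w l| * |f w|)
      ≤ |kern a b i (x - w)| * ((‖x - w‖ + ‖x‖) * |f w|) := by gcongr
    _ = (|kern a b i (x - w)| * ‖x - w‖ + ‖x‖ * |kern a b i (x - w)|) * |f w| := by ring
    _ ≤ (D * (‖x - w‖ ^ 2)⁻¹ + ‖x‖ * (Real.Gamma (3 / 2) * (‖x - w‖ ^ 2)⁻¹)) * |f w| := by
        refine mul_le_mul_of_nonneg_right (add_le_add (h i _)
          (mul_le_mul_of_nonneg_left (abs_kern_le ha i _) (norm_nonneg _))) (abs_nonneg _)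
    _ = _ := by ring

/-- The increment of the regularised potential `kern a b i * f`. -/
def kernIncr (a b : ℝ) (i : Fin 3) (f : E3 → ℝ) (x y : E3) : ℝ :=
  ∫ w, (kern a b i (x - w) - kern a b i (y - w)) * f w

/-- The constant in the increment bound. -/
def incrConst : ℝ≥0∞ := ENNReal.ofReal (12 * Real.Gamma (3 / 2)) * (2 * potConst)

/-- The heart of the increment estimate: w_l = (w_l - y_l) + y_l. As |w_l - y_l| ≤ |y - w|, the
first part falls under the weighted difference bound and the potential estimate; the second leaves
y_l times the increment of the potential of f itself. Expanding about y puts the horizontal weight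
at the point where ρ is evaluated. -/
theorem enorm_kern_coord_sub_le {a b : ℝ} (ha : 0 < a) (hab : a ≤ b) (i l : Fin 3) {f : E3 → ℝ}
    (hf : Measurable f) (hZ : lorentzNorm 3 1 f ≠ ⊤) (x y : E3) :
    ‖(∫ w, kern a b i (x - w) * (w l * f w)) - ∫ w, kern a b i (y - w) * (w l * f w)‖ₑ
      ≤ incrConst * ‖x - y‖ₑ * lorentzNorm 3 1 f + ‖y l‖ₑ * ‖kernIncr a b i f x y‖ₑ := by
  have hG : 0 < Real.Gamma (3 / 2) := Real.Gamma_pos_of_pos (by norm_num)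
  have i1 := integrable_kern_mul_coord ha hab i l hf hZ
  have i2 := integrable_kern_mul ha hab i hf hZ
  have i3 : Integrable fun w => (kern a b i (x - w) - kern a b i (y - w)) * f w :=
    ((i2 x).sub (i2 y)).congr (Eventually.of_forall fun w => by simp only [Pi.sub_apply]; ring)
  have i4 : Integrable fun w => (kern a b i (x - w) - kern a b i (y - w)) * (w l - y l) * f w :=
    (((i1 x).sub (i1 y)).sub (i3.const_mul (y l))).congr
      (Eventually.of_forall fun w => by simp only [Pi.sub_apply]; ring)
  have e : (∫ w, kern a b i (x - w) * (w l * f w)) - ∫ w, kern a b i (y - w) * (w l * f w)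
      = (∫ w, (kern a b i (x - w) - kern a b i (y - w)) * (w l - y l) * f w)
        + y l * kernIncr a b i f x y := by
    rw [kernIncr, ← integral_const_mul, ← integral_sub (i1 x) (i1 y),
      ← integral_add i4 (i3.const_mul _)]
    refine integral_congr_ae (Eventually.of_forall fun w => ?_)
    simp only; ring
  rw [e]
  refine (enorm_add_le _ _).trans (add_le_add ?_ (enorm_mul _ _).le)
  refine (enorm_integral_le_lintegral_enorm _).trans ?_
  have hm : ∀ x : E3, Measurable fun w : E3 => ‖f w‖ₑ * ENNReal.ofReal (‖x - w‖ ^ 2)⁻¹ := by fun_prop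
  calc ∫⁻ w, ‖(kern a b i (x - w) - kern a b i (y - w)) * (w l - y l) * f w‖ₑ
      ≤ ∫⁻ w, ENNReal.ofReal (12 * Real.Gamma (3 / 2)) * ‖x - y‖ₑ *
          (‖f w‖ₑ * ENNReal.ofReal (‖x - w‖ ^ 2)⁻¹ + ‖f w‖ₑ * ENNReal.ofReal (‖y - w‖ ^ 2)⁻¹) := by
        refine lintegral_mono fun w => ?_
        have h := abs_kern_sub_mul_le (b := b) ha i (x - w) (y - w)
        rw [sub_sub_sub_cancel_right] at h
        have h1 : |w l - y l| ≤ ‖y - w‖ := by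
          have := PiLp.norm_apply_le (y - w) l
          rwa [Real.norm_eq_abs, PiLp.sub_apply, abs_sub_comm] at this
        have h2 : |(kern a b i (x - w) - kern a b i (y - w)) * (w l - y l)|
            ≤ 12 * Real.Gamma (3 / 2) * ‖x - y‖ * ((‖x - w‖ ^ 2)⁻¹ + (‖y - w‖ ^ 2)⁻¹) := by
          rw [abs_mul]
          exact (mul_le_mul_of_nonneg_left h1 (abs_nonneg _)).trans h
        rw [enorm_mul, Real.enorm_eq_ofReal_abs, ← mul_add, ← ENNReal.ofReal_add (by positivity)
          (by positivity), mul_left_comm, mul_comm]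
        gcongr
        rw [← ofReal_norm (x - y), ← ENNReal.ofReal_mul (by positivity),
          ← ENNReal.ofReal_mul (by positivity)]
        exact ENNReal.ofReal_le_ofReal h2
    _ = ENNReal.ofReal (12 * Real.Gamma (3 / 2)) * ‖x - y‖ₑ *
          ((∫⁻ w, ‖f w‖ₑ * ENNReal.ofReal (‖x - w‖ ^ 2)⁻¹)
            + ∫⁻ w, ‖f w‖ₑ * ENNReal.ofReal (‖y - w‖ ^ 2)⁻¹) := by
        rw [← lintegral_add_left (hm x),
          lintegral_const_mul' _ _ (ENNReal.mul_ne_top ENNReal.ofReal_ne_top enorm_ne_top)]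
    _ ≤ ENNReal.ofReal (12 * Real.Gamma (3 / 2)) * ‖x - y‖ₑ *
          (potConst * lorentzNorm 3 1 f + potConst * lorentzNorm 3 1 f) := by
        gcongr
        · exact lintegral_enorm_mul_inv_sq_le hf x
        · exact lintegral_enorm_mul_inv_sq_le hf y
    _ = _ := by rw [incrConst]; ring

theorem enorm_coord_le_horiz {l : Fin 3} (hl : l = 0 ∨ l = 1) (y : E3) : ‖y l‖ₑ ≤ ‖horiz y‖ₑ := by
  rcases hl with rfl | rfl
  · exact enorm_le_iff_norm_le.2 (PiLp.norm_apply_le (horiz y) 0)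
  · exact enorm_le_iff_norm_le.2 (PiLp.norm_apply_le (horiz y) 1)

/-- The regularised Biot-Savart law with curl v expressed through ζ; the axis, where ζ carries no
information, is a null set. -/
theorem enorm_band_sub_le {v : E3 → E3} (hv : ContDiff ℝ 1 v) (hv2 : MemLp v 2 volume)
    (hax : IsAxisymmetricNoSwirl v) (hdiv : ∀ x, divergence v x = 0)
    (hZ : lorentzNorm 3 1 (fun x => omegaTheta v x / rad x) ≠ ⊤)
    {a b : ℝ} (ha : 0 < a) (hab : a ≤ b) (x y : E3) (j : Fin 3) :
    ‖band a b (fun w => v w j) x - band a b (fun w => v w j) y‖ₑ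
      ≤ ∑ i, (incrConst * ‖x - y‖ₑ * lorentzNorm 3 1 (fun x => omegaTheta v x / rad x)
        + ‖horiz y‖ₑ * ‖kernIncr a b i (fun x => omegaTheta v x / rad x) x y‖ₑ) := by
  set ζ : E3 → ℝ := fun x => omegaTheta v x / rad x with hζ
  have hm : Measurable ζ := measurable_omegaTheta_div hv
  have hs := fun i => hax.exists_skew_eq hv i j
  choose σ l hσ hl hs using hs
  have hae : ∀ᵐ w : E3, rad w ≠ 0 := by
    rw [ae_iff]; simpa using volume_rad_eq_zero
  have hcongr : ∀ z i, (fun w => kern a b i (z - w) * (pderiv i j v w - pderiv j i v w))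
      =ᵐ[volume] fun w => σ i * (kern a b i (z - w) * (w (l i) * ζ w)) := by
    intro z i
    filter_upwards [hae] with w hw
    rw [hs i w hw]; ring
  have hb : ∀ z, band a b (fun w => v w j) z
      = ∑ i, σ i * ∫ w, kern a b i (z - w) * (w (l i) * ζ w) := by
    intro z
    rw [band_eq_sum hv hv2 hdiv ha hab z j fun i =>
      ((integrable_kern_mul_coord ha hab i (l i) hm hZ z).const_mul (σ i)).congr (hcongr z i).symm]
    refine Finset.sum_congr rfl fun i _ => ?_
    rw [integral_congr_ae (hcongr z i), integral_const_mul]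
  rw [hb, hb, ← Finset.sum_sub_distrib]
  refine (enorm_sum_le _ _).trans (Finset.sum_le_sum fun i _ => ?_)
  rw [← mul_sub, enorm_mul]
  have h1 : ‖σ i‖ₑ ≤ 1 := by
    rw [Real.enorm_eq_ofReal_abs]; exact ENNReal.ofReal_le_one.2 (hσ i)
  calc _ ≤ 1 * (incrConst * ‖x - y‖ₑ * lorentzNorm 3 1 ζ + ‖y (l i)‖ₑ * ‖kernIncr a b i ζ x y‖ₑ) :=
        mul_le_mul' h1 (enorm_kern_coord_sub_le ha hab i (l i) hm hZ x y)
    _ ≤ _ := by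
        rw [one_mul]
        gcongr
        exact enorm_coord_le_horiz (hl i) y

/-! ### Convolution with Schwartz functions -/

/-- A weight dominating Schwartz functions. -/
def wt (x : E3) : ℝ := (1 + ‖x‖) ^ (-4 : ℝ)

theorem wt_pos (x : E3) : 0 < wt x := by unfold wt; positivity

theorem wt_le_one (x : E3) : wt x ≤ 1 :=
  Real.rpow_le_one_of_one_le_of_nonpos (by linarith [norm_nonneg x]) (by norm_num)

theorem continuous_wt : Continuous wt := by
  unfold wt
  exact Continuous.rpow_const (by fun_prop) fun x => Or.inl (by positivity)

theorem integrable_wt : Integrable wt :=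
  integrable_one_add_norm (by rw [finrank_euclideanSpace_fin]; norm_num)

theorem memLp_wt : MemLp wt 2 volume := by
  rw [memLp_two_iff_integrable_sq continuous_wt.aestronglyMeasurable]
  refine integrable_wt.mono' (continuous_wt.pow 2).aestronglyMeasurable
    (Eventually.of_forall fun x => ?_)
  rw [Real.norm_of_nonneg (sq_nonneg _), sq]
  exact mul_le_of_le_one_left (wt_pos x).le (wt_le_one x)

/-- The constant is 2⁴. A bound locally uniform in x permits differentiation under the integral
sign, and the exponent 4 exceeds the dimension, so the weight is integrable. -/
theorem wt_le_of_norm_le {x y : E3} (h : ‖x - y‖ ≤ 1) : wt x ≤ 16 * wt y := by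
  have h1 : 1 + ‖y‖ ≤ 2 * (1 + ‖x‖) := by
    have := norm_sub_norm_le y x
    rw [norm_sub_rev] at this
    linarith [norm_nonneg x]
  have h2 : (16 : ℝ) = 2 ^ (4 : ℝ) := by norm_num
  unfold wt
  rw [Real.rpow_neg (by positivity), Real.rpow_neg (by positivity), h2, ← div_eq_mul_inv,
    le_div_iff₀ (by positivity), inv_mul_le_iff₀ (by positivity),
    ← Real.mul_rpow (by positivity) (by positivity), mul_comm]
  exact Real.rpow_le_rpow (by positivity) h1 (by norm_num)

theorem exists_le_wt {F : Type*} [NormedAddCommGroup F] [NormedSpace ℝ F] (H : 𝓢(E3, F)) :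
    ∃ C : ℝ, 0 ≤ C ∧ ∀ x, ‖H x‖ ≤ C * wt x := by
  refine ⟨2 ^ 4 * (Finset.Iic (4, 0)).sup (fun m => SchwartzMap.seminorm ℝ m.1 m.2) H,
    by positivity, fun x => ?_⟩
  have h := SchwartzMap.one_add_le_sup_seminorm_apply (𝕜 := ℝ) (m := (4, 0)) le_rfl le_rfl H x
  rw [norm_iteratedFDeriv_zero] at h
  have h2 : wt x * (1 + ‖x‖) ^ 4 = 1 := by
    rw [wt, ← Real.rpow_natCast, ← Real.rpow_add (by positivity)]; norm_num
  calc ‖H x‖ = wt x * ((1 + ‖x‖) ^ 4 * ‖H x‖) := by rw [← mul_assoc, h2, one_mul]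
    _ ≤ wt x * _ := mul_le_mul_of_nonneg_left h (wt_pos x).le
    _ = _ := mul_comm _ _

section Conv

variable {F : Type*} [NormedAddCommGroup F] [NormedSpace ℝ F]

theorem norm_smul_schwartz_le (H : 𝓢(E3, F)) {ρ : E3 → ℝ} {C : ℝ} (hC : ∀ x, ‖H x‖ ≤ C * wt x)
    (hC0 : 0 ≤ C) {x x₀ : E3} (hx : x ∈ Metric.ball x₀ 1) (y : E3) :
    ‖ρ y • H (x - y)‖ ≤ 16 * C * (wt (x₀ - y) * |ρ y|) := by
  have h1 : wt (x - y) ≤ 16 * wt (x₀ - y) := by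
    refine wt_le_of_norm_le ?_
    rw [sub_sub_sub_cancel_right]
    exact (mem_ball_iff_norm.1 hx).le
  rw [norm_smul, Real.norm_eq_abs]
  calc |ρ y| * ‖H (x - y)‖ ≤ |ρ y| * (C * (16 * wt (x₀ - y))) := by
        gcongr
        exact (hC _).trans (by gcongr)
    _ = _ := by ring

theorem integrable_wt_mul {ρ : E3 → ℝ} (hρ : MemLp ρ 2 volume) (x : E3) :
    Integrable fun y => wt (x - y) * |ρ y| :=
  integrable_sub_left_mul memLp_wt hρ.abs x

theorem aestronglyMeasurable_smul_schwartz (H : 𝓢(E3, F)) {ρ : E3 → ℝ} (hρ : MemLp ρ 2 volume)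
    (x : E3) : AEStronglyMeasurable (fun y => ρ y • H (x - y)) volume :=
  hρ.1.smul (Continuous.aestronglyMeasurable (H.continuous.comp (by fun_prop)))

theorem integrable_smul_schwartz (H : 𝓢(E3, F)) {ρ : E3 → ℝ} (hρ : MemLp ρ 2 volume) (x : E3) :
    Integrable fun y => ρ y • H (x - y) := by
  obtain ⟨C, hC0, hC⟩ := exists_le_wt H
  exact ((integrable_wt_mul hρ x).const_mul (16 * C)).mono'
    (aestronglyMeasurable_smul_schwartz H hρ x) (Eventually.of_forall
      (norm_smul_schwartz_le H hC hC0 (Metric.mem_ball_self one_pos)))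

theorem continuous_integral_smul_schwartz (H : 𝓢(E3, F)) {ρ : E3 → ℝ} (hρ : MemLp ρ 2 volume) :
    Continuous fun x => ∫ y, ρ y • H (x - y) := by
  obtain ⟨C, hC0, hC⟩ := exists_le_wt H
  refine continuous_iff_continuousAt.2 fun x₀ => ?_
  refine continuousAt_of_dominated
    (Eventually.of_forall fun x => aestronglyMeasurable_smul_schwartz H hρ x) ?_
    ((integrable_wt_mul hρ x₀).const_mul (16 * C)) (Eventually.of_forall fun y => ?_)
  · filter_upwards [Metric.ball_mem_nhds x₀ one_pos] with x hx
    exact Eventually.of_forall (norm_smul_schwartz_le H hC hC0 hx)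
  · have : Continuous fun x => ρ y • H (x - y) :=
      (H.continuous.comp (by fun_prop)).const_smul (ρ y)
    exact this.continuousAt

end Conv

theorem hasFDerivAt_schwartz_sub (h : 𝓢(E3, ℂ)) (x y : E3) :
    HasFDerivAt (fun x => h (x - y)) (fderiv ℝ h (x - y)) x := by
  have := (h.hasFDerivAt (x - y)).comp x ((hasFDerivAt_id x).sub_const y)
  rwa [ContinuousLinearMap.comp_id] at this

theorem hasFDerivAt_integral_smul_schwartz (h : 𝓢(E3, ℂ)) {H : 𝓢(E3, E3 →L[ℝ] ℂ)}
    (hH : ∀ x, H x = fderiv ℝ h x) {ρ : E3 → ℝ} (hρ : MemLp ρ 2 volume)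
    (x₀ : E3) : HasFDerivAt (fun x => ∫ y, ρ y • h (x - y)) (∫ y, ρ y • H (x₀ - y)) x₀ := by
  obtain ⟨C, hC0, hC⟩ := exists_le_wt H
  have h1 : ∀ y x, x ∈ Metric.ball x₀ 1 → ‖ρ y • H (x - y)‖ ≤ 16 * C * (wt (x₀ - y) * |ρ y|) :=
    fun y x hx => norm_smul_schwartz_le H hC hC0 hx y
  have h2 : ∀ y x, HasFDerivAt (fun x => ρ y • h (x - y)) (ρ y • H (x - y)) x := fun y x => by
    rw [hH]
    exact (hasFDerivAt_schwartz_sub h x y).const_smul (ρ y)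
  have h3 : Integrable fun y => 16 * C * (wt (x₀ - y) * |ρ y|) :=
    (integrable_wt_mul hρ x₀).const_mul (16 * C)
  have h4 : ∀ᶠ x in 𝓝 x₀, AEStronglyMeasurable (fun y => ρ y • h (x - y)) volume :=
    Eventually.of_forall fun x => aestronglyMeasurable_smul_schwartz h hρ x
  have h5 := aestronglyMeasurable_smul_schwartz H hρ x₀
  have h6 := integrable_smul_schwartz h hρ x₀
  exact hasFDerivAt_integral_of_dominated_of_fderiv_le (𝕜 := ℝ) (μ := (volume : Measure E3))
    (s := Metric.ball x₀ 1) (F := fun x y => ρ y • h (x - y)) (F' := fun x y => ρ y • H (x - y))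
    (bound := fun y => 16 * C * (wt (x₀ - y) * |ρ y|)) (Metric.ball_mem_nhds x₀ one_pos) h4 h6 h5
    (ae_of_all _ h1) h3 (ae_of_all _ fun y x _ => h2 y x)

theorem contDiff_integral_smul_schwartz (h : 𝓢(E3, ℂ)) {ρ : E3 → ℝ} (hρ : MemLp ρ 2 volume) :
    ContDiff ℝ 1 fun x => ∫ y, ρ y • h (x - y) := by
  have hH := SchwartzMap.fderivCLM_apply (𝕜 := ℝ) h
  refine contDiff_one_iff_fderiv.2 ⟨fun x =>
    (hasFDerivAt_integral_smul_schwartz h hH hρ x).differentiableAt, ?_⟩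
  rw [funext fun x => (hasFDerivAt_integral_smul_schwartz h hH hρ x).fderiv]
  exact continuous_integral_smul_schwartz _ hρ

/-! ### Fourier multipliers as convolutions -/

/-- The transpose of a Fourier multiplier. -/
theorem fourier_smulLeft_fourierInv (m ψ : 𝓢(E3, ℂ)) (y : E3) :
    (𝓕 (SchwartzMap.smulLeftCLM ℂ m (𝓕⁻ ψ)) : 𝓢(E3, ℂ)) y
      = ∫ x, ψ x * (𝓕⁻ m : 𝓢(E3, ℂ)) (x - y) := by
  set G : E3 → ℂ := fun ξ => Real.fourierChar (-inner ℝ ξ y) • m ξ with hG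
  have hGi : Integrable G := (Real.fourierIntegral_convergent_iff y).2 m.integrable
  have h1 : (𝓕 (SchwartzMap.smulLeftCLM ℂ m (𝓕⁻ ψ)) : 𝓢(E3, ℂ)) y
      = ∫ ξ, 𝓕 (fun x => ψ (-x)) ξ * G ξ := by
    rw [SchwartzMap.fourier_coe, Real.fourier_eq]
    refine integral_congr_ae (Eventually.of_forall fun ξ => ?_)
    simp only [hG]
    rw [SchwartzMap.smulLeftCLM_apply_apply m.hasTemperateGrowth, SchwartzMap.fourierInv_coe,
      Real.fourierInv_eq_fourier_comp_neg, Circle.smul_def, Circle.smul_def]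
    simp only [smul_eq_mul]; ring
  rw [h1, integral_fourier_mul_flip ψ.integrable.comp_neg hGi,
    ← integral_neg_eq_self]
  refine integral_congr_ae (Eventually.of_forall fun x => ?_)
  simp only [neg_neg]
  congr 1
  rw [SchwartzMap.fourierInv_coe, Real.fourierInv_eq, Real.fourier_eq]
  refine integral_congr_ae (Eventually.of_forall fun ξ => ?_)
  simp only [hG]
  rw [smul_smul, ← AddChar.map_add_eq_mul]
  congr 2
  rw [inner_neg_right, inner_sub_right]; ring

theorem integral_integral_swap_of_bound {ψ : E3 → ℂ} (hψ : Integrable ψ) (hψc : Continuous ψ)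
    {K : E3 → E3 → ℂ} (hK : Continuous (Function.uncurry K)) (hKi : ∀ x, Integrable (K x)) {B : ℝ}
    (hB : ∀ x, ∫ y, ‖K x y‖ ≤ B) :
    ∫ y, ∫ x, ψ x * K x y = ∫ x, ψ x * ∫ y, K x y := by
  have hm : Continuous fun z : E3 × E3 => ψ z.1 * K z.1 z.2 :=
    (hψc.comp continuous_fst).mul hK
  have h : Integrable (Function.uncurry fun x y => ψ x * K x y) (volume.prod volume) := by
    refine (integrable_prod_iff hm.aestronglyMeasurable).2 ⟨Eventually.of_forall fun x => (hKi x).const_mul (ψ x), ?_⟩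
    have hm2 := (hm.aestronglyMeasurable (μ := volume.prod volume)).norm.integral_prod_right'
    refine (hψ.norm.mul_const B).mono' hm2 (Eventually.of_forall fun x => ?_)
    simp only [norm_mul]
    rw [integral_const_mul, norm_mul, norm_norm,
      Real.norm_of_nonneg (integral_nonneg fun _ => norm_nonneg _)]
    gcongr
    exact hB x
  rw [← integral_integral_swap h]
  simp_rw [integral_const_mul]

open LineDeriv

/-! ### The commutator as an integral operator -/

theorem contDiff_blockSymbol {χ φ : E3 → ℝ} (h : IsDyadicPartition χ φ) (q : ℤ) :
    ContDiff ℝ ∞ fun ξ : E3 => (blockSymbol χ φ q ((2 * Real.pi) • ξ) : ℂ) := by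
  have h1 : ContDiff ℝ ∞ (blockSymbol χ φ q) := by
    unfold blockSymbol
    split_ifs
    · exact h.chi_smooth
    · exact h.phi_smooth.comp (by fun_prop)
  exact Complex.ofRealCLM.contDiff.comp (h1.comp (by fun_prop))

theorem hasCompactSupport_blockSymbol {χ φ : E3 → ℝ} (h : IsDyadicPartition χ φ) (q : ℤ) :
    HasCompactSupport fun ξ : E3 => (blockSymbol χ φ q ((2 * Real.pi) • ξ) : ℂ) := by
  have h1 : HasCompactSupport (blockSymbol χ φ q) := by
    unfold blockSymbol
    split_ifs
    · exact h.chi_compact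
    · exact h.phi_compact.comp_smul (by positivity)
  exact (h1.comp_smul (c := 2 * Real.pi) (by positivity)).comp_left (g := ((↑) : ℝ → ℂ)) rfl

/-- The symbol of `Δ_q` as a Schwartz function. -/
def blockSchwartz {χ φ : E3 → ℝ} (h : IsDyadicPartition χ φ) (q : ℤ) : 𝓢(E3, ℂ) :=
  (hasCompactSupport_blockSymbol h q).toSchwartzMap (contDiff_blockSymbol h q)

/-- The convolution kernel of `Δ_q`. -/
def blockKernel {χ φ : E3 → ℝ} (h : IsDyadicPartition χ φ) (q : ℤ) : 𝓢(E3, ℂ) :=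
  𝓕⁻ (blockSchwartz h q)

/-- The gradient of the convolution kernel of `Δ_q`. -/
def gradKernel {χ φ : E3 → ℝ} (h : IsDyadicPartition χ φ) (q : ℤ) : 𝓢(E3, E3 →L[ℝ] ℂ) :=
  SchwartzMap.fderivCLM ℝ E3 ℂ (blockKernel h q)

theorem gradKernel_apply {χ φ : E3 → ℝ} (h : IsDyadicPartition χ φ) (q : ℤ) (x : E3) :
    gradKernel h q x = fderiv ℝ (blockKernel h q) x := rfl

/-- The transpose of `Δ_q` on test functions. -/
def blockTest {χ φ : E3 → ℝ} (h : IsDyadicPartition χ φ) (q : ℤ) (ψ : 𝓢(E3, ℂ)) : 𝓢(E3, ℂ) :=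
  𝓕 (SchwartzMap.smulLeftCLM ℂ (blockSchwartz h q) (𝓕⁻ ψ))

theorem block_apply {χ φ : E3 → ℝ} (h : IsDyadicPartition χ φ) (q : ℤ) (u : 𝓢'(E3, ℂ))
    (ψ : 𝓢(E3, ℂ)) : block χ φ q u ψ = u (blockTest h q ψ) := rfl

theorem blockTest_apply {χ φ : E3 → ℝ} (h : IsDyadicPartition χ φ) (q : ℤ) (ψ : 𝓢(E3, ℂ))
    (y : E3) : blockTest h q ψ y = ∫ x, ψ x * blockKernel h q (x - y) :=
  fourier_smulLeft_fourierInv _ ψ y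

/-! ### The distributions ρ and v·∇ρ and their blocks. -/

theorem exists_distribution_of_memLp {f : E3 → ℂ} {p : ℝ≥0∞} [Fact (1 ≤ p)]
    (hf : MemLp f p volume) : ∃ R : 𝓢'(E3, ℂ), ∀ ψ, R ψ = ∫ x, ψ x * f x := by
  refine ⟨Lp.toTemperedDistribution (hf.toLp f), fun ψ => ?_⟩
  rw [Lp.toTemperedDistribution_apply]
  refine integral_congr_ae ?_
  filter_upwards [hf.coeFn_toLp] with x hx
  rw [hx, smul_eq_mul]

theorem clm_apply_eq_sum {G : Type*} [NormedAddCommGroup G] [NormedSpace ℝ G] (L : E3 →L[ℝ] G)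
    (y : E3) : L y = ∑ j, y j • L (EuclideanSpace.single j 1) := by
  conv_lhs => rw [← (EuclideanSpace.basisFun (Fin 3) ℝ).sum_repr y]
  rw [map_sum]
  refine Finset.sum_congr rfl fun j _ => ?_
  rw [map_smul]; simp

theorem integrable_mul_norm {v : E3 → E3} {ρ : E3 → ℝ} (hv : MemLp v 2 volume)
    (hρ : MemLp ρ 2 volume) : Integrable fun y => |ρ y| * ‖v y‖ :=
  MemLp.integrable_mul hρ.abs hv.norm

/-- The distribution `div (ρ v)`. -/
theorem exists_distribution_div {v : E3 → E3} {ρ : E3 → ℝ} (hv : MemLp v 2 volume)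
    (hρ : MemLp ρ 2 volume) : ∃ U : 𝓢'(E3, ℂ), ∀ ψ : 𝓢(E3, ℂ),
      U ψ = -∫ y, ρ y • fderiv ℝ ψ y (v y) := by
  have hL : ∀ j, MemLp (fun y => ((ρ y * v y j : ℝ) : ℂ)) 1 volume := fun j =>
    memLp_one_iff_integrable.2 (MemLp.integrable_mul hρ (memLp_coord hv j)).ofReal
  choose R hR using fun j => exists_distribution_of_memLp (hL j)
  refine ⟨∑ j, ∂_{(EuclideanSpace.single j 1 : E3)} (R j), fun ψ => ?_⟩
  have hi : ∀ j, Integrable fun y =>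
      fderiv ℝ ψ y (EuclideanSpace.single j 1) * ((ρ y * v y j : ℝ) : ℂ) := by
    intro j
    obtain ⟨C, hC0, hC⟩ := exists_le_wt (∂_{(EuclideanSpace.single j 1 : E3)} ψ)
    refine Integrable.bdd_mul (c := C) (memLp_one_iff_integrable.1 (hL j))
      (∂_{(EuclideanSpace.single j 1 : E3)} ψ).continuous.aestronglyMeasurable
      (Eventually.of_forall fun y => (hC y).trans (mul_le_of_le_one_right hC0 (wt_le_one y)))
  have h1 : ∀ j, (∂_{(EuclideanSpace.single j 1 : E3)} (R j)) ψ
      = -∫ y, fderiv ℝ ψ y (EuclideanSpace.single j 1) * ((ρ y * v y j : ℝ) : ℂ) := by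
    intro j
    rw [TemperedDistribution.lineDerivOp_apply_apply, hR, ← integral_neg]
    refine integral_congr_ae (Eventually.of_forall fun y => ?_)
    simp only [neg_apply, SchwartzMap.lineDerivOp_apply_eq_fderiv, neg_mul]
  rw [sum_apply]
  simp_rw [h1]
  rw [Finset.sum_neg_distrib, ← integral_finsetSum _ fun j _ => hi j]
  congr 1
  refine integral_congr_ae (Eventually.of_forall fun y => ?_)
  simp only
  rw [clm_apply_eq_sum (fderiv ℝ ψ y) (v y), Finset.smul_sum]
  refine Finset.sum_congr rfl fun j _ => ?_
  rw [smul_smul, Complex.real_smul, mul_comm]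

theorem advect_ofReal {v : E3 → E3} {ρ : E3 → ℝ} (hρ : ContDiff ℝ 1 ρ) (x : E3) :
    advect v (fun x => (ρ x : ℂ)) x = ((fderiv ℝ ρ x (v x) : ℝ) : ℂ) := by
  have h := (Complex.ofRealCLM.hasFDerivAt.comp x
    (hρ.differentiable one_ne_zero x).hasFDerivAt).fderiv
  rw [advect]
  change fderiv ℝ (⇑Complex.ofRealCLM ∘ ρ) x (v x) = _
  rw [h]; simp

/-- v·∇ρ need not have decay of its own, but ρv is integrable, so div(ρv) is tempered. Against
compactly supported test functions integration by parts and div v = 0 identify the two. -/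
theorem isRepresentedBy_advect {v : E3 → E3} {ρ : E3 → ℝ} (hv : ContDiff ℝ 1 v)
    (hdiv : ∀ x, divergence v x = 0) (hρ : ContDiff ℝ 1 ρ) {U : 𝓢'(E3, ℂ)}
    (hU : ∀ ψ : 𝓢(E3, ℂ), U ψ = -∫ y, ρ y • fderiv ℝ ψ y (v y)) :
    IsRepresentedBy U (advect v fun x => (ρ x : ℂ)) := by
  have hρd := hρ.continuous_fderiv one_ne_zero
  have hc : Continuous (advect v fun x => (ρ x : ℂ)) := by
    rw [funext fun x => advect_ofReal (v := v) hρ x]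
    exact Complex.continuous_ofReal.comp (hρd.clm_apply hv.continuous)
  refine ⟨hc.locallyIntegrable, fun ψ hψ => ?_⟩
  rw [hU, ← integral_neg]
  set g : Fin 3 → E3 → ℝ := fun j y => ρ y * v y j with hg
  have hgc : ∀ j, ContDiff ℝ 1 (g j) := fun j => hρ.mul (contDiff_coord hv j)
  have hgC : ∀ j, ContDiff ℝ 1 fun y => (g j y : ℂ) := fun j =>
    Complex.ofRealCLM.contDiff.comp (hgc j)
  have hψd : ∀ j, Continuous fun y => fderiv ℝ ψ y (EuclideanSpace.single j 1) := fun j =>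
    (∂_{(EuclideanSpace.single j 1 : E3)} ψ).continuous
  have hψs : ∀ j, HasCompactSupport fun y => fderiv ℝ ψ y (EuclideanSpace.single j 1) := fun j =>
    hψ.fderiv_apply ℝ _
  have hgd : ∀ j, Continuous fun y => fderiv ℝ (fun y => (g j y : ℂ)) y (EuclideanSpace.single j 1) :=
    fun j => ((hgC j).continuous_fderiv one_ne_zero).clm_apply continuous_const
  have i1 : ∀ j, Integrable fun y => fderiv ℝ ψ y (EuclideanSpace.single j 1) * (g j y : ℂ) := fun j =>
    ((hψd j).mul (hgC j).continuous).integrable_of_hasCompactSupport (hψs j).mul_right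
  have i2 : ∀ j, Integrable fun y =>
      ψ y * fderiv ℝ (fun y => (g j y : ℂ)) y (EuclideanSpace.single j 1) := fun j =>
    (ψ.continuous.mul (hgd j)).integrable_of_hasCompactSupport hψ.mul_right
  have ibp := fun j => integral_mul_fderiv_eq_neg_fderiv_mul_of_integrable
    (μ := (volume : Measure E3)) (i1 j) (i2 j)
    ((ψ.continuous.mul (hgC j).continuous).integrable_of_hasCompactSupport hψ.mul_right)
    (fun y _ => ψ.differentiableAt) (fun y _ => (hgC j).differentiable one_ne_zero y)
  have hgf : ∀ j y, fderiv ℝ (fun y => (g j y : ℂ)) y (EuclideanSpace.single j 1)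
      = ((ρ y * pderiv j j v y + fderiv ℝ ρ y (EuclideanSpace.single j 1) * v y j : ℝ) : ℂ) := by
    intro j y
    have := advect_ofReal (v := fun _ => EuclideanSpace.single j 1) (hgc j) y
    rw [advect] at this
    rw [this, hg, fderiv_mul_coord hv hρ]
  calc ∫ y, -(ρ y • fderiv ℝ ψ y (v y))
      = ∫ y, ∑ j, -(fderiv ℝ ψ y (EuclideanSpace.single j 1) * (g j y : ℂ)) := by
        refine integral_congr_ae (Eventually.of_forall fun y => ?_)
        simp only
        rw [clm_apply_eq_sum (fderiv ℝ ψ y) (v y), Finset.smul_sum, Finset.sum_neg_distrib]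
        congr 1
        refine Finset.sum_congr rfl fun j _ => ?_
        rw [smul_smul, Complex.real_smul, mul_comm]
    _ = ∑ j, ∫ y, ψ y * fderiv ℝ (fun y => (g j y : ℂ)) y (EuclideanSpace.single j 1) := by
        have i3 : ∀ j, Integrable fun y =>
            -(fderiv ℝ ψ y (EuclideanSpace.single j 1) * (g j y : ℂ)) := fun j => (i1 j).neg
        rw [integral_finsetSum _ fun j _ => i3 j]
        refine Finset.sum_congr rfl fun j _ => ?_
        rw [integral_neg, ibp j]
    _ = ∫ y, ψ y * advect v (fun x => (ρ x : ℂ)) y := by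
        rw [← integral_finsetSum _ fun j _ => i2 j]
        refine integral_congr_ae (Eventually.of_forall fun y => ?_)
        simp only
        rw [← Finset.mul_sum, advect_ofReal hρ]
        congr 1
        simp_rw [hgf]
        rw [← Complex.ofReal_sum, Finset.sum_add_distrib, ← Finset.mul_sum,
          clm_apply_eq_sum (fderiv ℝ ρ y) (v y)]
        have : ∑ j, pderiv j j v y = 0 := hdiv y
        rw [this, mul_zero, zero_add]
        congr 1
        exact Finset.sum_congr rfl fun j _ => by rw [smul_eq_mul, mul_comm]

theorem integral_wt_mul_le {ρ : E3 → ℝ} (hρ : MemLp ρ 2 volume) (x : E3) :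
    ∫ y, wt (x - y) * |ρ y| ≤ (∫ y, wt y ^ 2) + ∫ y, ρ y ^ 2 := by
  have h1 := (integrable_sq_of_memLp memLp_wt).comp_sub_left x
  have h2 := integrable_sq_of_memLp hρ
  rw [← integral_sub_left_eq_self (fun y => wt y ^ 2) volume x, ← integral_add h1 h2]
  refine integral_mono (integrable_wt_mul hρ x) (h1.add h2) fun y => ?_
  have := two_mul_le_add_sq (wt (x - y)) |ρ y|
  have h3 := mul_nonneg (wt_pos (x - y)).le (abs_nonneg (ρ y))
  simp only
  rw [sq_abs] at this
  linarith

theorem isRepresentedBy_block_memLp {χ φ : E3 → ℝ} (h : IsDyadicPartition χ φ) (q : ℤ) {ρ : E3 → ℝ}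
    (hρc : Continuous ρ) (hρ : MemLp ρ 2 volume) {R : 𝓢'(E3, ℂ)}
    (hR : ∀ ψ : 𝓢(E3, ℂ), R ψ = ∫ x, ψ x * (ρ x : ℂ)) :
    IsRepresentedBy (block χ φ q R) fun x => ∫ y, ρ y • blockKernel h q (x - y) := by
  refine ⟨(continuous_integral_smul_schwartz _ hρ).locallyIntegrable, fun ψ _ => ?_⟩
  rw [block_apply h, hR]
  obtain ⟨C, hC0, hC⟩ := exists_le_wt (blockKernel h q)
  have hb : ∀ x, ∫ y, ‖ρ y • blockKernel h q (x - y)‖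
      ≤ 16 * C * ((∫ y, wt y ^ 2) + ∫ y, ρ y ^ 2) := by
    intro x
    calc _ ≤ ∫ y, 16 * C * (wt (x - y) * |ρ y|) :=
          integral_mono (integrable_smul_schwartz _ hρ x).norm
            ((integrable_wt_mul hρ x).const_mul _)
            (norm_smul_schwartz_le _ hC hC0 (Metric.mem_ball_self one_pos))
      _ ≤ _ := by
          rw [integral_const_mul]
          exact mul_le_mul_of_nonneg_left (integral_wt_mul_le hρ x) (by positivity)
  have hK : Continuous (Function.uncurry fun x y : E3 => ρ y • blockKernel h q (x - y)) :=
    (hρc.comp continuous_snd).smul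
      ((blockKernel h q).continuous.comp (continuous_fst.sub continuous_snd))
  rw [← integral_integral_swap_of_bound ψ.integrable ψ.continuous hK
    (integrable_smul_schwartz _ hρ) hb]
  refine integral_congr_ae (Eventually.of_forall fun y => ?_)
  simp only
  rw [blockTest_apply, ← integral_mul_const]
  refine integral_congr_ae (Eventually.of_forall fun x => ?_)
  simp only [Complex.real_smul]; ring

theorem exists_norm_gradKernel_le {χ φ : E3 → ℝ} (h : IsDyadicPartition χ φ) (q : ℤ) :
    ∃ C : ℝ, 0 ≤ C ∧ ∀ x, ‖gradKernel h q x‖ ≤ C := by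
  obtain ⟨C, hC0, hC⟩ := exists_le_wt (gradKernel h q)
  exact ⟨C, hC0, fun x => (hC x).trans (mul_le_of_le_one_right hC0 (wt_le_one x))⟩

/-- Differentiation of h_q(x-y) in y produces a minus sign, which cancels the one in the definition
of div(ρv). -/
theorem fderiv_blockTest {χ φ : E3 → ℝ} (h : IsDyadicPartition χ φ) (q : ℤ) (ψ : 𝓢(E3, ℂ))
    (y u : E3) : fderiv ℝ (blockTest h q ψ) y u = -∫ x, ψ x * gradKernel h q (x - y) u := by
  obtain ⟨C, hC0, hC⟩ := exists_norm_gradKernel_le h q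
  have hg := (gradKernel h q).continuous
  have hk := (blockKernel h q).continuous
  have hψ := ψ.continuous
  obtain ⟨D, hD0, hD⟩ := exists_le_wt (blockKernel h q)
  have h2 : ∀ x y, HasFDerivAt (fun y => ψ x • blockKernel h q (x - y))
      (ψ x • -gradKernel h q (x - y)) y := fun x y => by
    have h3 : HasFDerivAt (fun y => x - y) (-ContinuousLinearMap.id ℝ E3) y :=
      (hasFDerivAt_id y).const_sub x
    have h4 := ((blockKernel h q).hasFDerivAt (x - y)).comp y h3
    rw [ContinuousLinearMap.comp_neg, ContinuousLinearMap.comp_id] at h4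
    exact h4.const_smul (ψ x)
  have hm : ∀ y, AEStronglyMeasurable (fun x => ψ x • blockKernel h q (x - y)) volume := fun y =>
    Continuous.aestronglyMeasurable (by fun_prop)
  have hm' : Continuous (fun x => ψ x • -gradKernel h q (x - y)) := by fun_prop
  have hi : Integrable fun x => ψ x • blockKernel h q (x - y) :=
    (ψ.integrable.norm.mul_const D).mono' (hm y) (Eventually.of_forall fun x => by
      rw [norm_smul]
      exact mul_le_mul_of_nonneg_left
        ((hD _).trans (mul_le_of_le_one_right hD0 (wt_le_one _))) (norm_nonneg _))
  have hb : ∀ x y, ‖ψ x • -gradKernel h q (x - y)‖ ≤ ‖ψ x‖ * C := fun x y => by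
    rw [norm_smul, norm_neg]
    exact mul_le_mul_of_nonneg_left (hC _) (norm_nonneg _)
  have hd := hasFDerivAt_integral_of_dominated_of_fderiv_le (𝕜 := ℝ) (μ := (volume : Measure E3))
    (s := Set.univ) (F := fun y x => ψ x • blockKernel h q (x - y))
    (F' := fun y x => ψ x • -gradKernel h q (x - y)) (bound := fun x => ‖ψ x‖ * C)
    univ_mem (Eventually.of_forall hm) hi hm'.aestronglyMeasurable
    (ae_of_all _ fun x y _ => hb x y) (ψ.integrable.norm.mul_const C)
    (ae_of_all _ fun x y _ => h2 x y)
  have he : ⇑(blockTest h q ψ) = fun y => ∫ x, ψ x • blockKernel h q (x - y) :=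
    funext fun y => blockTest_apply h q ψ y
  rw [he, hd.fderiv, ContinuousLinearMap.integral_apply, ← integral_neg]
  · refine integral_congr_ae (Eventually.of_forall fun x => ?_)
    simp
  · exact (ψ.integrable.norm.mul_const C).mono' hm'.aestronglyMeasurable
      (Eventually.of_forall fun x => hb x y)

section Grad

variable {χ φ : E3 → ℝ} (h : IsDyadicPartition χ φ) (q : ℤ) {v : E3 → E3} {ρ : E3 → ℝ}

theorem integrable_gradKernel_apply (hvc : Continuous v) (hρc : Continuous ρ)
    (hv : MemLp v 2 volume) (hρ : MemLp ρ 2 volume) (x : E3) :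
    Integrable fun y => ρ y • gradKernel h q (x - y) (v y) := by
  obtain ⟨C, hC0, hC⟩ := exists_norm_gradKernel_le h q
  have hg := (gradKernel h q).continuous
  refine ((integrable_mul_norm hv hρ).const_mul C).mono'
    (Continuous.aestronglyMeasurable (by fun_prop)) (Eventually.of_forall fun y => ?_)
  rw [norm_smul, Real.norm_eq_abs, mul_left_comm]
  exact mul_le_mul_of_nonneg_left ((gradKernel h q (x - y)).le_of_opNorm_le (hC _) _) (abs_nonneg _)

theorem isRepresentedBy_block_div (hvc : Continuous v) (hρc : Continuous ρ)
    (hv : MemLp v 2 volume) (hρ : MemLp ρ 2 volume) {U : 𝓢'(E3, ℂ)}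
    (hU : ∀ ψ : 𝓢(E3, ℂ), U ψ = -∫ y, ρ y • fderiv ℝ ψ y (v y)) :
    IsRepresentedBy (block χ φ q U) fun x => ∫ y, ρ y • gradKernel h q (x - y) (v y) := by
  obtain ⟨C, hC0, hC⟩ := exists_norm_gradKernel_le h q
  have hg := (gradKernel h q).continuous
  have hi := integrable_gradKernel_apply h q hvc hρc hv hρ
  have hn : ∀ x y, ‖ρ y • gradKernel h q (x - y) (v y)‖ ≤ C * (|ρ y| * ‖v y‖) := fun x y => by
    rw [norm_smul, Real.norm_eq_abs, mul_left_comm]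
    exact mul_le_mul_of_nonneg_left ((gradKernel h q (x - y)).le_of_opNorm_le (hC _) _)
      (abs_nonneg _)
  have hcont : Continuous fun x => ∫ y, ρ y • gradKernel h q (x - y) (v y) := by
    refine continuous_of_dominated (fun x => (hi x).aestronglyMeasurable)
      (fun x => Eventually.of_forall (hn x)) ((integrable_mul_norm hv hρ).const_mul C)
      (Eventually.of_forall fun y => ?_)
    fun_prop
  refine ⟨hcont.locallyIntegrable, fun ψ _ => ?_⟩
  have hb : ∀ x, ∫ y, ‖ρ y • gradKernel h q (x - y) (v y)‖ ≤ C * ∫ y, |ρ y| * ‖v y‖ := fun x => by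
    rw [← integral_const_mul]
    exact integral_mono (hi x).norm ((integrable_mul_norm hv hρ).const_mul C) (hn x)
  have hK : Continuous (Function.uncurry fun x y : E3 => ρ y • gradKernel h q (x - y) (v y)) :=
    (hρc.comp continuous_snd).smul
      ((hg.comp (continuous_fst.sub continuous_snd)).clm_apply (hvc.comp continuous_snd))
  rw [block_apply h, hU, ← integral_integral_swap_of_bound ψ.integrable ψ.continuous hK hi hb,
    ← integral_neg]
  refine integral_congr_ae (Eventually.of_forall fun y => ?_)
  simp only
  rw [fderiv_blockTest, smul_neg, neg_neg, ← integral_smul]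
  refine integral_congr_ae (Eventually.of_forall fun x => ?_)
  simp only [Complex.real_smul]; ring

/-- Both terms become integrals of ρ against ∇h_q(x-y): in Δ_q div(ρv) the gradient is applied to
v(y), in v·∇Δ_qρ to v(x). Their difference involves only the increment of v. -/
theorem isBlockCommutator_integral (hvc : ContDiff ℝ 1 v) (hv : MemLp v 2 volume)
    (hdiv : ∀ x, divergence v x = 0) (hρc : ContDiff ℝ 1 ρ) (hρ : MemLp ρ 2 volume) :
    IsBlockCommutator χ φ q v ρ fun x => ∫ y, ρ y • gradKernel h q (x - y) (v y - v x) := by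
  have hρC : MemLp (fun x => (ρ x : ℂ)) 2 volume := hρ.ofReal
  obtain ⟨R, hR⟩ := exists_distribution_of_memLp hρC
  obtain ⟨U, hU⟩ := exists_distribution_div hv hρ
  refine ⟨R, U, fun x => ∫ y, ρ y • blockKernel h q (x - y),
    fun x => ∫ y, ρ y • gradKernel h q (x - y) (v y),
    ⟨(Complex.continuous_ofReal.comp hρc.continuous).locallyIntegrable, fun ψ _ => hR ψ⟩,
    isRepresentedBy_advect hvc hdiv hρc hU, contDiff_integral_smul_schwartz _ hρ,
    isRepresentedBy_block_memLp h q hρc.continuous hρ hR,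
    isRepresentedBy_block_div h q hvc.continuous hρc.continuous hv hρ hU, ?_⟩
  ext x
  have i1 := integrable_gradKernel_apply h q hvc.continuous hρc.continuous hv hρ x
  have i2 := integrable_smul_schwartz (gradKernel h q) hρ x
  rw [advect, (hasFDerivAt_integral_smul_schwartz _ (gradKernel_apply h q) hρ x).fderiv,
    ContinuousLinearMap.integral_apply i2, ← integral_sub i1 (i2.apply_continuousLinearMap (v x))]
  refine integral_congr_ae (Eventually.of_forall fun y => ?_)
  simp only [map_sub, smul_sub, smul_apply]

end Grad

/-! ### The first moment of the gradient kernels -/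

theorem fourierInv_comp_smul {m m' : 𝓢(E3, ℂ)} {R : ℝ} (hR : 0 < R)
    (h : ∀ ξ, m' ξ = m (R⁻¹ • ξ)) (x : E3) :
    (𝓕⁻ m' : 𝓢(E3, ℂ)) x = R ^ 3 • (𝓕⁻ m : 𝓢(E3, ℂ)) (R • x) := by
  rw [SchwartzMap.fourierInv_coe, SchwartzMap.fourierInv_coe, Real.fourierInv_eq, Real.fourierInv_eq]
  have h1 := Measure.integral_comp_smul (volume : Measure E3)
    (fun ξ => Real.fourierChar (inner ℝ ξ (R • x)) • m ξ) R⁻¹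
  rw [finrank_euclideanSpace_fin, inv_pow, inv_inv, abs_of_pos (by positivity)] at h1
  rw [← h1]
  refine integral_congr_ae (Eventually.of_forall fun ξ => ?_)
  simp only [h]
  rw [real_inner_smul_left, real_inner_smul_right, inv_mul_cancel_left₀ hR.ne']

theorem fderiv_fourierInv_comp_smul {m m' : 𝓢(E3, ℂ)} {R : ℝ} (hR : 0 < R)
    (h : ∀ ξ, m' ξ = m (R⁻¹ • ξ)) (x : E3) :
    fderiv ℝ (𝓕⁻ m' : 𝓢(E3, ℂ)) x = R ^ 4 • fderiv ℝ (𝓕⁻ m : 𝓢(E3, ℂ)) (R • x) := by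
  have h1 : HasFDerivAt (fun x : E3 => R • x) (R • ContinuousLinearMap.id ℝ E3) x :=
    (hasFDerivAt_id x).const_smul R
  have h2 := (((𝓕⁻ m : 𝓢(E3, ℂ)).hasFDerivAt (R • x)).comp x h1).const_smul (R ^ 3)
  have e : ⇑(𝓕⁻ m' : 𝓢(E3, ℂ)) = fun x => R ^ 3 • (𝓕⁻ m : 𝓢(E3, ℂ)) (R • x) :=
    funext (fourierInv_comp_smul hR h)
  rw [e]
  refine h2.fderiv.trans ?_
  rw [ContinuousLinearMap.comp_smul, ContinuousLinearMap.comp_id, smul_smul, ← pow_succ]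

/-- Scale invariance: with R = 2^q the gradient of the kernel scales by R⁴, which cancels R⁻³ from
dz and R⁻¹ from |z|. Hence the constant is independent of q, and only q = 0 and q = -1 remain to be
bounded. -/
theorem integral_norm_gradKernel {χ φ : E3 → ℝ} (h : IsDyadicPartition χ φ) {q : ℤ} (hq : 0 ≤ q) :
    ∫ z, ‖z‖ ^ 1 * ‖gradKernel h q z‖ = ∫ z, ‖z‖ ^ 1 * ‖gradKernel h 0 z‖ := by
  set R : ℝ := 2 ^ q with hRdef
  have hR : 0 < R := by positivity
  have hs : ∀ ξ, blockSchwartz h q ξ = blockSchwartz h 0 (R⁻¹ • ξ) := by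
    intro ξ
    change (blockSymbol χ φ q ((2 * Real.pi) • ξ) : ℂ)
      = blockSymbol χ φ 0 ((2 * Real.pi) • R⁻¹ • ξ)
    rw [blockSymbol, if_neg (by omega), blockSymbol, if_neg (by omega), neg_zero, zpow_zero, one_smul,
      hRdef, ← zpow_neg, smul_comm]
  have hg : ∀ z, gradKernel h q z = R ^ 4 • gradKernel h 0 (R • z) := fun z =>
    fderiv_fourierInv_comp_smul hR hs z
  have h1 := Measure.integral_comp_smul (volume : Measure E3)
    (fun z => ‖z‖ ^ 1 * ‖gradKernel h 0 z‖) R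
  rw [finrank_euclideanSpace_fin, abs_of_pos (by positivity)] at h1
  have h2 : ∫ z, ‖z‖ ^ 1 * ‖gradKernel h q z‖
      = R ^ 3 * ∫ z, ‖R • z‖ ^ 1 * ‖gradKernel h 0 (R • z)‖ := by
    rw [← integral_const_mul]
    refine integral_congr_ae (Eventually.of_forall fun z => ?_)
    simp only [hg]
    rw [norm_smul, norm_smul, Real.norm_of_nonneg hR.le, Real.norm_of_nonneg (by positivity)]
    ring
  rw [h2, h1, smul_eq_mul, mul_inv_cancel_left₀ (by positivity)]

theorem exists_moment_le {χ φ : E3 → ℝ} (h : IsDyadicPartition χ φ) :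
    ∃ M : ℝ, ∀ q : ℤ, -1 ≤ q → ∫⁻ z, ‖gradKernel h q z‖ₑ * ‖z‖ₑ ≤ ENNReal.ofReal M := by
  refine ⟨max (∫ z, ‖z‖ ^ 1 * ‖gradKernel h 0 z‖) (∫ z, ‖z‖ ^ 1 * ‖gradKernel h (-1) z‖),
    fun q hq => ?_⟩
  have h1 : ∫⁻ z, ‖gradKernel h q z‖ₑ * ‖z‖ₑ
      = ENNReal.ofReal (∫ z, ‖z‖ ^ 1 * ‖gradKernel h q z‖) := by
    rw [ofReal_integral_eq_lintegral_ofReal ((gradKernel h q).integrable_pow_mul volume 1)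
      (Eventually.of_forall fun z => by positivity)]
    refine lintegral_congr fun z => ?_
    rw [pow_one, ENNReal.ofReal_mul (norm_nonneg _), ofReal_norm, ofReal_norm, mul_comm]
  rw [h1]
  refine ENNReal.ofReal_le_ofReal ?_
  rcases eq_or_ne q (-1) with rfl | hne
  · exact le_max_right _ _
  · rw [integral_norm_gradKernel h (by omega)]
    exact le_max_left _ _

/-! ### The commutator estimate -/

/-- The regularised bound for the increments of the velocity. -/
def incrBound (a b : ℝ) (f : E3 → ℝ) (x y : E3) : ℝ≥0∞ :=
  9 * incrConst * ‖x - y‖ₑ * lorentzNorm 3 1 f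
    + 3 * ∑ i, ‖horiz y‖ₑ * ‖kernIncr a b i f x y‖ₑ

theorem measurable_kernIncr {a b : ℝ} (ha : 0 < a) (hab : a ≤ b) (i : Fin 3) {f : E3 → ℝ}
    (hf : Measurable f) : Measurable fun p : E3 × E3 => kernIncr a b i f p.1 p.2 := by
  have hc := (continuous_kern ha hab i).measurable
  have h : Measurable fun z : (E3 × E3) × E3 =>
      (kern a b i (z.1.1 - z.2) - kern a b i (z.1.2 - z.2)) * f z.2 := by fun_prop
  exact (h.stronglyMeasurable.integral_prod_right' (ν := volume)).measurable

theorem continuous_horiz : Continuous horiz := by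
  unfold horiz
  fun_prop

theorem measurable_incrBound {a b : ℝ} (ha : 0 < a) (hab : a ≤ b) {f : E3 → ℝ}
    (hf : Measurable f) : Measurable fun p : E3 × E3 => incrBound a b f p.1 p.2 := by
  have h := fun i => measurable_kernIncr ha hab i hf
  have hh := continuous_horiz.measurable
  unfold incrBound
  fun_prop

theorem sq_add_four_le (a b c d : ℝ≥0∞) :
    (a + (b + c + d)) ^ 2 ≤ 4 * (a ^ 2 + (b ^ 2 + c ^ 2 + d ^ 2)) := by
  have h2 : ∀ x y : ℝ≥0∞, (x + y) ^ 2 ≤ 2 * (x ^ 2 + y ^ 2) := fun x y => by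
    have := ENNReal.rpow_add_le_mul_rpow_add_rpow x y (p := 2) (by norm_num)
    norm_num at this
    exact this
  calc (a + (b + c + d)) ^ 2 = ((a + b) + (c + d)) ^ 2 := by ring
    _ ≤ 2 * ((a + b) ^ 2 + (c + d) ^ 2) := h2 _ _
    _ ≤ 2 * (2 * (a ^ 2 + b ^ 2) + 2 * (c ^ 2 + d ^ 2)) := by gcongr <;> exact h2 _ _
    _ = _ := by ring

/-- Hölder with exponents 3 and 3/2 for the squares, that is 1/2 = 1/6 + 1/3. -/
theorem lintegral_sq_mul_sq_le {f g : E3 → ℝ≥0∞} (hf : AEMeasurable f volume)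
    (hg : AEMeasurable g volume) :
    ∫⁻ y, f y ^ 2 * g y ^ 2
      ≤ ((∫⁻ y, f y ^ (6 : ℝ)) ^ (1 / 6 : ℝ)) ^ 2 * ((∫⁻ y, g y ^ (3 : ℝ)) ^ (1 / 3 : ℝ)) ^ 2 := by
  have hpq : (3 : ℝ).HolderConjugate (3 / 2) := by
    rw [Real.holderConjugate_iff]; norm_num
  have := ENNReal.lintegral_mul_le_Lp_mul_Lq volume hpq (hf.pow_const (2 : ℝ)) (hg.pow_const (2 : ℝ))
  simp only [Pi.mul_apply] at this
  simp_rw [← ENNReal.rpow_mul] at this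
  norm_num at this
  refine this.trans (le_of_eq ?_)
  rw [← ENNReal.rpow_natCast, ← ENNReal.rpow_mul, ← ENNReal.rpow_natCast, ← ENNReal.rpow_mul]
  norm_num

/-- The constant in the estimate, apart from the moment of the kernel. -/
def commConst : ℝ≥0∞ := 18 * (incrConst + gradConst)

theorem commConst_ne_top : commConst ≠ ⊤ :=
  ENNReal.mul_ne_top (by norm_num) (ENNReal.add_ne_top.2
    ⟨ENNReal.mul_ne_top ENNReal.ofReal_ne_top (ENNReal.mul_ne_top (by norm_num) potConst_ne_top),
      gradConst_ne_top⟩)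

/-- The pointwise Lipschitz part pairs with ρ in L²; the weighted part pairs ρ y_h in L⁶ with
increments of the potential in L³. Both yield a factor |z|. -/
theorem lintegral_incrBound_sq_le {a b : ℝ} (ha : 0 < a) (hab : a ≤ b) {f : E3 → ℝ}
    (hf : Measurable f) (hZ : lorentzNorm 3 1 f ≠ ⊤) {ρ : E3 → ℝ} (hρ : Continuous ρ) (z : E3) :
    ∫⁻ y, (‖ρ y‖ₑ * incrBound a b f (y + z) y) ^ 2
      ≤ (commConst * ‖z‖ₑ * lorentzNorm 3 1 f *
          (eLpNorm (fun x => ρ x • horiz x) 6 volume + eLpNorm ρ 2 volume)) ^ 2 := by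
  set Z := lorentzNorm 3 1 f with hZdef
  set N6 := eLpNorm (fun x => ρ x • horiz x) 6 volume with hN6
  set N2 := eLpNorm ρ 2 volume with hN2
  have hN2' : ∫⁻ y, ‖ρ y‖ₑ ^ 2 = N2 ^ 2 := by
    rw [hN2, eLpNorm_eq_lintegral_rpow_enorm_toReal (by norm_num) (by norm_num),
      ← ENNReal.rpow_natCast, ← ENNReal.rpow_mul]
    norm_num
  have hN6' : (∫⁻ y, (‖ρ y‖ₑ * ‖horiz y‖ₑ) ^ (6 : ℝ)) ^ (1 / 6 : ℝ) = N6 := by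
    rw [hN6, eLpNorm_eq_lintegral_rpow_enorm_toReal (by norm_num) (by norm_num)]
    simp_rw [enorm_smul]
    norm_num
  have hk := fun i => measurable_kernIncr ha hab i hf
  have hkz : ∀ i, Measurable fun y => ‖kernIncr a b i f (y + z) y‖ₑ := fun i =>
    ((hk i).comp (f := fun y : E3 => (y + z, y)) (by fun_prop)).enorm
  have hh := continuous_horiz.measurable
  have hρm := hρ.measurable
  have hL3 : ∀ i, (∫⁻ y, ‖kernIncr a b i f (y + z) y‖ₑ ^ (3 : ℝ)) ^ (1 / 3 : ℝ)
      ≤ gradConst * ‖z‖ₑ * Z := by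
    intro i
    have := ENNReal.rpow_le_rpow (lintegral_kern_sub_rpow_le ha hab i hf hZ z)
      (z := 1 / 3) (by norm_num)
    rw [← ENNReal.rpow_mul] at this
    norm_num at this
    simpa [kernIncr] using this
  set T : Fin 3 → E3 → ℝ≥0∞ := fun i y =>
    (‖ρ y‖ₑ * ‖horiz y‖ₑ) ^ 2 * ‖kernIncr a b i f (y + z) y‖ₑ ^ 2 with hT
  have hTm : ∀ i, Measurable (T i) := fun i =>
    ((hρm.enorm.mul hh.enorm).pow_const 2).mul ((hkz i).pow_const 2)
  have hTi : ∀ i, ∫⁻ y, T i y ≤ N6 ^ 2 * (gradConst * ‖z‖ₑ * Z) ^ 2 := by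
    intro i
    refine (lintegral_sq_mul_sq_le (f := fun y => ‖ρ y‖ₑ * ‖horiz y‖ₑ)
      (hρm.enorm.mul hh.enorm).aemeasurable (hkz i).aemeasurable).trans ?_
    rw [hN6']
    gcongr
    exact hL3 i
  calc ∫⁻ y, (‖ρ y‖ₑ * incrBound a b f (y + z) y) ^ 2
      ≤ ∫⁻ y, (4 * (9 * incrConst * ‖z‖ₑ * Z) ^ 2 * ‖ρ y‖ₑ ^ 2
          + 36 * (T 0 y + T 1 y + T 2 y)) := by
        refine lintegral_mono fun y => ?_
        rw [incrBound, add_sub_cancel_left, Fin.sum_univ_three, ← hZdef]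
        refine le_trans (le_of_eq ?_) ((sq_add_four_le (‖ρ y‖ₑ * (9 * incrConst * ‖z‖ₑ * Z))
          (‖ρ y‖ₑ * (3 * (‖horiz y‖ₑ * ‖kernIncr a b 0 f (y + z) y‖ₑ)))
          (‖ρ y‖ₑ * (3 * (‖horiz y‖ₑ * ‖kernIncr a b 1 f (y + z) y‖ₑ)))
          (‖ρ y‖ₑ * (3 * (‖horiz y‖ₑ * ‖kernIncr a b 2 f (y + z) y‖ₑ)))).trans (le_of_eq ?_))
        · ring
        · simp only [hT]; ring
    _ = 4 * (9 * incrConst * ‖z‖ₑ * Z) ^ 2 * N2 ^ 2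
          + 36 * ((∫⁻ y, T 0 y) + (∫⁻ y, T 1 y) + ∫⁻ y, T 2 y) := by
        rw [lintegral_add_left (by fun_prop), lintegral_const_mul _ (by fun_prop),
          lintegral_const_mul' _ _ (by norm_num), hN2',
          lintegral_add_left (f := fun y => T 0 y + T 1 y) ((hTm 0).add (hTm 1)),
          lintegral_add_left (hTm 0)]
    _ ≤ 4 * (9 * incrConst * ‖z‖ₑ * Z) ^ 2 * N2 ^ 2
          + 36 * (N6 ^ 2 * (gradConst * ‖z‖ₑ * Z) ^ 2 + N6 ^ 2 * (gradConst * ‖z‖ₑ * Z) ^ 2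
            + N6 ^ 2 * (gradConst * ‖z‖ₑ * Z) ^ 2) := by
        gcongr <;> exact hTi _
    _ = (18 * incrConst * ‖z‖ₑ * Z * N2) ^ 2 + 108 * (gradConst * ‖z‖ₑ * Z * N6) ^ 2 := by ring
    -- Rounding 108 up to 324 = 18² matches the first coefficient, 4 · 9² = 18².
    _ ≤ (18 * incrConst * ‖z‖ₑ * Z * N2) ^ 2 + 324 * (gradConst * ‖z‖ₑ * Z * N6) ^ 2 := by
        gcongr; norm_num
    _ = (18 * incrConst * ‖z‖ₑ * Z * N2) ^ 2 + (18 * gradConst * ‖z‖ₑ * Z * N6) ^ 2 := by ring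
    _ ≤ (18 * incrConst * ‖z‖ₑ * Z * N2 + 18 * gradConst * ‖z‖ₑ * Z * N6) ^ 2 := by
        rw [add_sq', add_assoc]
        gcongr
        exact le_self_add
    _ ≤ _ := by
        gcongr
        calc 18 * incrConst * ‖z‖ₑ * Z * N2 + 18 * gradConst * ‖z‖ₑ * Z * N6
            ≤ (18 * incrConst * ‖z‖ₑ * Z * N2 + 18 * gradConst * ‖z‖ₑ * Z * N6)
              + (18 * incrConst * ‖z‖ₑ * Z * N6 + 18 * gradConst * ‖z‖ₑ * Z * N2) := le_self_add
          _ = commConst * ‖z‖ₑ * Z * (N6 + N2) := by rw [commConst]; ring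

theorem one_div_succ_le (n : ℕ) : 1 / ((n : ℝ) + 1) ≤ (n : ℝ) + 1 := by
  have hn := n.cast_nonneg (α := ℝ)
  rw [div_le_iff₀ (by positivity)]; nlinarith

/-- Take a = 1/(n+1) and b = n+1. The regularised components converge pointwise to those of v,
whereas the regularised increments of ζ need not converge, hence a lower limit. -/
theorem enorm_sub_le_liminf_incrBound {v : E3 → E3} (hv : ContDiff ℝ 1 v) (hv2 : MemLp v 2 volume)
    (hax : IsAxisymmetricNoSwirl v) (hdiv : ∀ x, divergence v x = 0)
    (hZ : lorentzNorm 3 1 (fun x => omegaTheta v x / rad x) ≠ ⊤) (x y : E3) :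
    ‖v y - v x‖ₑ ≤ liminf (fun n : ℕ => incrBound (1 / ((n : ℝ) + 1)) ((n : ℝ) + 1)
      (fun x => omegaTheta v x / rad x) x y) atTop := by
  set ζ : E3 → ℝ := fun x => omegaTheta v x / rad x with hζ
  have hb := fun j x => tendsto_band (memLp_coord hv2 j) (contDiff_coord hv j).continuous x
  have h1 : Tendsto (fun n : ℕ => ∑ j, ‖band (1 / ((n : ℝ) + 1)) ((n : ℝ) + 1) (fun w => v w j) x
      - band (1 / ((n : ℝ) + 1)) ((n : ℝ) + 1) (fun w => v w j) y‖ₑ) atTop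
      (𝓝 (∑ j, ‖v x j - v y j‖ₑ)) :=
    tendsto_finsetSum _ fun j _ => ((hb j x).sub (hb j y)).enorm
  have h2 : ‖v y - v x‖ₑ ≤ ∑ j, ‖v x j - v y j‖ₑ := by
    rw [← (EuclideanSpace.basisFun (Fin 3) ℝ).sum_repr (v y - v x)]
    refine (enorm_sum_le _ _).trans (Finset.sum_le_sum fun j _ => ?_)
    rw [enorm_smul]
    have e1 : ‖(EuclideanSpace.basisFun (Fin 3) ℝ) j‖ₑ = 1 := by
      rw [← ofReal_norm, (EuclideanSpace.basisFun (Fin 3) ℝ).norm_eq_one, ENNReal.ofReal_one]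
    rw [e1, mul_one, ← enorm_neg]
    simp
  refine h2.trans ?_
  rw [← h1.liminf_eq]
  refine liminf_le_liminf (Eventually.of_forall fun n => ?_)
  have ha : (0 : ℝ) < 1 / ((n : ℝ) + 1) := by positivity
  refine (Finset.sum_le_sum fun j _ => enorm_band_sub_le hv hv2 hax hdiv hZ ha (one_div_succ_le n) x y j).trans ?_
  -- The sums over the components j of v and over the kernel index i give 3 · 3 = 9 Lipschitz terms
  -- and three copies of the weighted sum over i.
  rw [incrBound, Finset.sum_const, Finset.sum_add_distrib, Finset.sum_const]
  simp only [Finset.card_univ, Fintype.card_fin, nsmul_eq_mul]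
  refine le_of_eq ?_
  push_cast
  ring

/-- The commutator estimate, for a velocity field with controlled increments. -/
theorem lintegral_commutator_sq_le_of_liminf {v : E3 → E3} {ρ : E3 → ℝ} (hρ : Continuous ρ)
    (G : 𝓢(E3, E3 →L[ℝ] ℂ)) {D : ℕ → E3 × E3 → ℝ≥0∞} (hDm : ∀ n, Measurable (D n))
    (hD : ∀ x y, ‖v y - v x‖ₑ ≤ liminf (fun n => D n (x, y)) atTop) {K : ℝ≥0∞}
    (hK : ∀ n z, ∫⁻ y, (‖ρ y‖ₑ * D n (y + z, y)) ^ 2 ≤ (‖z‖ₑ * K) ^ 2) :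
    ∫⁻ x, ‖∫ y, ρ y • G (x - y) (v y - v x)‖ₑ ^ (2 : ℝ)
      ≤ ((∫⁻ z, ‖G z‖ₑ * ‖z‖ₑ) * K) ^ (2 : ℝ) := by
  have hGm : Measurable fun z => ‖G z‖ₑ := G.continuous.enorm.measurable
  have hρm : Measurable fun z => ‖ρ z‖ₑ := hρ.enorm.measurable
  set Φ : ℕ → E3 → E3 → ℝ≥0∞ := fun n x z => ‖ρ (x - z)‖ₑ * ‖G z‖ₑ * D n (x, x - z) with hΦ
  have hsub : Measurable fun p : E3 × E3 => p.1 - p.2 := measurable_fst.sub measurable_snd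
  have hΦm : ∀ n, Measurable (Function.uncurry (Φ n)) := fun n =>
    ((hρm.comp hsub).mul (hGm.comp measurable_snd)).mul
      ((hDm n).comp (measurable_fst.prodMk hsub))
  set A : ℕ → E3 → ℝ≥0∞ := fun n x => ∫⁻ z, Φ n x z with hA
  have hAm : ∀ n, Measurable (A n) := fun n => (hΦm n).lintegral_prod_right'
  have hpt : ∀ x, ‖∫ y, ρ y • G (x - y) (v y - v x)‖ₑ ≤ liminf (fun n => A n x) atTop := by
    intro x
    rw [← integral_sub_left_eq_self _ volume x]
    refine (enorm_integral_le_lintegral_enorm _).trans ?_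
    refine le_trans ?_ (lintegral_liminf_le fun n => (hΦm n).of_uncurry_left)
    refine lintegral_mono fun z => ?_
    have h1 := hD x (x - z)
    rw [sub_sub_cancel, enorm_smul]
    have h2 : ‖G z (v (x - z) - v x)‖ₑ ≤ ‖G z‖ₑ * ‖v (x - z) - v x‖ₑ := (G z).le_opENorm _
    calc _ ≤ ‖ρ (x - z)‖ₑ * ‖G z‖ₑ * liminf (fun n => D n (x, x - z)) atTop := by
          rw [mul_assoc]
          exact mul_le_mul_right (h2.trans (mul_le_mul_right h1 _)) _
      _ = _ := by
          rw [← ENNReal.liminf_const_mul_of_ne_top (ENNReal.mul_ne_top enorm_ne_top enorm_ne_top)]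
  -- Minkowski in z: for fixed z a translation in x turns the inner L² norm into the hypothesis at
  -- z, with weight |G(z)||z|K.
  have hn : ∀ n, ∫⁻ x, A n x ^ (2 : ℝ) ≤ ((∫⁻ z, ‖G z‖ₑ * ‖z‖ₑ) * K) ^ (2 : ℝ) := by
    intro n
    have hc : Measurable fun z => ‖G z‖ₑ * ‖z‖ₑ := hGm.mul measurable_enorm
    have hmink := lintegral_rpow_lintegral_le (μ := (volume : Measure E3))
      (ν := (volume : Measure E3)) (F := Φ n) (c := fun z => ‖G z‖ₑ * ‖z‖ₑ * K) (p := 2)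
      (hΦm n) (hc.mul_const K) (by norm_num) ?_
    · rwa [lintegral_mul_const _ hc] at hmink
    · intro z
      have h1 := hK n z
      rw [← lintegral_sub_right_eq_self _ z] at h1
      calc ∫⁻ x, Φ n x z ^ (2 : ℝ)
          = ‖G z‖ₑ ^ 2 * ∫⁻ x, (‖ρ (x - z)‖ₑ * D n (x - z + z, x - z)) ^ 2 := by
            rw [← lintegral_const_mul' _ _ (by simp)]
            refine lintegral_congr fun x => ?_
            rw [sub_add_cancel, ENNReal.rpow_two, hΦ]
            ring
        _ ≤ ‖G z‖ₑ ^ 2 * (‖z‖ₑ * K) ^ 2 := mul_le_mul_right h1 _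
        _ = (‖G z‖ₑ * ‖z‖ₑ * K) ^ (2 : ℝ) := by
            rw [ENNReal.rpow_two]; ring
  calc ∫⁻ x, ‖∫ y, ρ y • G (x - y) (v y - v x)‖ₑ ^ (2 : ℝ)
      ≤ ∫⁻ x, liminf (fun n => A n x ^ (2 : ℝ)) atTop := by
        refine lintegral_mono fun x => ?_
        have := (ENNReal.orderIsoRpow 2 (by norm_num)).liminf_apply (f := atTop)
          (u := fun n => A n x)
        simp only [ENNReal.orderIsoRpow_apply] at this
        rw [← this]
        exact ENNReal.rpow_le_rpow (hpt x) (by norm_num)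
    _ ≤ liminf (fun n => ∫⁻ x, A n x ^ (2 : ℝ)) atTop :=
        lintegral_liminf_le fun n => (hAm n).pow_const _
    _ ≤ liminf (fun _ : ℕ => ((∫⁻ z, ‖G z‖ₑ * ‖z‖ₑ) * K) ^ (2 : ℝ)) atTop :=
        liminf_le_liminf (Eventually.of_forall hn)
    _ = _ := liminf_const _

theorem lintegral_commutator_sq_le {v : E3 → E3} (hv : ContDiff ℝ 1 v) (hv2 : MemLp v 2 volume)
    (hax : IsAxisymmetricNoSwirl v) (hdiv : ∀ x, divergence v x = 0)
    (hZ : lorentzNorm 3 1 (fun x => omegaTheta v x / rad x) ≠ ⊤) {ρ : E3 → ℝ} (hρ : Continuous ρ)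
    (G : 𝓢(E3, E3 →L[ℝ] ℂ)) :
    ∫⁻ x, ‖∫ y, ρ y • G (x - y) (v y - v x)‖ₑ ^ (2 : ℝ)
      ≤ ((∫⁻ z, ‖G z‖ₑ * ‖z‖ₑ) * (commConst * lorentzNorm 3 1 (fun x => omegaTheta v x / rad x) *
          (eLpNorm (fun x => ρ x • horiz x) 6 volume + eLpNorm ρ 2 volume))) ^ (2 : ℝ) := by
  have hm : Measurable fun x => omegaTheta v x / rad x := measurable_omegaTheta_div hv
  have ha : ∀ n : ℕ, (0 : ℝ) < 1 / ((n : ℝ) + 1) := fun n => by positivity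
  refine lintegral_commutator_sq_le_of_liminf hρ G
    (D := fun n p => incrBound (1 / ((n : ℝ) + 1)) ((n : ℝ) + 1)
      (fun x => omegaTheta v x / rad x) p.1 p.2)
    (fun n => measurable_incrBound (ha n) (one_div_succ_le n) hm)
    (enorm_sub_le_liminf_incrBound hv hv2 hax hdiv hZ) fun n z => ?_
  refine (lintegral_incrBound_sq_le (ha n) (one_div_succ_le n) hm hZ hρ z).trans (le_of_eq ?_)
  ring

/-- An infinite Lorentz norm is treated apart, since the integral representation of v is then
unavailable. With 0 · ∞ = 0, it must be checked that ρ = 0 a.e. forces a zero commutator. -/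
theorem eLpNorm_commutator_le {v : E3 → E3} (hv : ContDiff ℝ 1 v) (hv2 : MemLp v 2 volume)
    (hax : IsAxisymmetricNoSwirl v) (hdiv : ∀ x, divergence v x = 0) {ρ : E3 → ℝ}
    (hρ : Continuous ρ) (hρ2 : MemLp ρ 2 volume) (G : 𝓢(E3, E3 →L[ℝ] ℂ)) {M : ℝ}
    (hM : ∫⁻ z, ‖G z‖ₑ * ‖z‖ₑ ≤ ENNReal.ofReal M) :
    eLpNorm (fun x => ∫ y, ρ y • G (x - y) (v y - v x)) 2 volume
      ≤ ENNReal.ofReal (max M 0 * commConst.toReal + 1) *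
        lorentzNorm 3 1 (fun x => omegaTheta v x / rad x) *
        (eLpNorm (fun x => ρ x • horiz x) 6 volume + eLpNorm ρ 2 volume) := by
  by_cases hZ : lorentzNorm 3 1 (fun x => omegaTheta v x / rad x) = ⊤
  · rcases eq_or_ne (eLpNorm ρ 2 volume) 0 with h0 | h0
    · rw [eLpNorm_eq_zero_iff hρ2.1 (by norm_num)] at h0
      have hF : ∀ x, ∫ y, ρ y • G (x - y) (v y - v x) = 0 := fun x => by
        rw [← integral_zero E3 ℂ]
        refine integral_congr_ae ?_
        filter_upwards [h0] with y hy
        rw [hy]; simp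
      rw [funext hF, eLpNorm_zero']
      exact zero_le
    -- The summand 1 in the constant makes it positive even if the moment bound is zero, so the
    -- right-hand side is truly infinite.
    · have hC : ENNReal.ofReal (max M 0 * commConst.toReal + 1) ≠ 0 := by
        rw [ENNReal.ofReal_ne_zero_iff]; positivity
      rw [hZ, ENNReal.mul_top hC, ENNReal.top_mul (by simp [h0])]
      exact le_top
  · have h := lintegral_commutator_sq_le hv hv2 hax hdiv hZ hρ G
    rw [eLpNorm_eq_lintegral_rpow_enorm_toReal (by norm_num) (by norm_num)]
    simp only [ENNReal.toReal_ofNat, one_div]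
    rw [ENNReal.rpow_inv_le_iff (by norm_num)]
    refine h.trans (ENNReal.rpow_le_rpow ?_ (by norm_num))
    have h1 : (∫⁻ z, ‖G z‖ₑ * ‖z‖ₑ) * commConst
        ≤ ENNReal.ofReal (max M 0 * commConst.toReal + 1) := by
      calc _ ≤ ENNReal.ofReal (max M 0) * ENNReal.ofReal commConst.toReal := by
            rw [ENNReal.ofReal_toReal commConst_ne_top]
            gcongr
            exact hM.trans (ENNReal.ofReal_le_ofReal (le_max_left _ _))
        _ = ENNReal.ofReal (max M 0 * commConst.toReal) :=
            (ENNReal.ofReal_mul (le_max_right _ _)).symm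
        _ ≤ _ := ENNReal.ofReal_le_ofReal (by linarith)
    rw [← mul_assoc, ← mul_assoc]
    gcongr

end AxiBoussinesq

end

theorem proposition3p2 (χ φ : AxiBoussinesq.E3 → ℝ)
    (hχφ : AxiBoussinesq.IsDyadicPartition χ φ) :
    ∃ C : ℝ, 0 < C ∧
      ∀ (v : AxiBoussinesq.E3 → AxiBoussinesq.E3) (ρ : AxiBoussinesq.E3 → ℝ),
        ContDiff ℝ 1 v → MemLp v 2 volume →
        AxiBoussinesq.IsAxisymmetricNoSwirl v →
        (∀ x, AxiBoussinesq.divergence v x = 0) →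
        ContDiff ℝ 1 ρ → MemLp ρ 2 volume →
        ∀ q : ℤ, -1 ≤ q →
          ∃ F : AxiBoussinesq.E3 → ℂ,
            AxiBoussinesq.IsBlockCommutator χ φ q v ρ F ∧
            eLpNorm F 2 volume ≤
              ENNReal.ofReal C *
                AxiBoussinesq.lorentzNorm 3 1
                  (fun x => AxiBoussinesq.omegaTheta v x / AxiBoussinesq.rad x) *
                (eLpNorm (fun x => ρ x • AxiBoussinesq.horiz x) 6 volume
                  + eLpNorm ρ 2 volume) := by
  obtain ⟨M, hM⟩ := AxiBoussinesq.exists_moment_le hχφ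
  -- The moment bound M depends on the partition alone and is uniform in q; the other factor is
  -- absolute.
  refine ⟨max M 0 * AxiBoussinesq.commConst.toReal + 1, by positivity, ?_⟩
  intro v ρ hv hv2 hax hdiv hρ hρ2 q hq
  exact ⟨_, AxiBoussinesq.isBlockCommutator_integral hχφ q hv hv2 hdiv hρ hρ2,
    AxiBoussinesq.eLpNorm_commutator_le hv hv2 hax hdiv hρ.continuous hρ2 _ (hM q hq)⟩
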